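/- Let $n\ge 3$, let $B$ be the open unit ball of $\mathbb{R}^n$, and let $h>0$. Consider a finite family $\mathcal{T}_h$ of nondegenerate closed $n$-simplices $T$ of diameter $h_T\le h$, with pairwise disjoint interiors, any two intersecting ones meeting exactly in a common face. Let $B_h$ be the interior of their union, and assume that $B_h\subset B$, that every vertex of the triangulation lying on $\partial B_h$ lies on $\partial B$, and that $|B\setminus B_h|\le h^2$. Assume that $\mathcal{T}_h$ is shape regular and uniform with constants $\sigma,\tau$: $h_T/\rho_T\le\sigma$ and $h/h_T\le\tau$ for all $T\in\mathcal{T}_h$, where $\rho_T$ is the radius of the largest ball contained in $T$. Let $V_h^n$ be the space of functions in $H^1_0(B)$ that vanish outside $B_h$ and are affine on each $T\in\mathcal{T}_h$. (i) Let $n=3$. There is a constant $C>0$ such that for all $\sigma,\tau$ there are $h_0>0$ and a function $r$ with $r(h)=o(1/|\log h|^2)$ as $h\to0^+$, such that for every $0<h<h_0$ and every such triangulation with constants $\sigma,\tau$ the minimum below is attained and $$\frac14+\frac{C}{|\log h|^2}\le \min_{0\ne v\in V_h^3}\frac{\int_B|\nabla v|^2\,dx}{\int_B|x|^{-2}|v|^2\,dx}\le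 \frac14+\frac{\pi^2}{|\log h|^2}+r(h).$$ (ii) The lower bound holds in every dimension: for every $n\ge3$ there is a constant $C_n>0$ such that for all $\sigma,\tau$ there is $h_0>0$ such that for every $0<h<h_0$ and every such triangulation with constants $\sigma,\tau$ the minimum below is attained and $$\min_{0\ne v\in V_h^n}\frac{\int_B|\nabla v|^2\,dx}{\int_B|x|^{-2}|v|^2\,dx}\ge\frac{(n-2)^2}{4}+\frac{C_n}{|\log h|^2}.$$ -/

import Mathlib

open scoped ContDiff Topology ENNReal

noncomputable section

namespace HardyFEM

/-- Euclidean space `ℝⁿ`. -/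
abbrev E (n : ℕ) : Type := EuclideanSpace ℝ (Fin n)

/-! ### Sobolev functions -/

/-- Test functions `C_c^∞(Ω)`. -/
def IsTest {n : ℕ} (Ω : Set (E n)) (φ : E n → ℝ) : Prop :=
  ContDiff ℝ ∞ φ ∧ HasCompactSupport φ ∧ tsupport φ ⊆ Ω

/-- `v ∈ H¹(Ω)` with weak gradient `G`. -/
structure MemH1 {n : ℕ} (Ω : Set (E n)) (v : E n → ℝ) (G : E n → E n) : Prop where
  memLp : MeasureTheory.MemLp v 2 (MeasureTheory.volume.restrict Ω)
  memLp_grad : MeasureTheory.MemLp G 2 (MeasureTheory.volume.restrict Ω)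
  weak_grad : ∀ φ : E n → ℝ, IsTest Ω φ →
    ∫ x in Ω, v x • gradient φ x = - ∫ x in Ω, φ x • G x

/-- `v ∈ H¹₀(Ω)` with weak gradient `G`: an `H¹(Ω)` function in the closure of `C_c^∞(Ω)`
for the `H¹` norm. -/
structure MemH10 {n : ℕ} (Ω : Set (E n)) (v : E n → ℝ) (G : E n → E n) : Prop
    extends MemH1 Ω v G where
  approx : ∀ ε : ℝ≥0∞, 0 < ε → ∃ φ : E n → ℝ, IsTest Ω φ ∧
    MeasureTheory.eLpNorm (fun x => v x - φ x) 2 (MeasureTheory.volume.restrict Ω) < ε ∧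
    MeasureTheory.eLpNorm (fun x => G x - gradient φ x) 2
      (MeasureTheory.volume.restrict Ω) < ε

/-! ### Triangulations -/

/-- The closed (possibly degenerate) simplex with vertex set `s`. -/
def cell {n : ℕ} (s : Finset (E n)) : Set (E n) := convexHull ℝ (s : Set (E n))

/-- The diameter `h_T` of the element with vertex set `s`. -/
def cellDiam {n : ℕ} (s : Finset (E n)) : ℝ := Metric.diam (cell s)

/-- The inradius `ρ_T`: the radius of the largest ball contained in the element. -/
def inradius {n : ℕ} (s : Finset (E n)) : ℝ :=
  sSup {ρ : ℝ | ∃ c : E n, Metric.closedBall c ρ ⊆ cell s}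

/-- A finite conforming affine triangulation. Each element is a nondegenerate `n`-simplex (an
invertible affine image of the unit simplex), recorded by its vertex set; distinct elements have
disjoint interiors and meet, if at all, exactly in the face spanned by their common vertices. -/
structure Triangulation (n : ℕ) where
  cells : Finset (Finset (E n))
  card_eq : ∀ s ∈ cells, s.card = n + 1
  affineIndependent : ∀ s ∈ cells, AffineIndependent ℝ (fun p : s => (p : E n))
  interior_disjoint : ∀ s ∈ cells, ∀ t ∈ cells, s ≠ t →
    Disjoint (interior (cell s)) (interior (cell t))
  inter_eq : ∀ s ∈ cells, ∀ t ∈ cells, s ≠ t → (cell s ∩ cell t).Nonempty →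
    cell s ∩ cell t = convexHull ℝ ((s : Set (E n)) ∩ (t : Set (E n)))

/-- The open polyhedral domain covered by the triangulation. -/
def Triangulation.domain {n : ℕ} (𝒯 : Triangulation n) : Set (E n) :=
  interior (⋃ s ∈ 𝒯.cells, cell s)

/-- `𝒯` is a triangulation of size `h` of a polyhedral approximation `B_h = 𝒯.domain` of the unit
ball, shape regular with constant `σ` and uniform with constant `τ`. -/
structure IsBallMesh {n : ℕ} (𝒯 : Triangulation n) (h σ τ : ℝ) : Prop where
  diam_le : ∀ s ∈ 𝒯.cells, cellDiam s ≤ h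
  shape_regular : ∀ s ∈ 𝒯.cells, cellDiam s / inradius s ≤ σ
  uniform : ∀ s ∈ 𝒯.cells, h / cellDiam s ≤ τ
  domain_subset : 𝒯.domain ⊆ Metric.ball 0 1
  boundary_vertices : ∀ s ∈ 𝒯.cells, ∀ p ∈ s, p ∈ frontier 𝒯.domain → p ∈ Metric.sphere 0 1
  volume_diff : MeasureTheory.volume (Metric.ball 0 1 \ 𝒯.domain) ≤ ENNReal.ofReal (h ^ 2)

/-! ### The finite element space and the discrete Hardy quotients -/

/-- The finite element space: functions in `H¹₀(B)` (extended by zero) that vanish outside `B_h` and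
are affine on each element. -/
def Triangulation.feSpace {n : ℕ} (𝒯 : Triangulation n) : Set (E n → ℝ) :=
  {v | (∃ G, MemH10 (Metric.ball 0 1) v G) ∧
    (∀ x, x ∉ 𝒯.domain → v x = 0) ∧
    ∀ s ∈ 𝒯.cells, ∃ f : E n →ᵃ[ℝ] ℝ, Set.EqOn v f (cell s)}

/-- The Hardy quotients `∫_B |∇v|² / ∫_B |x|⁻² v²` of the nonzero functions `v` of the finite
element space; the discrete Hardy constant is the minimum of this set. -/
def Triangulation.hardyQuotients {n : ℕ} (𝒯 : Triangulation n) : Set ℝ :=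
  {q | ∃ v G, v ∈ 𝒯.feSpace ∧ v ≠ 0 ∧ MemH10 (Metric.ball 0 1) v G ∧
    q = (∫ x in Metric.ball (0 : E n) 1, ‖G x‖ ^ 2) /
      (∫ x in Metric.ball (0 : E n) 1, (‖x‖ ^ 2)⁻¹ * v x ^ 2)}

end HardyFEM

end

/-! Lower bound. For a radial field `Q x • x`, integrating `φ² div(Q x)` by parts and completing a
square bounds `∫ |∇φ|²` below by `∫ φ² (div(Q x) - |Q x|²)`. The ground state `|x|^(-(n-2)/2) (2 -
log |x|)^(1/2)` has minus its logarithmic gradient of this form, and it gives Hardy's weight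
`(n-2)²/4 · |x|⁻²` plus the gain `|x|⁻² / (2 (2 - log |x|))²`, which is at least a multiple of
`|x|⁻² / |log R|²` where `|x| ≥ R`, for small `R` (`hardy_integral`). A continuous near-optimiser
would put its mass ever closer to the origin, out of reach of this gain. A finite element function
cannot: on a shape regular, uniform mesh its supremum is controlled by `h^(-n/2)` times its weighted
norm (`IsBallMesh.inverse_estimate`), so the ball of radius `R = h^(n+1)` carries at most half of
the denominator. Since `|log R| = (n+1) |log h|`, the gain has the claimed order
(`hardyQuotient_lower_bound`).

Upper bound, `n = 3`. With `u(x) = |x|^(-1/2) g(log |x| - log r)`, polar coordinates turn numerator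
and denominator into the same multiple of `∫ (g' - g/2)²` and `∫ g²`. For `g` vanishing at the ends
of `[0, L]` the first is `∫ g'² + (1/4) ∫ g²`, so the best excess over `1/4` is the Dirichlet
eigenvalue `π²/L²`; a smoothly cut-off sine attains it up to `O(L⁻³)` (`exists_profile`,
`exists_radial_test`). Nodal interpolation of `u` costs `O((h/r)²)` in Dirichlet energy, by a Taylor
estimate on each cell (`IsBallMesh.norm_gradient_interp_sub_le`), and Hardy's inequality transfers
this to the denominator (`hardy_perturbation`), so the quotient moves by `O(h/r)`. With `r = h |log
h|³` and `L` maximal subject to `r e^L ≤ 1/2`, one has `L ~ |log h|`, and all errors are `o(|log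
h|⁻²)`.

Attainment. The space has finite dimension, and the quotient is continuous and homogeneous of degree
zero off the origin. The space is nontrivial because boundary vertices lie on the unit sphere and
the volume condition excludes a missing core, so the mesh covers the ball of radius `3/4`
(`IsBallMesh.ball_subset_domain`). -/

noncomputable section

namespace HardyFEM

open MeasureTheory Filter Set Metric
open scoped NNReal Convolution

variable {n : ℕ}

/-! ### Sobolev functions: algebra and uniqueness of the weak gradient -/


lemma IsTest.gradient_memLp {Ω : Set (E n)} {φ : E n → ℝ} (hφ : IsTest Ω φ) :
    Continuous (gradient φ) ∧ HasCompactSupport (gradient φ) := by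
  constructor
  · exact (InnerProductSpace.toDual ℝ (E n)).symm.continuous.comp
      (hφ.1.continuous_fderiv (by simp))
  · exact (hφ.2.1.fderiv ℝ).comp_left (g := (InnerProductSpace.toDual ℝ (E n)).symm) (by simp)

lemma gradient_add_of_differentiable {φ ψ : E n → ℝ} (hφ : Differentiable ℝ φ)
    (hψ : Differentiable ℝ ψ) (x : E n) :
    gradient (fun y => φ y + ψ y) x = gradient φ x + gradient ψ x := by
  simp only [gradient]
  rw [fderiv_fun_add (hφ x) (hψ x), map_add]

lemma gradient_const_smul_of_differentiable {φ : E n → ℝ} (hφ : Differentiable ℝ φ) (c : ℝ)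
    (x : E n) : gradient (fun y => c * φ y) x = c • gradient φ x := by
  simp only [gradient]
  rw [fderiv_const_mul (hφ x), map_smul]

lemma IsTest.differentiable {Ω : Set (E n)} {φ : E n → ℝ} (hφ : IsTest Ω φ) :
    Differentiable ℝ φ := hφ.1.differentiable (by simp)

lemma IsTest.add {Ω : Set (E n)} {φ ψ : E n → ℝ} (hφ : IsTest Ω φ) (hψ : IsTest Ω ψ) :
    IsTest Ω (fun x => φ x + ψ x) :=
  ⟨hφ.1.add hψ.1, hφ.2.1.add hψ.2.1,
    (tsupport_add φ ψ).trans (union_subset hφ.2.2 hψ.2.2)⟩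

lemma IsTest.const_mul {Ω : Set (E n)} {φ : E n → ℝ} (hφ : IsTest Ω φ) (c : ℝ) :
    IsTest Ω (fun x => c * φ x) :=
  ⟨contDiff_const.mul hφ.1, hφ.2.1.mul_left,
    (closure_mono (Function.support_mul_subset_right _ _)).trans hφ.2.2⟩

lemma IsTest.integrable_smul_gradient {Ω : Set (E n)} {φ v : E n → ℝ} (hφ : IsTest Ω φ)
    (hv : MemLp v 2 (volume.restrict Ω)) :
    Integrable (fun x => v x • gradient φ x) (volume.restrict Ω) := by
  have h := hφ.gradient_memLp
  have h2 : MemLp (gradient φ) 2 (volume.restrict Ω) :=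
    (h.1.memLp_of_hasCompactSupport h.2 (μ := volume)).mono_measure Measure.restrict_le_self
  exact memLp_one_iff_integrable.1 (h2.smul hv)

lemma IsTest.integrable_smul {Ω : Set (E n)} {φ : E n → ℝ} {G : E n → E n} (hφ : IsTest Ω φ)
    (hG : MemLp G 2 (volume.restrict Ω)) :
    Integrable (fun x => φ x • G x) (volume.restrict Ω) := by
  have h2 : MemLp φ 2 (volume.restrict Ω) :=
    (hφ.1.continuous.memLp_of_hasCompactSupport hφ.2.1 (μ := volume)).mono_measure
      Measure.restrict_le_self
  exact memLp_one_iff_integrable.1 (hG.smul h2)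

lemma MemH1.add {Ω : Set (E n)} {v w : E n → ℝ} {G H : E n → E n} (hv : MemH1 Ω v G)
    (hw : MemH1 Ω w H) : MemH1 Ω (fun x => v x + w x) (fun x => G x + H x) where
  memLp := hv.memLp.add hw.memLp
  memLp_grad := hv.memLp_grad.add hw.memLp_grad
  weak_grad φ hφ := by
    simp only [add_smul, smul_add]
    rw [integral_add (hφ.integrable_smul_gradient hv.memLp)
      (hφ.integrable_smul_gradient hw.memLp), integral_add (hφ.integrable_smul hv.memLp_grad)
      (hφ.integrable_smul hw.memLp_grad), hv.weak_grad φ hφ, hw.weak_grad φ hφ, neg_add]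

lemma MemH1.const_mul {Ω : Set (E n)} {v : E n → ℝ} {G : E n → E n} (hv : MemH1 Ω v G) (c : ℝ) :
    MemH1 Ω (fun x => c * v x) (fun x => c • G x) where
  memLp := hv.memLp.const_mul c
  memLp_grad := hv.memLp_grad.const_smul c
  weak_grad φ hφ := by
    have h1 : ∀ x, (c * v x) • gradient φ x = c • (v x • gradient φ x) := fun x => mul_smul _ _ _
    have h2 : ∀ x, φ x • c • G x = c • (φ x • G x) := fun x => smul_comm _ _ _
    simp only [h1, h2]
    rw [integral_smul, integral_smul, hv.weak_grad φ hφ, smul_neg]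

lemma IsTest.aestronglyMeasurable {Ω : Set (E n)} {φ : E n → ℝ} (hφ : IsTest Ω φ)
    (μ : Measure (E n)) : AEStronglyMeasurable φ μ ∧ AEStronglyMeasurable (gradient φ) μ :=
  ⟨hφ.1.continuous.aestronglyMeasurable, hφ.gradient_memLp.1.aestronglyMeasurable⟩

lemma MemH10.add {Ω : Set (E n)} {v w : E n → ℝ} {G H : E n → E n} (hv : MemH10 Ω v G)
    (hw : MemH10 Ω w H) : MemH10 Ω (fun x => v x + w x) (fun x => G x + H x) where
  toMemH1 := hv.toMemH1.add hw.toMemH1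
  approx ε hε := by
    have hε2 : 0 < ε / 2 := ENNReal.div_pos hε.ne' (by simp)
    obtain ⟨φ, hφ, h1, h2⟩ := hv.approx _ hε2
    obtain ⟨ψ, hψ, h3, h4⟩ := hw.approx _ hε2
    have hmφ := hφ.aestronglyMeasurable (volume.restrict Ω)
    have hmψ := hψ.aestronglyMeasurable (volume.restrict Ω)
    refine ⟨_, hφ.add hψ, ?_, ?_⟩
    · calc _ = eLpNorm ((fun x => v x - φ x) + (fun x => w x - ψ x)) 2 (volume.restrict Ω) := by
            congr 1; ext x; simp only [Pi.add_apply]; ring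
        _ ≤ _ := eLpNorm_add_le (hv.memLp.1.sub hmφ.1) (hw.memLp.1.sub hmψ.1) (by norm_num)
        _ < ε / 2 + ε / 2 := ENNReal.add_lt_add h1 h3
        _ = ε := ENNReal.add_halves ε
    · calc _ = eLpNorm ((fun x => G x - gradient φ x) + (fun x => H x - gradient ψ x)) 2
              (volume.restrict Ω) := by
            congr 1; ext1 x
            simp only [Pi.add_apply,
              gradient_add_of_differentiable hφ.differentiable hψ.differentiable]
            abel
        _ ≤ _ := eLpNorm_add_le (hv.memLp_grad.1.sub hmφ.2) (hw.memLp_grad.1.sub hmψ.2)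
              (by norm_num)
        _ < ε / 2 + ε / 2 := ENNReal.add_lt_add h2 h4
        _ = ε := ENNReal.add_halves ε

lemma MemH10.const_mul {Ω : Set (E n)} {v : E n → ℝ} {G : E n → E n} (hv : MemH10 Ω v G)
    (c : ℝ) : MemH10 Ω (fun x => c * v x) (fun x => c • G x) where
  toMemH1 := hv.toMemH1.const_mul c
  approx ε hε := by
    obtain ⟨δ, hδ, hδε⟩ : ∃ δ : ℝ≥0∞, 0 < δ ∧ ∀ a < δ, ‖c‖ₑ * a < ε := by
      by_cases hc : c = 0
      · exact ⟨1, by simp, fun a _ => by simpa [hc] using hε⟩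
      · refine ⟨ε / ‖c‖ₑ, ENNReal.div_pos hε.ne' (by simp), fun a ha => ?_⟩
        rw [mul_comm]
        exact (ENNReal.lt_div_iff_mul_lt (by simp [hc]) (by simp)).1 ha
    obtain ⟨φ, hφ, h1, h2⟩ := hv.approx δ hδ
    refine ⟨_, hφ.const_mul c, ?_, ?_⟩
    · calc _ = eLpNorm (c • (fun x => v x - φ x)) 2 (volume.restrict Ω) := by
            congr 1; ext x; simp only [Pi.smul_apply, smul_eq_mul]; ring
        _ = ‖c‖ₑ * eLpNorm (fun x => v x - φ x) 2 (volume.restrict Ω) := eLpNorm_const_smul ..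
        _ < ε := hδε _ h1
    · calc _ = eLpNorm (c • (fun x => G x - gradient φ x)) 2 (volume.restrict Ω) := by
            congr 1; ext1 x
            simp only [Pi.smul_apply, gradient_const_smul_of_differentiable hφ.differentiable,
              smul_sub]
        _ = ‖c‖ₑ * eLpNorm (fun x => G x - gradient φ x) 2 (volume.restrict Ω) :=
            eLpNorm_const_smul ..
        _ < ε := hδε _ h2

lemma MemH10.zero (Ω : Set (E n)) : MemH10 Ω (fun _ => 0) (fun _ => 0) where
  memLp := by simp
  memLp_grad := by simp
  weak_grad φ _ := by simp
  approx ε hε := ⟨fun _ => 0, ⟨contDiff_const, HasCompactSupport.zero, by simp [tsupport]⟩,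
    by simpa using hε, by simpa [gradient] using hε⟩

lemma MemH10.sub {Ω : Set (E n)} {v w : E n → ℝ} {G H : E n → E n} (hv : MemH10 Ω v G)
    (hw : MemH10 Ω w H) : MemH10 Ω (fun x => v x - w x) (fun x => G x - H x) := by
  simpa [sub_eq_add_neg] using hv.add (hw.const_mul (-1))

lemma MemH10.sum {ι : Type*} {Ω : Set (E n)} (s : Finset ι) {v : ι → E n → ℝ}
    {G : ι → E n → E n} (h : ∀ i ∈ s, MemH10 Ω (v i) (G i)) :
    MemH10 Ω (fun x => ∑ i ∈ s, v i x) (fun x => ∑ i ∈ s, G i x) := by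
  classical
  induction s using Finset.induction_on with
  | empty => simpa using MemH10.zero Ω
  | insert a s ha ih =>
    simp only [Finset.sum_insert ha]
    exact (h a (by simp)).add (ih fun i hi => h i (by simp [hi]))

/-- The difference of the two gradients integrates to zero against every test function, so the
fundamental lemma of the calculus of variations applies. The Hardy quotient thus depends on `v`
alone. -/
lemma MemH1.grad_ae_eq {Ω : Set (E n)} (hΩ : IsOpen Ω) {v : E n → ℝ} {G H : E n → E n}
    (hG : MemH1 Ω v G) (hH : MemH1 Ω v H) : G =ᵐ[volume.restrict Ω] H := by
  have hint : MemLp (fun x => G x - H x) 2 (volume.restrict Ω) := hG.memLp_grad.sub hH.memLp_grad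
  have hloc : LocallyIntegrableOn (fun x => G x - H x) Ω volume :=
    locallyIntegrableOn_of_locallyIntegrable_restrict (hint.locallyIntegrable (by norm_num))
  have := hΩ.ae_eq_zero_of_integral_contDiff_smul_eq_zero hloc (fun φ h1 h2 h3 => by
    have hφ : IsTest Ω φ := ⟨h1, h2, h3⟩
    rw [← setIntegral_eq_integral_of_forall_compl_eq_zero (s := Ω)]
    · simp only [smul_sub]
      rw [integral_sub (hφ.integrable_smul hG.memLp_grad) (hφ.integrable_smul hH.memLp_grad),
        sub_eq_zero, ← neg_inj, ← hG.weak_grad φ hφ, ← hH.weak_grad φ hφ]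
    · intro x hx
      rw [image_eq_zero_of_notMem_tsupport (fun h => hx (h3 h)), zero_smul])
  rw [EventuallyEq, ae_restrict_iff' hΩ.measurableSet]
  filter_upwards [this] with x hx hxΩ using sub_eq_zero.1 (hx hxΩ)

/-! ### Lipschitz functions with compact support -/

lemma measurable_gradient (v : E n → ℝ) : Measurable (gradient v) :=
  (InnerProductSpace.toDual ℝ (E n)).symm.continuous.measurable.comp (measurable_fderiv ℝ v)

lemma norm_gradient_le_of_lipschitz {v : E n → ℝ} {C : ℝ≥0} (hv : LipschitzWith C v) (x : E n) :
    ‖gradient v x‖ ≤ C := by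
  simp only [gradient, LinearIsometryEquiv.norm_map]
  exact norm_fderiv_le_of_lipschitz ℝ hv

lemma gradient_eq_zero_of_notMem_tsupport {v : E n → ℝ} {x : E n} (hx : x ∉ tsupport v) :
    gradient v x = 0 := by
  simp only [gradient]
  rw [image_eq_zero_of_notMem_tsupport (f := fderiv ℝ v), map_zero]
  exact fun h => hx (tsupport_fderiv_subset ℝ h)

/-- By Rademacher's theorem the pointwise gradient exists almost everywhere; integration by parts
for line derivatives, one direction at a time, identifies it with the weak gradient. -/
lemma MemH1.of_lipschitz {Ω : Set (E n)} {v : E n → ℝ} {C : ℝ≥0}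
    (hv : LipschitzWith C v) (hc : HasCompactSupport v) : MemH1 Ω v (gradient v) := by
  have hgrad : MemLp (gradient v) 2 volume := by
    have hb : MemLp (gradient v) 2 (volume.restrict (tsupport v)) := by
      have : IsFiniteMeasure (volume.restrict (tsupport v)) :=
        ⟨by simpa using hc.measure_lt_top⟩
      exact MemLp.of_bound (measurable_gradient v).aestronglyMeasurable C
        (.of_forall (norm_gradient_le_of_lipschitz hv))
    have hi : (tsupport v).indicator (gradient v) = gradient v := by
      refine indicator_eq_self.2 fun x hx => ?_
      by_contra h
      exact hx (gradient_eq_zero_of_notMem_tsupport h)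
    rw [← hi]
    exact (memLp_indicator_iff_restrict (isClosed_tsupport v).measurableSet).2 hb
  refine ⟨(hv.continuous.memLp_of_hasCompactSupport hc).mono_measure Measure.restrict_le_self,
    hgrad.mono_measure Measure.restrict_le_self, fun φ hφ => ?_⟩
  have h1 : ∫ x in Ω, v x • gradient φ x = ∫ x, v x • gradient φ x :=
    setIntegral_eq_integral_of_forall_compl_eq_zero fun x hx => by
      rw [gradient_eq_zero_of_notMem_tsupport (fun h => hx (hφ.2.2 h)), smul_zero]
  have h2 : ∫ x in Ω, φ x • gradient v x = ∫ x, φ x • gradient v x :=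
    setIntegral_eq_integral_of_forall_compl_eq_zero fun x hx => by
      rw [image_eq_zero_of_notMem_tsupport (fun h => hx (hφ.2.2 h)), zero_smul]
  rw [h1, h2]
  have hi1 : Integrable (fun x => v x • gradient φ x) volume :=
    (hv.continuous.smul hφ.gradient_memLp.1).integrable_of_hasCompactSupport hc.smul_right
  have hi2 : Integrable (fun x => φ x • gradient v x) volume :=
    memLp_one_iff_integrable.1
      (hgrad.smul (hφ.1.continuous.memLp_of_hasCompactSupport hφ.2.1 (p := 2)))
  refine ext_inner_left ℝ fun e => ?_
  rw [inner_neg_right, ← integral_inner hi1, ← integral_inner hi2]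
  obtain ⟨D, hD⟩ : ∃ D, LipschitzWith D φ :=
    ContDiff.lipschitzWith_of_hasCompactSupport hφ.2.1 hφ.1 (by simp)
  have key := hv.integral_lineDeriv_mul_eq (μ := volume) hD hφ.2.1 e
  have e1 : ∫ x, inner ℝ e (φ x • gradient v x) = ∫ x, lineDeriv ℝ v x e * φ x := by
    refine integral_congr_ae ?_
    filter_upwards [hv.ae_differentiableAt] with x hx
    rw [inner_smul_right, inner_gradient_right, hx.lineDeriv_eq_fderiv]
    simp [mul_comm]
  have e2 : ∫ x, inner ℝ e (v x • gradient φ x) = - ∫ x, lineDeriv ℝ φ x (-e) * v x := by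
    rw [← integral_neg]
    refine integral_congr_ae (.of_forall fun x => ?_)
    simp only
    rw [inner_smul_right, inner_gradient_right, (hφ.differentiable x).lineDeriv_eq_fderiv]
    simp [mul_comm]
  rw [e1, e2, key]

lemma tendsto_eLpNorm_two_of_bounded {F : Type*} [NormedAddCommGroup F] {μ : Measure (E n)}
    [IsFiniteMeasure μ] {f : ℕ → E n → F} (M : ℝ≥0∞) (hM : M ≠ ⊤)
    (hf : ∀ k, AEStronglyMeasurable (f k) μ) (hb : ∀ k x, ‖f k x‖ₑ ≤ M)
    (hlim : ∀ᵐ x ∂μ, Tendsto (fun k => f k x) atTop (𝓝 0)) :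
    Tendsto (fun k => eLpNorm (f k) 2 μ) atTop (𝓝 0) := by
  have h : Tendsto (fun k => ∫⁻ x, ‖f k x‖ₑ ^ (2:ℝ) ∂μ) atTop (𝓝 (∫⁻ _, 0 ∂μ)) := by
    refine tendsto_lintegral_of_dominated_convergence' (fun _ => M ^ (2:ℝ))
      (fun k => (hf k).enorm.pow_const _) (fun k => .of_forall fun x => ?_) ?_ ?_
    · exact ENNReal.rpow_le_rpow (hb k x) (by norm_num)
    · rw [lintegral_const]
      exact ENNReal.mul_ne_top (ENNReal.rpow_ne_top_of_nonneg (by norm_num) hM)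
        (measure_ne_top _ _)
    · filter_upwards [hlim] with x hx
      have h2 := (ENNReal.continuous_rpow_const (y := 2)).tendsto 0 |>.comp
        (by simpa using hx.enorm)
      simpa [Function.comp_def] using h2
  have h3 := (ENNReal.continuous_rpow_const (y := (1/2:ℝ))).tendsto 0 |>.comp
    (by simpa using h)
  simp only [eLpNorm_eq_lintegral_rpow_enorm_toReal (p := 2) (by norm_num) (by norm_num)]
  simpa [Function.comp_def] using h3

/-- Mollification: the smoothed functions keep their supports in `Ω`, their gradients are bounded by
the same Lipschitz constant and converge at almost every point, so dominated convergence on the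
finite measure space `Ω` gives `H¹` convergence. -/
lemma MemH10.of_lipschitz {Ω : Set (E n)} (hΩ : IsOpen Ω) (hΩf : volume Ω ≠ ⊤) {v : E n → ℝ}
    {C : ℝ≥0} (hv : LipschitzWith C v) (hc : HasCompactSupport v) (hs : tsupport v ⊆ Ω) :
    MemH10 Ω v (gradient v) where
  toMemH1 := MemH1.of_lipschitz hv hc
  approx ε hε := by
    obtain ⟨δ, hδ, hδΩ⟩ := hc.isCompact.exists_cthickening_subset_open hΩ hs
    -- Outer radii at most `δ` keep the supports in the thickening contained in `Ω`; the fixed ratio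
    -- 2 of the radii is what Lebesgue differentiation along the bumps needs.
    let ρ : ℕ → ContDiffBump (0 : E n) := fun k =>
      ⟨δ / (k + 2) / 2, δ / (k + 2), by positivity, by
        have : 0 < δ / ((k:ℝ) + 2) := by positivity
        linarith⟩
    have hρ0 : Tendsto (fun k => (ρ k).rOut) atTop (𝓝 0) := by
      have h1 : Tendsto (fun k : ℕ => (k : ℝ) + 2) atTop atTop :=
        tendsto_atTop_add_const_right _ _ tendsto_natCast_atTop_atTop
      simpa [ρ] using h1.const_div_atTop δ
    have hρ2 : ∀ᶠ k in atTop, (ρ k).rOut ≤ 2 * (ρ k).rIn :=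
      .of_forall fun k => by simp only [ρ]; linarith
    let φ : ℕ → E n → ℝ := fun k =>
      ((ρ k).normed volume ⋆[ContinuousLinearMap.lsmul ℝ ℝ, volume] v)
    have hvint : LocallyIntegrable v volume := hv.continuous.locallyIntegrable
    have hsm : ∀ k, ContDiff ℝ ∞ (φ k) := fun k =>
      HasCompactSupport.contDiff_convolution_left _ (ρ k).hasCompactSupport_normed
        (ρ k).contDiff_normed hvint
    have hφdef : ∀ k x, φ k x = ∫ y, v (x - y) * (ρ k).normed volume y := fun k x => by
      simp [φ, convolution_def, mul_comm]
    have hρint : ∀ k, Integrable ((ρ k).normed (volume : Measure (E n))) volume :=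
      fun k => (ρ k).integrable_normed
    have hlipc : ∀ x, LipschitzWith C (fun y => v (x - y)) := fun x => by
      have := hv.comp (LipschitzWith.of_dist_le_mul (K := 1) (f := fun y : E n => x - y)
        (fun a b => by simp only [dist_sub_left, NNReal.coe_one, one_mul, le_refl]))
      simpa [Function.comp_def] using this
    -- The derivative falls on the merely Lipschitz factor: its difference quotients, integrated
    -- against the kernel, converge to the integral of its line derivative.
    have hline : ∀ k x e, fderiv ℝ (φ k) x e =
        ((ρ k).normed volume ⋆[ContinuousLinearMap.lsmul ℝ ℝ, volume]
          (fun y => lineDeriv ℝ v y e)) x := by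
      intro k x e
      have h1 : Tendsto (fun t : ℝ => t⁻¹ • (φ k (x + t • e) - φ k x)) (𝓝[>] 0)
          (𝓝 (fderiv ℝ (φ k) x e)) :=
        (((hsm k).differentiable (by simp) x).hasFDerivAt.hasLineDerivAt e).tendsto_slope_zero_right
      have h2 := (hlipc x).integral_inv_smul_sub_mul_tendsto_integral_lineDeriv_mul (hρint k) (-e)
      have h3 : ∀ t : ℝ, t⁻¹ • (φ k (x + t • e) - φ k x) =
          ∫ y, (t⁻¹ • (v (x - (y + t • -e)) - v (x - y))) * (ρ k).normed volume y := by
        intro t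
        have hi : ∀ z, Integrable (fun y => v (z - y) * (ρ k).normed volume y) volume := fun z =>
          ((hlipc z).continuous.mul (ρ k).continuous_normed).integrable_of_hasCompactSupport
            (ρ k).hasCompactSupport_normed.mul_left
        rw [hφdef, hφdef, ← integral_sub (hi _) (hi _), ← integral_smul]
        congr 1
        ext y
        rw [show x - (y + t • -e) = x + t • e - y by rw [smul_neg]; abel]
        simp only [smul_eq_mul]
        ring
      simp only [h3] at h1
      rw [tendsto_nhds_unique h1 h2, convolution_def]
      congr 1
      ext y
      have : lineDeriv ℝ (fun y => v (x - y)) y (-e) = lineDeriv ℝ v (x - y) e := by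
        simp only [lineDeriv]
        congr 1
        ext t
        congr 1
        rw [smul_neg]; abel
      rw [this]
      simp [mul_comm]
    have hsupp : ∀ k, tsupport (φ k) ⊆ cthickening δ (tsupport v) := by
      intro k
      refine closure_minimal ?_ isClosed_cthickening
      intro x hx
      obtain ⟨a, ha, b, hb, rfl⟩ := support_convolution_subset _ hx
      rw [(ρ k).support_normed_eq] at ha
      refine mem_cthickening_of_dist_le _ b δ _ (subset_tsupport _ hb) ?_
      have h1 : ‖a‖ < δ / (k + 2) := by simpa [ρ] using ha
      have h2 : δ / ((k:ℝ) + 2) ≤ δ := div_le_self hδ.le (by linarith [k.cast_nonneg (α := ℝ)])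
      simpa using (h1.le.trans h2)
    have htest : ∀ k, IsTest Ω (φ k) := fun k =>
      ⟨hsm k, HasCompactSupport.intro' hc.isCompact.cthickening isClosed_cthickening
        (fun x hx => image_eq_zero_of_notMem_tsupport fun h => hx (hsupp k h)),
        (hsupp k).trans hδΩ⟩
    have hfin : IsFiniteMeasure (volume.restrict Ω) := ⟨by simpa using lt_top_iff_ne_top.2 hΩf⟩
    have hdist : ∀ k x, dist (φ k x) (v x) ≤ C * δ := by
      intro k x
      refine (ρ k).dist_normed_convolution_le hv.continuous.aestronglyMeasurable fun y hy => ?_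
      refine (hv.dist_le_mul y x).trans ?_
      have h2 : δ / ((k:ℝ) + 2) ≤ δ := div_le_self hδ.le (by linarith [k.cast_nonneg (α := ℝ)])
      have h1 : dist y x < δ / (k + 2) := hy
      gcongr
      linarith
    have hφlip : ∀ k, LipschitzWith C (φ k) := by
      intro k
      refine LipschitzWith.of_dist_le_mul fun x y => ?_
      have hi : ∀ z, Integrable (fun y => v (z - y) * (ρ k).normed volume y) volume := fun z =>
        ((hlipc z).continuous.mul (ρ k).continuous_normed).integrable_of_hasCompactSupport
          (ρ k).hasCompactSupport_normed.mul_left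
      rw [dist_eq_norm, hφdef, hφdef, ← integral_sub (hi _) (hi _)]
      calc _ ≤ ∫ z, (C * dist x y) * (ρ k).normed volume z := by
            refine norm_integral_le_of_norm_le ((hρint k).const_mul _) (.of_forall fun z => ?_)
            rw [← sub_mul, norm_mul, Real.norm_of_nonneg ((ρ k).nonneg_normed z)]
            refine mul_le_mul_of_nonneg_right ?_ ((ρ k).nonneg_normed z)
            have := hv.dist_le_mul (x - z) (y - z)
            simpa [dist_eq_norm] using this
        _ = C * dist x y := by rw [integral_const_mul, (ρ k).integral_normed, mul_one]
    have hl1 : Tendsto (fun k => eLpNorm (fun x => v x - φ k x) 2 (volume.restrict Ω)) atTop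
        (𝓝 0) := by
      refine tendsto_eLpNorm_two_of_bounded (ENNReal.ofReal (C * δ)) ENNReal.ofReal_ne_top
        (fun k => (hv.continuous.sub (hsm k).continuous).aestronglyMeasurable) (fun k x => ?_)
        (.of_forall fun x => ?_)
      · rw [← ofReal_norm, ← dist_eq_norm, dist_comm]
        exact ENNReal.ofReal_le_ofReal (hdist k x)
      · simpa using (ContDiffBump.convolution_tendsto_right_of_continuous (μ := volume) hρ0
          hv.continuous x).const_sub (v x)
    have hl2 : Tendsto (fun k => eLpNorm (fun x => gradient v x - gradient (φ k) x) 2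
        (volume.restrict Ω)) atTop (𝓝 0) := by
      refine tendsto_eLpNorm_two_of_bounded (ENNReal.ofReal (C + C)) (by simp)
        (fun k => ((measurable_gradient v).sub (measurable_gradient _)).aestronglyMeasurable)
        (fun k x => ?_) (ae_restrict_of_ae ?_)
      · rw [← ofReal_norm]
        exact ENNReal.ofReal_le_ofReal ((norm_sub_le _ _).trans
          (add_le_add (norm_gradient_le_of_lipschitz hv x)
            (norm_gradient_le_of_lipschitz (hφlip k) x)))
      · have hb : ∀ᵐ x ∂(volume : Measure (E n)), ∀ i : Fin n,
            Tendsto (fun k => fderiv ℝ (φ k) x (EuclideanSpace.single i 1)) atTop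
              (𝓝 (lineDeriv ℝ v x (EuclideanSpace.single i 1))) := by
          refine ae_all_iff.2 fun i => ?_
          simp only [hline]
          exact ContDiffBump.ae_convolution_tendsto_right_of_locallyIntegrable hρ0 hρ2
            (hv.locallyIntegrable_lineDeriv _)
        filter_upwards [hb, hv.ae_differentiableAt] with x hx hd
        have hco : ∀ (w : E n → ℝ) (i : Fin n),
            gradient w x i = fderiv ℝ w x (EuclideanSpace.single i 1) := fun w i => by
          rw [← inner_gradient_left, EuclideanSpace.inner_single_right]; simp
        have hlim : Tendsto (fun k => gradient (φ k) x) atTop (𝓝 (gradient v x)) := by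
          have h1 : Tendsto (fun k => (EuclideanSpace.equiv (Fin n) ℝ) (gradient (φ k) x)) atTop
              (𝓝 ((EuclideanSpace.equiv (Fin n) ℝ) (gradient v x))) := by
            refine tendsto_pi_nhds.2 fun i => ?_
            have := hx i
            rw [hd.lineDeriv_eq_fderiv] at this
            simp only [← hco] at this
            exact this
          have h2 := (EuclideanSpace.equiv (Fin n) ℝ).symm.continuous.tendsto _ |>.comp h1
          simpa [Function.comp_def] using h2
        simpa using hlim.const_sub (gradient v x)
    obtain ⟨k, h1, h2⟩ := ((hl1.eventually_lt_const hε).and (hl2.eventually_lt_const hε)).exists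
    exact ⟨φ k, htest k, h1, h2⟩

lemma IsTest.memH10 {Ω : Set (E n)} (hΩ : IsOpen Ω) (hΩf : volume Ω ≠ ⊤) {φ : E n → ℝ}
    (hφ : IsTest Ω φ) : MemH10 Ω φ (gradient φ) := by
  obtain ⟨D, hD⟩ : ∃ D, LipschitzWith D φ :=
    ContDiff.lipschitzWith_of_hasCompactSupport hφ.2.1 hφ.1 (by simp)
  exact MemH10.of_lipschitz hΩ hΩf hD hφ.2.1 hφ.2.2

/-! ### A Hardy inequality with logarithmic improvement -/

lemma integrable_of_continuousOn_tsupport {φ f : E n → ℝ} (hc : HasCompactSupport φ)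
    (hf : ContinuousOn f (tsupport φ)) (h0 : ∀ x, φ x = 0 → f x = 0) : Integrable f volume := by
  rw [← integrableOn_iff_integrable_of_support_subset (s := tsupport φ)]
  · exact hf.integrableOn_compact hc
  · intro x hx
    exact subset_tsupport _ fun h => hx (h0 x h)

lemma gradient_apply (φ : E n → ℝ) (x : E n) (i : Fin n) :
    gradient φ x i = fderiv ℝ φ x (EuclideanSpace.single i 1) := by
  rw [← inner_gradient_left, EuclideanSpace.inner_single_right]; simp

/-- Integration by parts against the radial vector field `Q x • x`. -/
lemma integral_sq_mul_div_radial {Ω : Set (E n)} {φ : E n → ℝ} (hφ : IsTest Ω φ) {Q Q' : E n → ℝ}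
    (hQd : ∀ x ∈ tsupport φ, HasFDerivAt Q (Q' x • 2 • innerSL ℝ x) x)
    (hQ' : ContinuousOn Q' (tsupport φ)) :
    Integrable (fun x => φ x ^ 2 * (n * Q x + 2 * ‖x‖ ^ 2 * Q' x)) volume ∧
    Integrable (fun x => φ x ^ 2 * (‖x‖ ^ 2 * Q x ^ 2)) volume ∧
    ∫ x, φ x ^ 2 * (n * Q x + 2 * ‖x‖ ^ 2 * Q' x) =
      ∫ x, -(2 * (φ x * Q x) * inner ℝ x (gradient φ x)) := by
  have hQ : ContinuousOn Q (tsupport φ) := fun x hx =>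
    (hQd x hx).continuousAt.continuousWithinAt
  have hφc : Continuous φ := hφ.1.continuous
  have hgc : Continuous (gradient φ) := hφ.gradient_memLp.1
  have hgi : ∀ i : Fin n, Continuous (fun x => gradient φ x i) := fun i => by fun_prop
  have hxi : ∀ i : Fin n, Continuous (fun x : E n => x i) := fun i => by fun_prop
  have hA : ∀ i : Fin n, Integrable
      (fun x => φ x ^ 2 * (Q x + 2 * x i ^ 2 * Q' x)) volume := fun i =>
    integrable_of_continuousOn_tsupport hφ.2.1
      (by have := (hxi i).continuousOn (s := tsupport φ); fun_prop) (fun x hx => by simp [hx])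
  have hB : ∀ i : Fin n, Integrable
      (fun x => (2 * φ x * gradient φ x i) * (x i * Q x)) volume := fun i =>
    integrable_of_continuousOn_tsupport hφ.2.1
      (by
        have := (hgi i).continuousOn (s := tsupport φ)
        have := (hxi i).continuousOn (s := tsupport φ)
        fun_prop) (fun x hx => by simp [hx])
  have hC : ∀ i : Fin n, Integrable (fun x => φ x ^ 2 * (x i * Q x)) volume := fun i =>
    integrable_of_continuousOn_tsupport hφ.2.1
      (by have := (hxi i).continuousOn (s := tsupport φ); fun_prop) (fun x hx => by simp [hx])
  have hparts : ∀ i : Fin n,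
      ∫ x, φ x ^ 2 * (Q x + 2 * x i ^ 2 * Q' x) =
        - ∫ x, (2 * φ x * gradient φ x i) * (x i * Q x) := by
    intro i
    refine integral_bilinear_hasLineDerivAt_right_eq_neg_left_of_integrable (μ := volume)
      (B := ContinuousLinearMap.mul ℝ ℝ) (v := EuclideanSpace.single i (1:ℝ))
      (f := fun x => φ x ^ 2) (f' := fun x => 2 * φ x * gradient φ x i)
      (g := fun x => x i * Q x) (g' := fun x => Q x + 2 * x i ^ 2 * Q' x)
      (hB i) (hA i) (hC i) ?_ ?_
    · intro x _
      have h1 := ((hφ.differentiable x).hasFDerivAt.pow 2).hasLineDerivAt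
        (EuclideanSpace.single i (1:ℝ))
      convert h1 using 1
      rw [gradient_apply]
      simp
    · intro x hx
      have hx' : x ∈ tsupport φ := by
        refine closure_mono (fun y hy => ?_) hx
        intro h
        exact hy (by simp [h])
      have h1 : HasFDerivAt (fun y : E n => y i) (EuclideanSpace.proj (𝕜 := ℝ) i) x :=
        (EuclideanSpace.proj (𝕜 := ℝ) i).hasFDerivAt
      have h3 := (h1.fun_mul (hQd x hx')).hasLineDerivAt (EuclideanSpace.single i (1:ℝ))
      have he : (x i • Q' x • 2 • innerSL ℝ x + Q x • EuclideanSpace.proj (𝕜 := ℝ) i)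
          (EuclideanSpace.single i (1:ℝ)) = Q x + 2 * x i ^ 2 * Q' x := by
        simp [EuclideanSpace.inner_single_right]
        ring
      rwa [he] at h3
  refine ⟨integrable_of_continuousOn_tsupport hφ.2.1 ?_ (fun x hx => by simp [hx]),
    integrable_of_continuousOn_tsupport hφ.2.1 (by fun_prop) (fun x hx => by simp [hx]), ?_⟩
  · refine ContinuousOn.mul (by fun_prop) (ContinuousOn.add ?_ (by fun_prop))
    exact continuousOn_const.mul hQ
  -- Summing the coordinate identities assembles the divergence `n Q + 2 |x|² Q'`, since `Q'` is the
  -- derivative of `Q` in the variable `|x|²`.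
  calc _ = ∫ x, ∑ i, φ x ^ 2 * (Q x + 2 * x i ^ 2 * Q' x) := by
        congr 1
        ext x
        rw [← Finset.mul_sum, Finset.sum_add_distrib, ← Finset.sum_mul, ← Finset.mul_sum,
          ← EuclideanSpace.real_norm_sq_eq]
        simp
    _ = ∑ i, - ∫ x, (2 * φ x * gradient φ x i) * (x i * Q x) := by
        rw [integral_finsetSum _ fun i _ => hA i]
        exact Finset.sum_congr rfl fun i _ => hparts i
    _ = - ∫ x, ∑ i, (2 * φ x * gradient φ x i) * (x i * Q x) := by
        rw [integral_finsetSum _ fun i _ => hB i, Finset.sum_neg_distrib]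
    _ = _ := by
        rw [← integral_neg]
        congr 1
        ext x
        rw [PiLp.inner_apply, Finset.mul_sum, neg_inj]
        refine Finset.sum_congr rfl fun i _ => ?_
        simp
        ring

lemma IsTest.integrable_norm_gradient_sq {Ω : Set (E n)} {φ : E n → ℝ} (hφ : IsTest Ω φ) :
    Integrable (fun x => ‖gradient φ x‖ ^ 2) volume :=
  (hφ.gradient_memLp.1.memLp_of_hasCompactSupport hφ.gradient_memLp.2).integrable_norm_pow
    two_ne_zero

/-- Expand `|∇φ + φ Q x|² ≥ 0` and replace the cross term through the radial integration by parts.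
Each choice of `Q` yields a Hardy-type inequality whose weight is a Riccati expression in `Q`. -/
lemma integral_sq_mul_riccati_le {Ω : Set (E n)} {φ : E n → ℝ} (hφ : IsTest Ω φ)
    {Q Q' : E n → ℝ} (hQd : ∀ x ∈ tsupport φ, HasFDerivAt Q (Q' x • 2 • innerSL ℝ x) x)
    (hQ' : ContinuousOn Q' (tsupport φ)) :
    Integrable (fun x => φ x ^ 2 * (n * Q x + 2 * ‖x‖ ^ 2 * Q' x - ‖x‖ ^ 2 * Q x ^ 2)) volume ∧
    ∫ x, φ x ^ 2 * (n * Q x + 2 * ‖x‖ ^ 2 * Q' x - ‖x‖ ^ 2 * Q x ^ 2) ≤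
      ∫ x, ‖gradient φ x‖ ^ 2 := by
  obtain ⟨hI1, hI2, heq⟩ := integral_sq_mul_div_radial hφ hQd hQ'
  have hsplit : ∀ x, φ x ^ 2 * (n * Q x + 2 * ‖x‖ ^ 2 * Q' x - ‖x‖ ^ 2 * Q x ^ 2) =
      φ x ^ 2 * (n * Q x + 2 * ‖x‖ ^ 2 * Q' x) - φ x ^ 2 * (‖x‖ ^ 2 * Q x ^ 2) := fun x => by ring
  simp only [hsplit]
  refine ⟨hI1.sub hI2, ?_⟩
  have hQ : ContinuousOn Q (tsupport φ) := fun x hx =>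
    (hQd x hx).continuousAt.continuousWithinAt
  have hφc : Continuous φ := hφ.1.continuous
  have hgc : Continuous (gradient φ) := hφ.gradient_memLp.1
  have hI3 : Integrable (fun x => -(2 * (φ x * Q x) * inner ℝ x (gradient φ x))) volume := by
    refine integrable_of_continuousOn_tsupport hφ.2.1 ?_ (fun x hx => by simp [hx])
    have : Continuous (fun x => inner ℝ x (gradient φ x)) := continuous_id.inner hgc
    fun_prop
  rw [integral_sub hI1 hI2, heq, ← integral_sub hI3 hI2]
  refine integral_mono (hI3.sub hI2) hφ.integrable_norm_gradient_sq fun x => ?_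
  have h2 : 0 ≤ ‖gradient φ x + (φ x * Q x) • x‖ ^ 2 := by positivity
  rw [norm_add_sq_real, inner_smul_right, norm_smul, mul_pow, Real.norm_eq_abs, sq_abs,
    real_inner_comm] at h2
  simp only
  nlinarith

/-- The regularised Hardy weight, improved on `‖x‖ ≥ R`. -/
def hardyWeight (a b R ε : ℝ) (x : E n) : ℝ :=
  (a + {y : E n | R ≤ ‖y‖}.indicator (fun _ => b) x) / (‖x‖ ^ 2 + ε)

/-- The gain `β` increases with `|x|`, so for `|x| ≥ R` it is at least `1 / (2 (2 - log R))`. The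
constant 2 keeps the denominator positive on the whole ball, where `log (|x|² + ε) ≤ 1`. -/
lemma hardyWeight_le {R ε : ℝ} (hR : 0 < R) (hR1 : R < 1) (hε : 0 < ε) (hε1 : ε ≤ 1)
    {β : ℝ → ℝ} (hβ : ∀ s, β s = 1 / (2 * (2 - Real.log (s + ε) / 2)))
    {x : E n} (hx : ‖x‖ < 1) :
    0 < β (‖x‖ ^ 2) ∧ β (‖x‖ ^ 2) ≤ 1 / 2 ∧
    hardyWeight (((n:ℝ) - 2) ^ 2 / 4) ((1 / (2 * (2 - Real.log R))) ^ 2) R ε x ≤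
      (((n:ℝ) - 2) ^ 2 / 4 + β (‖x‖ ^ 2) ^ 2) / (‖x‖ ^ 2 + ε) := by
  have hs1 : ‖x‖ ^ 2 < 1 := by nlinarith [norm_nonneg x]
  have hpos : 0 < ‖x‖ ^ 2 + ε := by positivity
  have hl : Real.log (‖x‖ ^ 2 + ε) ≤ 1 := by
    have := Real.log_le_sub_one_of_pos hpos
    linarith
  have hb0 : 0 < β (‖x‖ ^ 2) := by rw [hβ]; apply div_pos <;> linarith
  refine ⟨hb0, ?_, ?_⟩
  · rw [hβ]
    apply one_div_le_one_div_of_le <;> linarith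
  · rw [hardyWeight]
    gcongr
    by_cases hxR : R ≤ ‖x‖
    · rw [indicator_of_mem (by exact hxR), hβ]
      have h1 : Real.log R ≤ Real.log (‖x‖ ^ 2 + ε) / 2 := by
        have : Real.log (R ^ 2) ≤ Real.log (‖x‖ ^ 2 + ε) :=
          Real.log_le_log (by positivity) (by nlinarith)
        rw [Real.log_pow] at this
        push_cast at this
        linarith
      have h2 : Real.log R < 0 := Real.log_neg hR hR1
      have h3 : 1 / (2 * (2 - Real.log R)) ≤ 1 / (2 * (2 - Real.log (‖x‖ ^ 2 + ε) / 2)) := by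
        apply one_div_le_one_div_of_le <;> linarith
      have h4 : 0 ≤ 1 / (2 * (2 - Real.log R)) := by apply div_nonneg <;> linarith
      gcongr
    · rw [indicator_of_notMem (by exact hxR)]
      positivity

/-- The choice is `Q = (α + β) / (|x|² + ε)` with `α = (n-2)/2`; at `ε = 0` this is the field of the
ground state `|x|^(-α) (2 - log |x|)^(1/2)`. The function `β` solves `β' = β² / (s + ε)`, which
makes the Riccati expression collapse to `α² + β²`. The shift `ε` keeps `Q` smooth at the origin. -/
lemma hardy_test (hn : 3 ≤ n) {R ε : ℝ} (hR : 0 < R) (hR1 : R < 1) (hε : 0 < ε) (hε1 : ε ≤ 1)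
    {φ : E n → ℝ} (hφ : IsTest (ball (0 : E n) 1) φ) :
    ∫⁻ x, ENNReal.ofReal
      (hardyWeight (((n:ℝ) - 2) ^ 2 / 4) ((1 / (2 * (2 - Real.log R))) ^ 2) R ε x * φ x ^ 2) ≤
      ∫⁻ x, ENNReal.ofReal (‖gradient φ x‖ ^ 2) := by
  set α : ℝ := ((n:ℝ) - 2) / 2 with hα
  have hn' : (3:ℝ) ≤ n := by exact_mod_cast hn
  have hnα : (n:ℝ) = 2 * α + 2 := by rw [hα]; ring
  have hα0 : 0 < α := by rw [hα]; linarith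
  have hα2 : ((n:ℝ) - 2) ^ 2 / 4 = α ^ 2 := by rw [hα]; ring
  set β : ℝ → ℝ := fun s => 1 / (2 * (2 - Real.log (s + ε) / 2)) with hβ
  have hl : ∀ s ∈ Ico (0:ℝ) 1, 0 < 2 - Real.log (s + ε) / 2 := fun s hs => by
    have := Real.log_le_sub_one_of_pos (show 0 < s + ε by linarith [hs.1])
    linarith [hs.2]
  have hβd : ∀ s ∈ Ico (0:ℝ) 1, HasDerivAt β (β s ^ 2 / (s + ε)) s := by
    intro s hs
    have hp : s + ε ≠ 0 := by linarith [hs.1]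
    have h1 : HasDerivAt (fun s => Real.log (s + ε)) (1 / (s + ε)) s :=
      ((hasDerivAt_id s).add_const ε).log hp
    have h2 := (((h1.div_const 2).const_sub 2).const_mul 2).inv (mul_pos two_pos (hl s hs)).ne'
    simp only [hβ, one_div]
    refine h2.congr_deriv ?_
    have := (hl s hs).ne'
    field_simp
  set q : ℝ → ℝ := fun s => (α + β s) / (s + ε) with hq
  set q' : ℝ → ℝ := fun s => (β s ^ 2 - (α + β s)) / (s + ε) ^ 2 with hq'
  have hqd : ∀ s ∈ Ico (0:ℝ) 1, HasDerivAt q (q' s) s := by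
    intro s hs
    have hp : s + ε ≠ 0 := by linarith [hs.1]
    have := ((hβd s hs).const_add α).div ((hasDerivAt_id s).add_const ε) hp
    refine this.congr_deriv ?_
    simp only [hq', id]
    field_simp
  have hq'c : ContinuousOn q' (Ico 0 1) := by
    have hβc : ContinuousOn β (Ico 0 1) := fun s hs =>
      (hβd s hs).continuousAt.continuousWithinAt
    refine ContinuousOn.div (by fun_prop) (by fun_prop) fun s hs => ?_
    have : 0 < s + ε := by linarith [hs.1]
    positivity
  have hmem : ∀ x ∈ tsupport φ, ‖x‖ ^ 2 ∈ Ico (0:ℝ) 1 := fun x hx => by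
    have := hφ.2.2 hx
    rw [mem_ball_zero_iff] at this
    exact ⟨by positivity, by nlinarith [norm_nonneg x]⟩
  obtain ⟨i4, hle⟩ := integral_sq_mul_riccati_le hφ (Q := fun x => q (‖x‖ ^ 2))
    (Q' := fun x => q' (‖x‖ ^ 2))
    (fun x hx => (hqd _ (hmem x hx)).comp_hasFDerivAt x (hasStrictFDerivAt_norm_sq x).hasFDerivAt)
    (hq'c.comp (by fun_prop) hmem)
  rw [← ofReal_integral_eq_lintegral_ofReal hφ.integrable_norm_gradient_sq
    (.of_forall fun x => by positivity)]
  have hpt : ∀ x, 0 ≤ φ x ^ 2 * (n * q (‖x‖ ^ 2) + 2 * ‖x‖ ^ 2 * q' (‖x‖ ^ 2) -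
      ‖x‖ ^ 2 * q (‖x‖ ^ 2) ^ 2) ∧
      hardyWeight (((n:ℝ) - 2) ^ 2 / 4) ((1 / (2 * (2 - Real.log R))) ^ 2) R ε x * φ x ^ 2 ≤
      φ x ^ 2 * (n * q (‖x‖ ^ 2) + 2 * ‖x‖ ^ 2 * q' (‖x‖ ^ 2) -
      ‖x‖ ^ 2 * q (‖x‖ ^ 2) ^ 2) := by
    intro x
    by_cases hx0 : φ x = 0
    · simp [hx0]
    have hx : ‖x‖ < 1 := by
      simpa using hφ.2.2 (subset_tsupport φ hx0)
    obtain ⟨b0, b1, hw⟩ := hardyWeight_le hR hR1 hε hε1 (fun s => rfl : ∀ s, β s = _) hx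
    have hp : 0 < ‖x‖ ^ 2 + ε := by positivity
    -- At `ε = 0` this is an equality. The shift contributes `n (α + β) ε` to the numerator, which
    -- dominates `(α² + β²) ε` because `n = 2 α + 2`.
    have key : (α ^ 2 + β (‖x‖ ^ 2) ^ 2) / (‖x‖ ^ 2 + ε) ≤
        n * q (‖x‖ ^ 2) + 2 * ‖x‖ ^ 2 * q' (‖x‖ ^ 2) - ‖x‖ ^ 2 * q (‖x‖ ^ 2) ^ 2 := by
      have e : n * q (‖x‖ ^ 2) + 2 * ‖x‖ ^ 2 * q' (‖x‖ ^ 2) - ‖x‖ ^ 2 * q (‖x‖ ^ 2) ^ 2 =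
          (‖x‖ ^ 2 * (α ^ 2 + β (‖x‖ ^ 2) ^ 2) + n * (α + β (‖x‖ ^ 2)) * ε) /
            (‖x‖ ^ 2 + ε) ^ 2 := by
        simp only [hq, hq']
        rw [hnα]
        field_simp
        ring
      rw [e, div_le_div_iff₀ hp (by positivity)]
      have : (α ^ 2 + β (‖x‖ ^ 2) ^ 2) ≤ n * (α + β (‖x‖ ^ 2)) := by
        rw [hnα]; nlinarith [mul_pos hα0 b0]
      have h2 : (α ^ 2 + β (‖x‖ ^ 2) ^ 2) * (‖x‖ ^ 2 + ε) ≤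
        ‖x‖ ^ 2 * (α ^ 2 + β (‖x‖ ^ 2) ^ 2) + n * (α + β (‖x‖ ^ 2)) * ε := by nlinarith
      calc _ = ((α ^ 2 + β (‖x‖ ^ 2) ^ 2) * (‖x‖ ^ 2 + ε)) * (‖x‖ ^ 2 + ε) := by ring
        _ ≤ _ := by gcongr
    rw [hα2] at hw ⊢
    refine ⟨mul_nonneg (sq_nonneg _) (le_trans (by positivity) key), ?_⟩
    rw [mul_comm]
    exact mul_le_mul_of_nonneg_left (hw.trans key) (sq_nonneg _)
  calc _ ≤ ∫⁻ x, ENNReal.ofReal (φ x ^ 2 * (n * q (‖x‖ ^ 2) + 2 * ‖x‖ ^ 2 * q' (‖x‖ ^ 2) -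
      ‖x‖ ^ 2 * q (‖x‖ ^ 2) ^ 2)) := lintegral_mono fun x => ENNReal.ofReal_le_ofReal (hpt x).2
    _ = ENNReal.ofReal _ :=
      (ofReal_integral_eq_lintegral_ofReal i4 (.of_forall fun x => (hpt x).1)).symm
    _ ≤ _ := ENNReal.ofReal_le_ofReal hle

lemma eLpNorm_two_sq {F : Type*} [NormedAddCommGroup F] (μ : Measure (E n)) (f : E n → F) :
    eLpNorm f 2 μ ^ 2 = ∫⁻ x, ENNReal.ofReal (‖f x‖ ^ 2) ∂μ := by
  have := eLpNorm_nnreal_pow_eq_lintegral (μ := μ) (f := f) (p := 2) two_ne_zero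
  simp only [NNReal.coe_ofNat, ENNReal.coe_ofNat, ENNReal.rpow_ofNat] at this
  rw [this]
  congr 1
  ext x
  rw [ENNReal.ofReal_pow (norm_nonneg _), ofReal_norm]

lemma hardyWeight_nonneg {a b R ε : ℝ} (ha : 0 ≤ a) (hb : 0 ≤ b) (hε : 0 < ε) (x : E n) :
    0 ≤ hardyWeight a b R ε x :=
  div_nonneg (add_nonneg ha (indicator_nonneg (fun _ _ => hb) _)) (by positivity)

lemma hardyWeight_le_const {a b R ε : ℝ} (ha : 0 ≤ a) (hb : 0 ≤ b) (hε : 0 < ε) (x : E n) :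
    hardyWeight a b R ε x ≤ (a + b) / ε := by
  unfold hardyWeight
  have : {y : E n | R ≤ ‖y‖}.indicator (fun _ => b) x ≤ b := indicator_le_self' (fun _ _ => hb) x
  gcongr
  nlinarith [sq_nonneg ‖x‖]

lemma measurable_hardyWeight (a b R ε : ℝ) : Measurable (hardyWeight a b R ε : E n → ℝ) := by
  unfold hardyWeight
  have : MeasurableSet {y : E n | R ≤ ‖y‖} := measurableSet_le measurable_const measurable_norm
  have : Measurable ({y : E n | R ≤ ‖y‖}.indicator fun _ => b) := measurable_const.indicator this
  fun_prop

/-- For fixed `ε` the weight is bounded, so both sides are continuous in the `H¹` norm and the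
inequality passes from test functions to their closure. -/
lemma hardy_regularised (hn : 3 ≤ n) {R ε : ℝ} (hR : 0 < R) (hR1 : R < 1) (hε : 0 < ε)
    (hε1 : ε ≤ 1) {v : E n → ℝ} {G : E n → E n} (hv : MemH10 (ball (0 : E n) 1) v G) :
    ∫⁻ x in ball (0 : E n) 1, ENNReal.ofReal
      (hardyWeight (((n:ℝ) - 2) ^ 2 / 4) ((1 / (2 * (2 - Real.log R))) ^ 2) R ε x * v x ^ 2) ≤
      ∫⁻ x in ball (0 : E n) 1, ENNReal.ofReal (‖G x‖ ^ 2) := by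
  set a : ℝ := ((n:ℝ) - 2) ^ 2 / 4 with ha
  set b : ℝ := (1 / (2 * (2 - Real.log R))) ^ 2 with hb
  have ha0 : 0 ≤ a := by positivity
  have hb0 : 0 ≤ b := by positivity
  set μ : Measure (E n) := volume.restrict (ball 0 1) with hμ
  set w : E n → ℝ := fun x => √(hardyWeight a b R ε x) with hw
  have hwm : Measurable w := (measurable_hardyWeight a b R ε).sqrt
  have hwsq : ∀ (f : E n → ℝ) x, ‖w x * f x‖ ^ 2 = hardyWeight a b R ε x * f x ^ 2 :=
    fun f x => by
      rw [Real.norm_eq_abs, sq_abs, mul_pow, Real.sq_sqrt (hardyWeight_nonneg ha0 hb0 hε x)]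
  set B : ℝ≥0 := Real.toNNReal √((a + b) / ε) with hB
  have hwB : ∀ x, ‖w x‖ ≤ B := fun x => by
    rw [Real.norm_of_nonneg (Real.sqrt_nonneg _), hB, Real.coe_toNNReal _ (Real.sqrt_nonneg _)]
    exact Real.sqrt_le_sqrt (hardyWeight_le_const ha0 hb0 hε x)
  have htest : ∀ φ, IsTest (ball (0 : E n) 1) φ →
      eLpNorm (fun x => w x * φ x) 2 μ ≤ eLpNorm (gradient φ) 2 μ := by
    intro φ hφ
    rw [← ENNReal.pow_le_pow_left_iff two_ne_zero, eLpNorm_two_sq, eLpNorm_two_sq]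
    simp only [hwsq]
    rw [hμ, setLIntegral_eq_of_support_subset, setLIntegral_eq_of_support_subset]
    · exact hardy_test hn hR hR1 hε hε1 hφ
    · intro x hx
      by_contra h
      exact hx (by simp [gradient_eq_zero_of_notMem_tsupport fun h' => h (hφ.2.2 h')])
    · intro x hx
      by_contra h
      exact hx (by simp [image_eq_zero_of_notMem_tsupport fun h' => h (hφ.2.2 h')])
  have hmain : eLpNorm (fun x => w x * v x) 2 μ ≤ eLpNorm G 2 μ := by
    refine ENNReal.le_of_forall_pos_le_add fun η hη _ => ?_
    -- The function error is multiplied by `B` and the gradient error by 1; with this tolerance they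
    -- add up to `η`.
    have hδ : 0 < (η / (B + 1) : ℝ≥0) := by positivity
    obtain ⟨φ, hφ, h1, h2⟩ := hv.approx ((η / (B + 1) : ℝ≥0) : ℝ≥0∞) (by exact_mod_cast hδ)
    have hmφ := hφ.aestronglyMeasurable μ
    have hwφ : AEStronglyMeasurable (fun x => w x * φ x) μ :=
      hwm.aestronglyMeasurable.mul hmφ.1
    have hwv : AEStronglyMeasurable (fun x => w x * (v x - φ x)) μ :=
      hwm.aestronglyMeasurable.mul (hv.memLp.1.sub hmφ.1)
    calc eLpNorm (fun x => w x * v x) 2 μ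
        = eLpNorm ((fun x => w x * φ x) + (fun x => w x * (v x - φ x))) 2 μ := by
          congr 1; ext x; simp only [Pi.add_apply]; ring
      _ ≤ eLpNorm (fun x => w x * φ x) 2 μ + eLpNorm (fun x => w x * (v x - φ x)) 2 μ :=
          eLpNorm_add_le hwφ hwv (by norm_num)
      _ ≤ eLpNorm (gradient φ) 2 μ + B * eLpNorm (fun x => v x - φ x) 2 μ := by
          gcongr
          · exact htest φ hφ
          · refine eLpNorm_le_nnreal_smul_eLpNorm_of_ae_le_mul (.of_forall fun x => ?_) 2
            rw [← NNReal.coe_le_coe]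
            push_cast
            rw [norm_mul]
            exact mul_le_mul_of_nonneg_right (hwB x) (norm_nonneg _)
      _ ≤ (eLpNorm G 2 μ + eLpNorm (fun x => G x - gradient φ x) 2 μ) +
            B * eLpNorm (fun x => v x - φ x) 2 μ := by
          gcongr
          calc _ = eLpNorm (G - (fun x => G x - gradient φ x)) 2 μ := by
                congr 1; ext1 x; simp
            _ ≤ _ := eLpNorm_sub_le hv.memLp_grad.1 (hv.memLp_grad.1.sub hmφ.2) (by norm_num)
      _ ≤ (eLpNorm G 2 μ + (η / (B + 1) : ℝ≥0)) + B * (η / (B + 1) : ℝ≥0) := by gcongr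
      _ = eLpNorm G 2 μ + η := by
          rw [add_assoc]
          congr 1
          norm_cast
          field_simp
          ring
  rw [← ENNReal.pow_le_pow_left_iff two_ne_zero, eLpNorm_two_sq, eLpNorm_two_sq] at hmain
  simpa only [hwsq] using hmain

/-- Hardy inequality in the unit ball, improved on `‖x‖ ≥ R`. -/
lemma hardy_lintegral (hn : 3 ≤ n) {R : ℝ} (hR : 0 < R) (hR1 : R < 1)
    {v : E n → ℝ} {G : E n → E n} (hv : MemH10 (ball (0 : E n) 1) v G) :
    ∫⁻ x in ball (0 : E n) 1, ENNReal.ofReal ((((n:ℝ) - 2) ^ 2 / 4 +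
      {y : E n | R ≤ ‖y‖}.indicator (fun _ => (1 / (2 * (2 - Real.log R))) ^ 2) x) *
        ((‖x‖ ^ 2)⁻¹ * v x ^ 2)) ≤
      ∫⁻ x in ball (0 : E n) 1, ENNReal.ofReal (‖G x‖ ^ 2) := by
  set a : ℝ := ((n:ℝ) - 2) ^ 2 / 4 with ha
  set b : ℝ := (1 / (2 * (2 - Real.log R))) ^ 2 with hb
  have ha0 : 0 ≤ a := by positivity
  have hb0 : 0 ≤ b := by positivity
  -- The regularisation is removed along `ε = 1/(k+1)` by Fatou's lemma.
  set f : ℕ → E n → ℝ≥0∞ := fun k x =>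
    ENNReal.ofReal (hardyWeight a b R (1 / ((k:ℝ) + 1)) x * v x ^ 2) with hf
  have hfm : ∀ k, AEMeasurable (f k) (volume.restrict (ball (0 : E n) 1)) := fun k =>
    ((measurable_hardyWeight a b R _).aemeasurable.mul
      (hv.memLp.1.aemeasurable.pow_const 2)).ennreal_ofReal
  calc _ ≤ ∫⁻ x in ball (0 : E n) 1, liminf (fun k => f k x) atTop := by
        refine lintegral_mono fun x => ?_
        -- At the origin the convention `0⁻¹ = 0` makes the limiting integrand vanish.
        by_cases hx : x = 0
        · simp [hx]
        refine le_of_eq (Tendsto.liminf_eq ?_).symm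
        refine ENNReal.tendsto_ofReal ?_
        have hx0 : ‖x‖ ^ 2 ≠ 0 := by simpa using hx
        have h1 : Tendsto (fun k : ℕ => ‖x‖ ^ 2 + 1 / ((k:ℝ) + 1)) atTop (𝓝 (‖x‖ ^ 2 + 0)) :=
          tendsto_const_nhds.add tendsto_one_div_add_atTop_nhds_zero_nat
        rw [add_zero] at h1
        have h2 := ((tendsto_const_nhds (x := a + {y : E n | R ≤ ‖y‖}.indicator (fun _ => b) x)).div
          h1 hx0).mul_const (v x ^ 2)
        simp only [hardyWeight]
        rw [← mul_assoc, ← div_eq_mul_inv]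
        exact h2
    _ ≤ liminf (fun k => ∫⁻ x in ball (0 : E n) 1, f k x) atTop :=
        lintegral_liminf_le' hfm
    _ ≤ ∫⁻ x in ball (0 : E n) 1, ENNReal.ofReal (‖G x‖ ^ 2) := by
        refine liminf_le_of_le (by isBoundedDefault) fun c hc => ?_
        obtain ⟨k, hk⟩ := hc.exists
        refine hk.trans (hardy_regularised hn hR hR1 (by positivity) ?_ hv)
        rw [div_le_one (by positivity)]
        linarith [k.cast_nonneg (α := ℝ)]

/-- Hardy inequality in the unit ball, in terms of Bochner integrals. -/
lemma hardy_integral (hn : 3 ≤ n) {v : E n → ℝ} {G : E n → E n}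
    (hv : MemH10 (ball (0 : E n) 1) v G) :
    IntegrableOn (fun x => (‖x‖ ^ 2)⁻¹ * v x ^ 2) (ball (0 : E n) 1) ∧
    IntegrableOn (fun x => ‖G x‖ ^ 2) (ball (0 : E n) 1) ∧
    ∀ R : ℝ, 0 < R → R < 1 →
      ((n:ℝ) - 2) ^ 2 / 4 * (∫ x in ball (0 : E n) 1, (‖x‖ ^ 2)⁻¹ * v x ^ 2) +
      (1 / (2 * (2 - Real.log R))) ^ 2 *
        (∫ x in ball (0 : E n) 1 ∩ {y | R ≤ ‖y‖}, (‖x‖ ^ 2)⁻¹ * v x ^ 2) ≤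
      ∫ x in ball (0 : E n) 1, ‖G x‖ ^ 2 := by
  have hG : IntegrableOn (fun x => ‖G x‖ ^ 2) (ball (0 : E n) 1) :=
    hv.memLp_grad.integrable_norm_pow two_ne_zero
  have hGfin : ∫⁻ x in ball (0 : E n) 1, ENNReal.ofReal (‖G x‖ ^ 2) ≠ ⊤ := by
    rw [← ofReal_integral_eq_lintegral_ofReal hG (.of_forall fun x => by positivity)]
    exact ENNReal.ofReal_ne_top
  have hn' : (3:ℝ) ≤ n := by exact_mod_cast hn
  have ha : 0 < ((n:ℝ) - 2) ^ 2 / 4 := by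
    have : (0:ℝ) < n - 2 := by linarith
    positivity
  have hms : ∀ R : ℝ, MeasurableSet {y : E n | R ≤ ‖y‖} := fun R =>
    measurableSet_le measurable_const measurable_norm
  have hvm : AEStronglyMeasurable (fun x => (‖x‖ ^ 2)⁻¹ * v x ^ 2)
      (volume.restrict (ball (0 : E n) 1)) :=
    ((measurable_norm.pow_const 2).inv.aemeasurable.mul
      (hv.memLp.1.aemeasurable.pow_const 2)).aestronglyMeasurable
  have hint : IntegrableOn (fun x => (‖x‖ ^ 2)⁻¹ * v x ^ 2) (ball (0 : E n) 1) := by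
    have h1 : IntegrableOn (fun x => ((n:ℝ) - 2) ^ 2 / 4 * ((‖x‖ ^ 2)⁻¹ * v x ^ 2))
        (ball (0 : E n) 1) := by
      refine ⟨hvm.const_mul _, ?_⟩
      rw [hasFiniteIntegral_iff_ofReal (.of_forall fun x => by positivity)]
      refine lt_of_le_of_lt (lintegral_mono fun x => ?_)
        ((hardy_lintegral hn (R := 1 / 2) (by norm_num) (by norm_num) hv).trans_lt
          (lt_top_iff_ne_top.2 hGfin))
      refine ENNReal.ofReal_le_ofReal (mul_le_mul_of_nonneg_right ?_ (by positivity))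
      have : 0 ≤ {y : E n | 1 / 2 ≤ ‖y‖}.indicator
        (fun _ => (1 / (2 * (2 - Real.log (1 / 2)))) ^ 2) x :=
        indicator_nonneg (fun _ _ => by positivity) _
      linarith
    refine (h1.const_mul (((n:ℝ) - 2) ^ 2 / 4)⁻¹).congr (.of_forall fun x => ?_)
    simp only
    rw [← mul_assoc, inv_mul_cancel₀ ha.ne', one_mul]
  refine ⟨hint, hG, fun R hR hR1 => ?_⟩
  set b : ℝ := (1 / (2 * (2 - Real.log R))) ^ 2 with hb
  have hb0 : 0 ≤ b := by positivity
  have hsplit : ∀ x : E n, (((n:ℝ) - 2) ^ 2 / 4 + {y : E n | R ≤ ‖y‖}.indicator (fun _ => b) x) *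
        ((‖x‖ ^ 2)⁻¹ * v x ^ 2) = ((n:ℝ) - 2) ^ 2 / 4 * ((‖x‖ ^ 2)⁻¹ * v x ^ 2) +
        b * {y : E n | R ≤ ‖y‖}.indicator (fun x => (‖x‖ ^ 2)⁻¹ * v x ^ 2) x := fun x => by
    by_cases hx : x ∈ {y : E n | R ≤ ‖y‖}
    · rw [indicator_of_mem hx, indicator_of_mem hx]; ring
    · rw [indicator_of_notMem hx, indicator_of_notMem hx]; ring
  have i1 := hint.const_mul (((n:ℝ) - 2) ^ 2 / 4)
  have i2 := (Integrable.indicator hint (hms R)).const_mul b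
  have hle := hardy_lintegral hn hR hR1 hv
  simp only [← hb, hsplit] at hle
  rw [← ofReal_integral_eq_lintegral_ofReal hG (.of_forall fun x => by positivity),
    ← ofReal_integral_eq_lintegral_ofReal (i1.fun_add i2) (.of_forall fun x => ?_),
    ENNReal.ofReal_le_ofReal_iff (integral_nonneg fun x => by positivity)] at hle
  · rwa [integral_add i1 i2, integral_const_mul, integral_const_mul, integral_indicator (hms R),
      Measure.restrict_restrict (hms R), inter_comm] at hle
  · simp only [Pi.zero_apply]
    exact add_nonneg (by positivity) (mul_nonneg hb0 (indicator_nonneg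
      (fun y _ => by positivity) _))

/-! ### Affine interpolation on a simplex -/

/-- The points of `s` are the vertices of a nondegenerate simplex. -/
def IsSimplex (s : Finset (E n)) : Prop :=
  s.card = n + 1 ∧ AffineIndependent ℝ (fun p : s => (p : E n))

lemma Triangulation.isSimplex (𝒯 : Triangulation n) {s : Finset (E n)} (hs : s ∈ 𝒯.cells) :
    IsSimplex s := ⟨𝒯.card_eq s hs, 𝒯.affineIndependent s hs⟩

lemma IsSimplex.affineSpan_eq_top {s : Finset (E n)} (hs : IsSimplex s) :
    affineSpan ℝ (s : Set (E n)) = ⊤ := by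
  have := (hs.2.affineSpan_eq_top_iff_card_eq_finrank_add_one).2 (by simp [hs.1])
  simpa using this

/-- The affine basis of the space formed by the vertices of a simplex. -/
def IsSimplex.basis {s : Finset (E n)} (hs : IsSimplex s) : AffineBasis s ℝ (E n) :=
  ⟨fun p => p, hs.2, by simpa using hs.affineSpan_eq_top⟩

lemma IsSimplex.basis_apply {s : Finset (E n)} (hs : IsSimplex s) (p : s) :
    hs.basis p = p := rfl

lemma IsSimplex.exists_interp {s : Finset (E n)} (hs : IsSimplex s) (c : E n → ℝ) :
    ∃ f : E n →ᵃ[ℝ] ℝ, ∀ p ∈ s, f p = c p := by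
  classical
  refine ⟨∑ p : s, c p • hs.basis.coord p, fun p hp => ?_⟩
  have h : ∀ q : s, (c q • hs.basis.coord q) p = if q = ⟨p, hp⟩ then c p else 0 := by
    intro q
    have := hs.basis.coord_apply q ⟨p, hp⟩
    rw [hs.basis_apply] at this
    change c q * hs.basis.coord q p = _
    rw [this, mul_ite, mul_one, mul_zero]
    split_ifs with h
    · rw [h]
    · rfl
  have hsum : ∀ (t : Finset s), (∑ q ∈ t, c q • hs.basis.coord q) p =
      ∑ q ∈ t, (c q • hs.basis.coord q) p := fun t => by
    induction t using Finset.induction_on with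
    | empty => simp
    | insert a t ha ih =>
      rw [Finset.sum_insert ha, Finset.sum_insert ha, ← ih]
      rfl
  rw [hsum, Finset.sum_congr rfl fun q _ => h q]
  simp

/-- The affine function with values `c` at the vertices in `s`. -/
def nodal (s : Finset (E n)) (c : E n → ℝ) : E n →ᵃ[ℝ] ℝ :=
  Classical.epsilon fun f : E n →ᵃ[ℝ] ℝ => ∀ p ∈ s, f p = c p

lemma IsSimplex.nodal_apply {s : Finset (E n)} (hs : IsSimplex s) (c : E n → ℝ) {p : E n}
    (hp : p ∈ s) : nodal s c p = c p :=
  Classical.epsilon_spec (hs.exists_interp c) p hp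

lemma IsSimplex.affine_ext {s : Finset (E n)} (hs : IsSimplex s) {f g : E n →ᵃ[ℝ] ℝ}
    (h : ∀ p ∈ s, f p = g p) : f = g :=
  AffineMap.ext_on hs.affineSpan_eq_top h

lemma affine_eqOn_convexHull {t : Set (E n)} {f g : E n →ᵃ[ℝ] ℝ} (h : EqOn f g t) :
    EqOn f g (convexHull ℝ t) := fun _ hx =>
  AffineMap.eqOn_affineSpan h (convexHull_subset_affineSpan t hx)

/-- The barycentric coordinate of the vertex `p` of `s`. -/
def bary (s : Finset (E n)) (p : E n) : E n →ᵃ[ℝ] ℝ := nodal s (indicator {p} fun _ => 1)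

lemma IsSimplex.bary_self {s : Finset (E n)} (hs : IsSimplex s) {p : E n} (hp : p ∈ s) :
    bary s p p = 1 := by
  rw [bary, hs.nodal_apply _ hp]; simp

lemma IsSimplex.bary_ne {s : Finset (E n)} (hs : IsSimplex s) {p q : E n} (hq : q ∈ s)
    (h : q ≠ p) : bary s p q = 0 := by
  rw [bary, hs.nodal_apply _ hq]; simp [h]

lemma IsSimplex.bary_eq_coord {s : Finset (E n)} (hs : IsSimplex s) (p : s) :
    bary s p = hs.basis.coord p := by
  classical
  refine hs.affine_ext fun q hq => ?_
  have := hs.basis.coord_apply p ⟨q, hq⟩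
  rw [hs.basis_apply] at this
  rw [this, bary, hs.nodal_apply _ hq]
  by_cases h : q = p
  · simp [h]
  · rw [if_neg fun h' => h (by rw [h']), indicator_of_notMem (by simpa using h)]

lemma IsSimplex.mem_cell_iff {s : Finset (E n)} (hs : IsSimplex s) {x : E n} :
    x ∈ cell s ↔ ∀ p ∈ s, 0 ≤ bary s p x := by
  have h := hs.basis.convexHull_eq_nonneg_coord
  have hr : range hs.basis = (s : Set (E n)) := by
    ext y; simp [hs.basis_apply]
  rw [hr] at h
  rw [cell, h]
  simp only [mem_ofPred_eq]
  constructor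
  · intro hx p hp
    rw [hs.bary_eq_coord ⟨p, hp⟩]; exact hx _
  · intro hx p
    rw [← hs.bary_eq_coord]; exact hx p p.2

lemma IsSimplex.interior_nonempty {s : Finset (E n)} (hs : IsSimplex s) :
    (interior (cell s)).Nonempty :=
  interior_convexHull_nonempty_iff_affineSpan_eq_top.2 hs.affineSpan_eq_top

lemma IsSimplex.nodal_eq_sum {s : Finset (E n)} (hs : IsSimplex s) (c : E n → ℝ) (x : E n) :
    nodal s c x = ∑ p ∈ s, c p * bary s p x := by
  classical
  have hx : ∑ p : s, hs.basis.coord p x • (p : E n) = x := by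
    simpa [hs.basis_apply] using hs.basis.linear_combination_coord_eq_self x
  have hx1 : ∑ p : s, hs.basis.coord p x = 1 := hs.basis.sum_coord_apply_eq_one x
  have h := hs.basis.affineCombination_coord_eq_self x
  have h2 := congrArg (nodal s c) h
  rw [Finset.map_affineCombination _ _ _ hx1,
    Finset.affineCombination_eq_linear_combination _ _ _ hx1] at h2
  rw [← h2, ← Finset.sum_coe_sort s]
  refine Finset.sum_congr rfl fun p _ => ?_
  rw [Function.comp_apply, hs.basis_apply, hs.nodal_apply _ p.2, hs.bary_eq_coord p, smul_eq_mul,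
    mul_comm]

lemma isCompact_cell (s : Finset (E n)) : IsCompact (cell s) :=
  s.finite_toSet.isCompact_convexHull (𝕜 := ℝ)

lemma isClosed_cell (s : Finset (E n)) : IsClosed (cell s) := (isCompact_cell s).isClosed

lemma convex_cell (s : Finset (E n)) : Convex ℝ (cell s) := convex_convexHull ℝ _

lemma mem_cell_of_mem {s : Finset (E n)} {p : E n} (hp : p ∈ s) : p ∈ cell s :=
  subset_convexHull ℝ _ hp

lemma dist_le_cellDiam {s : Finset (E n)} {x y : E n} (hx : x ∈ cell s) (hy : y ∈ cell s) :
    dist x y ≤ cellDiam s := dist_le_diam_of_mem (isCompact_cell s).isBounded hx hy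

/-! ### The geometry of a triangulation -/

lemma Triangulation.mem_convexHull_inter (𝒯 : Triangulation n) {s t : Finset (E n)}
    (hs : s ∈ 𝒯.cells) (ht : t ∈ 𝒯.cells) {x : E n} (hxs : x ∈ cell s) (hxt : x ∈ cell t) :
    x ∈ convexHull ℝ ((s : Set (E n)) ∩ (t : Set (E n))) := by
  by_cases h : s = t
  · subst h
    rwa [inter_self]
  · rw [← 𝒯.inter_eq s hs t ht h ⟨x, hxs, hxt⟩]
    exact ⟨hxs, hxt⟩

/-- By conformity a common point lies in the face spanned by the common vertices, where both affine
functions take the values `c`. This makes the global interpolant well defined. -/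
lemma Triangulation.nodal_eq_nodal (𝒯 : Triangulation n) {s t : Finset (E n)}
    (hs : s ∈ 𝒯.cells) (ht : t ∈ 𝒯.cells) {x : E n} (hxs : x ∈ cell s) (hxt : x ∈ cell t)
    (c : E n → ℝ) : nodal s c x = nodal t c x :=
  affine_eqOn_convexHull (fun p hp => by
    rw [(𝒯.isSimplex hs).nodal_apply c hp.1, (𝒯.isSimplex ht).nodal_apply c hp.2])
    (𝒯.mem_convexHull_inter hs ht hxs hxt)

/-- The union of the elements. -/
def Triangulation.carrier (𝒯 : Triangulation n) : Set (E n) := ⋃ s ∈ 𝒯.cells, cell s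

lemma Triangulation.mem_carrier {𝒯 : Triangulation n} {x : E n} :
    x ∈ 𝒯.carrier ↔ ∃ s ∈ 𝒯.cells, x ∈ cell s := by simp [Triangulation.carrier]

lemma Triangulation.isClosed_carrier (𝒯 : Triangulation n) : IsClosed 𝒯.carrier :=
  𝒯.cells.finite_toSet.isClosed_biUnion fun s _ => isClosed_cell s

lemma Triangulation.isOpen_domain (𝒯 : Triangulation n) : IsOpen 𝒯.domain := isOpen_interior

lemma Triangulation.domain_subset_carrier (𝒯 : Triangulation n) : 𝒯.domain ⊆ 𝒯.carrier :=
  interior_subset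

lemma Triangulation.interior_cell_subset (𝒯 : Triangulation n) {s : Finset (E n)}
    (hs : s ∈ 𝒯.cells) : interior (cell s) ⊆ 𝒯.domain :=
  interior_mono (subset_biUnion_of_mem (u := fun s => cell s) hs)

lemma Triangulation.carrier_subset_closure (𝒯 : Triangulation n) :
    𝒯.carrier ⊆ closure 𝒯.domain := by
  intro x hx
  obtain ⟨s, hs, hxs⟩ := Triangulation.mem_carrier.1 hx
  refine closure_mono (𝒯.interior_cell_subset hs) ?_
  rw [(convex_cell s).closure_interior_eq_closure_of_nonempty_interior
    (𝒯.isSimplex hs).interior_nonempty]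
  exact subset_closure hxs

/-- Near `x`, every element meeting a small neighbourhood contains `x`. -/
lemma Triangulation.eventually_mem_cell (𝒯 : Triangulation n) (x : E n) :
    ∀ᶠ y in 𝓝 x, ∀ s ∈ 𝒯.cells, y ∈ cell s → x ∈ cell s := by
  rw [Filter.eventually_all_finset]
  intro s _
  by_cases h : x ∈ cell s
  · exact .of_forall fun _ _ => h
  · filter_upwards [(isClosed_cell s).isOpen_compl.mem_nhds h] with y hy hys
    exact absurd hys hy

lemma affine_lineMap (f : E n →ᵃ[ℝ] ℝ) (p x : E n) (e : ℝ) :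
    f (AffineMap.lineMap p x e) = (1 - e) * f p + e * f x := by
  rw [AffineMap.apply_lineMap, AffineMap.lineMap_apply_module]; simp

lemma continuous_affine (f : E n →ᵃ[ℝ] ℝ) : Continuous f := f.continuous_of_finiteDimensional

/-- If a vertex lies in the open domain, so does the part of each element around it where the
corresponding barycentric coordinate is positive. -/
lemma Triangulation.mem_domain_of_bary_pos (𝒯 : Triangulation n) {s : Finset (E n)}
    (hs : s ∈ 𝒯.cells) {p : E n} (hp : p ∈ s) (hpD : p ∈ 𝒯.domain) {x : E n} (hx : x ∈ cell s)
    (hpos : 0 < bary s p x) : x ∈ 𝒯.domain := by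
  have hcont : Continuous (fun e : ℝ => AffineMap.lineMap p x e) := AffineMap.lineMap_continuous
  -- Pulling `x` towards `p` by the homothety of ratio `e` lands at a point `y` of the open domain.
  -- The covering of a neighbourhood of `y` is then transported back to `x`.
  obtain ⟨e, he0, he1, heD⟩ : ∃ e : ℝ, 0 < e ∧ e < 1 ∧ AffineMap.lineMap p x e ∈ 𝒯.domain := by
    have h1 : ∀ᶠ e : ℝ in 𝓝 0, AffineMap.lineMap p x e ∈ 𝒯.domain :=
      hcont.continuousAt.eventually_mem (by
        rw [AffineMap.lineMap_apply_zero]; exact 𝒯.isOpen_domain.mem_nhds hpD)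
    have h2 : ∀ᶠ e : ℝ in 𝓝[>] 0, e ∈ Ioo (0:ℝ) 1 := Ioo_mem_nhdsGT one_pos
    obtain ⟨e, he, he'⟩ := ((h1.filter_mono nhdsWithin_le_nhds).and h2).exists
    exact ⟨e, he'.1, he'.2, he⟩
  set y := AffineMap.lineMap p x e with hy
  have hys : y ∈ cell s :=
    (convex_cell s).lineMap_mem (mem_cell_of_mem hp) hx ⟨he0.le, he1.le⟩
  have hS := 𝒯.isSimplex hs
  have hbs : bary s p y = (1 - e) + e * bary s p x := by
    rw [hy, affine_lineMap, hS.bary_self hp, mul_one]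
  -- A cell through `y` without the vertex `p` would meet `s` in a face on which the coordinate of
  -- `p` vanishes, whereas that coordinate is at least `1 - e` at `y`.
  have ht : ∀ t ∈ 𝒯.cells, y ∈ cell t → p ∈ t ∧ 0 < bary t p x := by
    intro t ht hyt
    have hT := 𝒯.isSimplex ht
    have hpt : p ∈ t := by
      by_contra hpt
      have h0 : bary s p y = (0 : E n →ᵃ[ℝ] ℝ) y :=
        affine_eqOn_convexHull (fun q hq => by
          rw [hS.bary_ne hq.1 (fun h : q = p => hpt (h ▸ hq.2))]; rfl)
          (𝒯.mem_convexHull_inter hs ht hys hyt)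
      rw [hbs] at h0
      have : (0 : E n →ᵃ[ℝ] ℝ) y = 0 := rfl
      rw [this] at h0
      nlinarith
    refine ⟨hpt, ?_⟩
    have h1 : bary s p y = bary t p y := 𝒯.nodal_eq_nodal hs ht hys hyt _
    have h2 : bary t p y = (1 - e) + e * bary t p x := by
      rw [hy, affine_lineMap, hT.bary_self hpt, mul_one]
    have h3 : e * bary s p x = e * bary t p x := by linarith
    rwa [← mul_left_cancel₀ he0.ne' h3]
  have hmap : Continuous (fun z : E n => AffineMap.lineMap p z e) := by
    simp only [AffineMap.lineMap_apply_module]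
    fun_prop
  have e1 : ∀ᶠ z in 𝓝 x, AffineMap.lineMap p z e ∈ 𝒯.domain :=
    hmap.continuousAt.eventually_mem (𝒯.isOpen_domain.mem_nhds heD)
  have e2 : ∀ᶠ z in 𝓝 x, ∀ t ∈ 𝒯.cells, AffineMap.lineMap p z e ∈ cell t → y ∈ cell t :=
    hmap.continuousAt.eventually (𝒯.eventually_mem_cell y)
  have e3 : ∀ᶠ z in 𝓝 x, ∀ t ∈ 𝒯.cells, 0 < bary t p x → 0 < bary t p z := by
    rw [Filter.eventually_all_finset]
    intro t _
    by_cases h : 0 < bary t p x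
    · filter_upwards [(continuous_affine (bary t p)).continuousAt.eventually_const_lt h]
        with z hz _ using hz
    · exact .of_forall fun _ h' => absurd h' h
  refine mem_interior_iff_mem_nhds.2 ?_
  filter_upwards [e1, e2, e3] with z h1 h2 h3
  obtain ⟨t, htm, hzt⟩ := Triangulation.mem_carrier.1 (𝒯.domain_subset_carrier h1)
  obtain ⟨hpt, hpos'⟩ := ht t htm (h2 t htm hzt)
  refine Triangulation.mem_carrier.2 ⟨t, htm, ?_⟩
  have hT := 𝒯.isSimplex htm
  rw [hT.mem_cell_iff] at hzt ⊢
  intro q hq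
  -- The homothety multiplies every coordinate other than that of `p` by `e`, so nonnegativity
  -- passes back to `z`; the coordinate of `p` is positive near `x` by continuity.
  by_cases hqp : q = p
  · rw [hqp]; exact (h3 t htm hpos').le
  · have := hzt q hq
    rw [affine_lineMap, hT.bary_ne hpt (Ne.symm hqp), mul_zero, zero_add] at this
    exact nonneg_of_mul_nonneg_right this he0

/-- A point of the carrier off the open domain has a vertex of its element, with positive
barycentric coordinate, off the open domain. -/
lemma Triangulation.exists_vertex_notMem (𝒯 : Triangulation n) {s : Finset (E n)}
    (hs : s ∈ 𝒯.cells) {x : E n} (hx : x ∈ cell s) (hxD : x ∉ 𝒯.domain) :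
    ∃ p ∈ s, p ∉ 𝒯.domain := by
  by_contra! h
  have hS := 𝒯.isSimplex hs
  have h0 : ∀ p ∈ s, bary s p x = 0 := fun p hp => by
    by_contra hne
    exact hxD (𝒯.mem_domain_of_bary_pos hs hp (h p hp) hx
      (lt_of_le_of_ne (hS.mem_cell_iff.1 hx p hp) (Ne.symm hne)))
  have h1 : nodal s (fun _ => 1) x = AffineMap.const ℝ (E n) (1:ℝ) x := by
    rw [hS.affine_ext (f := nodal s fun _ => 1) (g := AffineMap.const ℝ (E n) 1)
      fun p hp => by rw [hS.nodal_apply _ hp]; rfl]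
  rw [hS.nodal_eq_sum, Finset.sum_congr rfl fun p hp => by rw [h0 p hp]] at h1
  simp at h1

lemma Triangulation.mem_frontier_domain (𝒯 : Triangulation n) {x : E n} (hx : x ∈ 𝒯.carrier)
    (hxD : x ∉ 𝒯.domain) : x ∈ frontier 𝒯.domain := by
  rw [𝒯.isOpen_domain.frontier_eq]
  exact ⟨𝒯.carrier_subset_closure hx, hxD⟩

lemma IsBallMesh.norm_eq_one {𝒯 : Triangulation n} {h σ τ : ℝ} (hm : IsBallMesh 𝒯 h σ τ)
    {s : Finset (E n)} (hs : s ∈ 𝒯.cells) {p : E n} (hp : p ∈ s) (hpD : p ∉ 𝒯.domain) :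
    ‖p‖ = 1 := by
  simpa using hm.boundary_vertices s hs p hp
    (𝒯.mem_frontier_domain (Triangulation.mem_carrier.2 ⟨s, hs, mem_cell_of_mem hp⟩) hpD)

lemma IsBallMesh.le_norm_of_notMem {𝒯 : Triangulation n} {h σ τ : ℝ} (hm : IsBallMesh 𝒯 h σ τ)
    {s : Finset (E n)} (hs : s ∈ 𝒯.cells) {x : E n} (hx : x ∈ cell s) (hxD : x ∉ 𝒯.domain) :
    1 - h ≤ ‖x‖ := by
  obtain ⟨p, hp, hpD⟩ := 𝒯.exists_vertex_notMem hs hx hxD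
  have h1 := hm.norm_eq_one hs hp hpD
  have h2 : dist p x ≤ h := (dist_le_cellDiam (mem_cell_of_mem hp) hx).trans (hm.diam_le s hs)
  rw [dist_eq_norm] at h2
  have := norm_sub_norm_le p x
  linarith

/-- A mesh of the ball leaves no hole away from the unit sphere. -/
lemma IsBallMesh.ball_subset_domain {𝒯 : Triangulation n} {h σ τ : ℝ} (hm : IsBallMesh 𝒯 h σ τ)
    (hh : h ≤ 1 / 4) (hvol : ENNReal.ofReal (h ^ 2) < volume (ball (0 : E n) (3 / 4))) :
    ball (0 : E n) (3 / 4) ⊆ 𝒯.domain := by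
  -- By connectedness it suffices that the domain meets this ball, which the volume condition
  -- forces, and is relatively closed in it. A limit point outside the domain would lie in a cell
  -- with a vertex on the unit sphere, hence within `h ≤ 1/4` of that sphere.
  refine (convex_ball (0 : E n) (3 / 4)).isPreconnected.subset_of_closure_inter_subset
    𝒯.isOpen_domain ?_ ?_
  · by_contra hne
    rw [not_nonempty_iff_eq_empty] at hne
    have hsub : ball (0 : E n) (3 / 4) ⊆ ball 0 1 \ 𝒯.domain := fun x hx =>
      ⟨ball_subset_ball (by norm_num) hx, fun hD => by
        have : x ∈ (∅ : Set (E n)) := hne ▸ ⟨hx, hD⟩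
        exact this⟩
    exact absurd ((measure_mono hsub).trans hm.volume_diff) (not_le.2 hvol)
  · rintro x ⟨hxc, hxb⟩
    by_contra hxD
    have hxU : x ∈ 𝒯.carrier :=
      closure_minimal 𝒯.domain_subset_carrier 𝒯.isClosed_carrier hxc
    obtain ⟨s, hs, hxs⟩ := Triangulation.mem_carrier.1 hxU
    have := hm.le_norm_of_notMem hs hxs hxD
    rw [mem_ball_zero_iff] at hxb
    linarith

/-- Each element of a shape regular uniform mesh contains a ball of comparable size. -/
lemma IsBallMesh.exists_closedBall_subset (hn : 0 < n) {𝒯 : Triangulation n} {h σ τ : ℝ}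
    (hm : IsBallMesh 𝒯 h σ τ) (hh : 0 < h) {s : Finset (E n)} (hs : s ∈ 𝒯.cells) :
    ∃ (c : E n) (ρ : ℝ), 0 < ρ ∧ closedBall c ρ ⊆ cell s ∧ h ≤ 2 * (σ * τ) * ρ := by
  set A : Set ℝ := {ρ : ℝ | ∃ c : E n, closedBall c ρ ⊆ cell s} with hA
  have hdist : ∀ ρ ∈ A, 0 ≤ ρ → ρ ≤ cellDiam s := by
    rintro ρ ⟨c, hc⟩ hρ
    have h1 := dist_le_cellDiam (s := s) (x := c + ρ • EuclideanSpace.single ⟨0, hn⟩ (1:ℝ)) (y := c)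
      (hc (by simp [norm_smul, abs_of_nonneg hρ])) (hc (mem_closedBall_self hρ))
    simpa [norm_smul, abs_of_nonneg hρ] using h1
  have hbdd : BddAbove A := by
    -- Every negative `ρ` belongs to `A`, its closed ball being empty; hence the maximum with 0.
    refine ⟨max (cellDiam s) 0, fun ρ hρ => ?_⟩
    by_cases h0 : 0 ≤ ρ
    · exact (hdist ρ hρ h0).trans (le_max_left _ _)
    · exact (not_le.1 h0).le.trans (le_max_right _ _)
  obtain ⟨c₀, hc₀⟩ := (𝒯.isSimplex hs).interior_nonempty
  obtain ⟨δ, hδ, hδs⟩ := nhds_basis_closedBall.mem_iff.1 (mem_interior_iff_mem_nhds.1 hc₀)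
  have hδA : δ ∈ A := ⟨c₀, hδs⟩
  have hin : 0 < inradius s := lt_of_lt_of_le hδ (le_csSup hbdd hδA)
  have hdiam : 0 < cellDiam s := lt_of_lt_of_le hδ (hdist δ hδA hδ.le)
  -- Settling for more than half of the supremum avoids showing that it is attained, at the price of
  -- the factor 2 in the conclusion.
  obtain ⟨ρ, ⟨c, hc⟩, hρ⟩ := exists_lt_of_lt_csSup ⟨δ, hδA⟩
    (show inradius s / 2 < sSup A from half_lt_self hin)
  refine ⟨c, ρ, by linarith, hc, ?_⟩
  have h1 := (div_le_iff₀ hin).1 (hm.shape_regular s hs)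
  have h2 := (div_le_iff₀ hdiam).1 (hm.uniform s hs)
  have hτ : 0 < τ := pos_of_mul_pos_left (hh.trans_le h2) hdiam.le
  have hσ : 0 < σ := pos_of_mul_pos_left (hdiam.trans_le h1) hin.le
  calc h ≤ τ * cellDiam s := h2
    _ ≤ τ * (σ * (2 * ρ)) := by gcongr; linarith [mul_le_mul_of_nonneg_left hρ.le hσ.le]
    _ = _ := by ring

/-! ### The global interpolant -/

/-- Local control with one constant becomes global by following the segment from `x` to `y`; the
slack `ε` supplies the strict inequality required by the comparison of slopes. -/
lemma lipschitzWith_of_eventually_le {f : E n → ℝ} {K : ℝ≥0}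
    (hf : ∀ x, ∀ᶠ y in 𝓝 x, |f y - f x| ≤ K * ‖y - x‖) : LipschitzWith K f := by
  have hc : Continuous f := by
    refine continuous_iff_continuousAt.2 fun x => ?_
    rw [ContinuousAt, tendsto_iff_norm_sub_tendsto_zero]
    refine squeeze_zero' (.of_forall fun _ => norm_nonneg _) (hf x) ?_
    have : Continuous fun y : E n => (K:ℝ) * ‖y - x‖ := by fun_prop
    simpa using this.tendsto x
  refine LipschitzWith.of_dist_le_mul fun y x => ?_
  rw [dist_eq_norm, dist_eq_norm]
  refine le_of_forall_pos_le_add fun ε hε => ?_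
  set g : ℝ → ℝ := fun t => f (x + t • (y - x)) - f x with hg
  have hgc : Continuous g := by fun_prop
  have key := image_norm_le_of_liminf_right_slope_norm_lt_deriv_boundary (f := g) (a := 0) (b := 1)
    (f' := fun _ => K * ‖y - x‖) (B := fun t => (K * ‖y - x‖ + ε) * t)
    (B' := fun _ => K * ‖y - x‖ + ε) hgc.continuousOn ?_ (by simp [hg]) (by fun_prop)
    (fun t _ => by simpa using ((hasDerivAt_id t).const_mul _).hasDerivWithinAt)
    (fun t _ _ => by linarith) (right_mem_Icc.2 zero_le_one)
  · simpa [hg] using key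
  · intro t _ r hr
    refine Eventually.frequently ?_
    have hm : ContinuousAt (fun z : ℝ => x + z • (y - x)) t := by fun_prop
    have h1 := hm.eventually (hf (x + t • (y - x)))
    filter_upwards [h1.filter_mono nhdsWithin_le_nhds, self_mem_nhdsWithin] with z hz hzt
    refine lt_of_le_of_lt ?_ hr
    have hzt' : 0 < z - t := sub_pos.2 hzt
    rw [slope_def_field, div_le_iff₀ hzt']
    have h2 : x + z • (y - x) - (x + t • (y - x)) = (z - t) • (y - x) := by
      rw [sub_smul]; abel
    rw [h2, norm_smul, Real.norm_of_nonneg hzt'.le] at hz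
    calc (norm ∘ g) z - (norm ∘ g) t ≤ ‖g z - g t‖ := norm_sub_norm_le _ _
      _ = |f (x + z • (y - x)) - f (x + t • (y - x))| := by
        rw [Real.norm_eq_abs]; congr 1; simp only [hg]; ring
      _ ≤ _ := hz
      _ = _ := by ring

lemma affine_lipschitz (f : E n →ᵃ[ℝ] ℝ) : ∃ K : ℝ≥0, ∀ x y, |f y - f x| ≤ K * ‖y - x‖ := by
  refine ⟨‖f.linear.toContinuousLinearMap‖₊, fun x y => ?_⟩
  have h := f.linearMap_vsub y x
  simp only [vsub_eq_sub] at h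
  rw [← h]
  exact f.linear.toContinuousLinearMap.le_opNorm (y - x)

open Classical in
/-- The continuous piecewise affine function with nodal values `c`, extended by zero. -/
def Triangulation.interp (𝒯 : Triangulation n) (c : E n → ℝ) (x : E n) : ℝ :=
  if h : ∃ s ∈ 𝒯.cells, x ∈ cell s then nodal h.choose c x else 0

lemma Triangulation.interp_eq_nodal (𝒯 : Triangulation n) (c : E n → ℝ) {s : Finset (E n)}
    (hs : s ∈ 𝒯.cells) {x : E n} (hx : x ∈ cell s) : 𝒯.interp c x = nodal s c x := by
  have h : ∃ s ∈ 𝒯.cells, x ∈ cell s := ⟨s, hs, hx⟩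
  rw [Triangulation.interp, dif_pos h]
  exact 𝒯.nodal_eq_nodal h.choose_spec.1 hs h.choose_spec.2 hx c

lemma Triangulation.interp_eq_zero_of_notMem_carrier (𝒯 : Triangulation n) (c : E n → ℝ) {x : E n}
    (hx : x ∉ 𝒯.carrier) : 𝒯.interp c x = 0 := by
  rw [Triangulation.interp, dif_neg fun h => hx (Triangulation.mem_carrier.2 h)]

lemma Triangulation.interp_eq_zero (𝒯 : Triangulation n) {c : E n → ℝ}
    (hc : ∀ s ∈ 𝒯.cells, ∀ p ∈ s, p ∉ 𝒯.domain → c p = 0) {x : E n} (hx : x ∉ 𝒯.domain) :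
    𝒯.interp c x = 0 := by
  by_cases hU : x ∈ 𝒯.carrier
  · obtain ⟨s, hs, hxs⟩ := Triangulation.mem_carrier.1 hU
    have hS := 𝒯.isSimplex hs
    rw [𝒯.interp_eq_nodal c hs hxs, hS.nodal_eq_sum]
    refine Finset.sum_eq_zero fun p hp => ?_
    by_cases hpD : p ∈ 𝒯.domain
    · have : ¬ 0 < bary s p x := fun h => hx (𝒯.mem_domain_of_bary_pos hs hp hpD hxs h)
      rw [le_antisymm (not_lt.1 this) (hS.mem_cell_iff.1 hxs p hp), mul_zero]
    · rw [hc s hs p hp hpD, zero_mul]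
  · exact 𝒯.interp_eq_zero_of_notMem_carrier c hU

/-- Any `y` of the carrier close to `x` shares a cell with `x`, so the largest slope over the
finitely many cells works locally. If `y` is off the carrier, then `x` is off the open domain and
both values vanish. -/
lemma Triangulation.interp_lipschitz (𝒯 : Triangulation n) {c : E n → ℝ}
    (hc : ∀ s ∈ 𝒯.cells, ∀ p ∈ s, p ∉ 𝒯.domain → c p = 0) :
    ∃ K, LipschitzWith K (𝒯.interp c) := by
  choose K hK using fun s => affine_lipschitz (nodal (n := n) s c)
  refine ⟨𝒯.cells.sup K, lipschitzWith_of_eventually_le fun x => ?_⟩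
  have h2 : ∀ᶠ y in 𝓝 x, x ∈ 𝒯.domain → y ∈ 𝒯.domain := by
    by_cases h : x ∈ 𝒯.domain
    · filter_upwards [𝒯.isOpen_domain.mem_nhds h] with y hy _ using hy
    · exact .of_forall fun _ h' => absurd h' h
  filter_upwards [𝒯.eventually_mem_cell x, h2] with y hy hyD
  by_cases hU : y ∈ 𝒯.carrier
  · obtain ⟨s, hs, hys⟩ := Triangulation.mem_carrier.1 hU
    rw [𝒯.interp_eq_nodal c hs hys, 𝒯.interp_eq_nodal c hs (hy s hs hys)]
    refine (hK s x y).trans ?_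
    have : K s ≤ 𝒯.cells.sup K := Finset.le_sup hs
    gcongr
  · have hyD' : y ∉ 𝒯.domain := fun h => hU (𝒯.domain_subset_carrier h)
    rw [𝒯.interp_eq_zero hc hyD', 𝒯.interp_eq_zero hc fun h => hyD' (hyD h)]
    simp only [sub_self, abs_zero]
    positivity

/-- Nodal values supported away from the unit sphere define a finite element function. -/
lemma IsBallMesh.interp_mem {𝒯 : Triangulation n} {h σ τ : ℝ} (hm : IsBallMesh 𝒯 h σ τ)
    (hh : h ≤ 1 / 4) {c : E n → ℝ} (hc : ∀ p, 1 / 2 < ‖p‖ → c p = 0) :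
    MemH10 (ball (0 : E n) 1) (𝒯.interp c) (gradient (𝒯.interp c)) ∧ 𝒯.interp c ∈ 𝒯.feSpace := by
  have hc' : ∀ s ∈ 𝒯.cells, ∀ p ∈ s, p ∉ 𝒯.domain → c p = 0 := fun s hs p hp hpD =>
    hc p (by rw [hm.norm_eq_one hs hp hpD]; norm_num)
  have hsupp : tsupport (𝒯.interp c) ⊆ closedBall 0 (3 / 4) := by
    refine closure_minimal (fun x hx => ?_) isClosed_closedBall
    by_contra hxb
    refine hx ?_
    by_cases hU : x ∈ 𝒯.carrier
    · obtain ⟨s, hs, hxs⟩ := Triangulation.mem_carrier.1 hU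
      have hS := 𝒯.isSimplex hs
      rw [𝒯.interp_eq_nodal c hs hxs, hS.nodal_eq_sum]
      refine Finset.sum_eq_zero fun p hp => ?_
      rw [hc p, zero_mul]
      have h2 : dist x p ≤ h :=
        (dist_le_cellDiam hxs (mem_cell_of_mem hp)).trans (hm.diam_le s hs)
      rw [dist_eq_norm] at h2
      have h3 := norm_sub_norm_le x p
      rw [mem_closedBall_zero_iff, not_le] at hxb
      linarith
    · exact 𝒯.interp_eq_zero_of_notMem_carrier c hU
  obtain ⟨K, hK⟩ := 𝒯.interp_lipschitz hc'
  have hH : MemH10 (ball (0 : E n) 1) (𝒯.interp c) (gradient (𝒯.interp c)) :=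
    MemH10.of_lipschitz isOpen_ball measure_ball_lt_top.ne hK
      (HasCompactSupport.of_support_subset_isCompact (isCompact_closedBall 0 (3 / 4))
        ((subset_tsupport _).trans hsupp))
      (hsupp.trans (closedBall_subset_ball (by norm_num)))
  exact ⟨hH, ⟨_, hH⟩, fun x hx => 𝒯.interp_eq_zero hc' hx, fun s hs =>
    ⟨nodal s c, fun x hx => 𝒯.interp_eq_nodal c hs hx⟩⟩

/-! ### Inverse estimate and lower bound -/

lemma volume_real_ball_pos (n : ℕ) : 0 < volume.real (ball (0 : E n) 1) :=
  ENNReal.toReal_pos (measure_ball_pos _ _ one_pos).ne' measure_ball_lt_top.ne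

/-- In polar coordinates the integrand is `y^(n-3)`, which is at most 1 because `n ≥ 3` and `R ≤ 1`.
-/
lemma setIntegral_inv_norm_sq_le (hn : 3 ≤ n) {R : ℝ} (hR : 0 < R) (hR1 : R ≤ 1) :
    IntegrableOn (fun x : E n => (‖x‖ ^ 2)⁻¹) (ball 0 R) ∧
    ∫ x in ball (0 : E n) R, (‖x‖ ^ 2)⁻¹ ≤ n * volume.real (ball (0 : E n) 1) * R := by
  have : Nontrivial (E n) := by
    have : Nonempty (Fin n) := ⟨⟨0, by omega⟩⟩
    infer_instance
  have hpt : ∀ y ∈ Ioo 0 R, ‖y ^ (n - 1) • (y ^ 2)⁻¹‖ ≤ 1 := by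
    intro y hy
    have hy0 : 0 < y := hy.1
    have e : y ^ (n - 1) = y ^ (n - 3) * y ^ 2 := by rw [← pow_add]; congr 1; omega
    rw [smul_eq_mul, e, mul_assoc, mul_inv_cancel₀ (by positivity), mul_one,
      Real.norm_of_nonneg (by positivity)]
    exact pow_le_one₀ hy0.le (hy.2.le.trans hR1)
  have hmeas : Measurable (fun y : ℝ => y ^ (n - 1) • (y ^ 2)⁻¹) := by fun_prop
  have hint : IntegrableOn (fun y : ℝ => y ^ (n - 1) • (y ^ 2)⁻¹) (Ioo 0 R) :=
    Measure.integrableOn_of_bounded (M := 1) (by simp) hmeas.aestronglyMeasurable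
      ((ae_restrict_iff' measurableSet_Ioo).2 (.of_forall hpt))
  have h1 : IntegrableOn (fun x : E n => (‖x‖ ^ 2)⁻¹) (ball 0 R) := by
    have := (integrableOn_fun_norm_addHaar (E := E n) volume (f := fun y => (y ^ 2)⁻¹)
      (r := R)).2 (by simpa using hint)
    exact this
  refine ⟨h1, ?_⟩
  have e1 : ∫ x in ball (0 : E n) R, (‖x‖ ^ 2)⁻¹ =
      ∫ x : E n, (Iio R).indicator (fun y => (y ^ 2)⁻¹) ‖x‖ := by
    rw [← integral_indicator measurableSet_ball]
    congr 1
    ext x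
    simp [indicator]
  have e2 : ∀ y : ℝ, y ^ (n - 1) • (Iio R).indicator (fun y => (y ^ 2)⁻¹) y =
      (Iio R).indicator (fun y => y ^ (n - 1) • (y ^ 2)⁻¹) y := fun y => by
    by_cases hy : y ∈ Iio R
    · rw [indicator_of_mem hy, indicator_of_mem hy]
    · rw [indicator_of_notMem hy, indicator_of_notMem hy, smul_zero]
  rw [e1, integral_fun_norm_addHaar, finrank_euclideanSpace_fin, nsmul_eq_mul, smul_eq_mul,
    mul_assoc]
  refine mul_le_mul_of_nonneg_left (mul_le_mul_of_nonneg_left ?_ measureReal_nonneg)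
    (Nat.cast_nonneg n)
  simp only [e2]
  rw [setIntegral_indicator measurableSet_Iio, Ioi_inter_Iio]
  calc _ ≤ ‖∫ y in Ioo 0 R, y ^ (n - 1) • (y ^ 2)⁻¹‖ := le_abs_self _
    _ ≤ 1 * volume.real (Ioo 0 R) := norm_setIntegral_le_of_norm_le_const (by simp) hpt
    _ = R := by simp [hR.le]

/-- Inverse estimate: finite element functions are bounded by their weighted `L²` norm. -/
lemma IsBallMesh.inverse_estimate (hn : 3 ≤ n) {𝒯 : Triangulation n} {h σ τ κ : ℝ}
    (hm : IsBallMesh 𝒯 h σ τ) (hh : 0 < h) (hκ0 : 0 < κ) (hκ : 2 * (σ * τ) ≤ κ) {v : E n → ℝ}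
    (hv : v ∈ 𝒯.feSpace) (x₀ : E n) :
    v x₀ ^ 2 * ((h / (4 * κ)) ^ n * volume.real (ball (0 : E n) 1)) ≤
      4 * ∫ x in ball (0 : E n) 1, (‖x‖ ^ 2)⁻¹ * v x ^ 2 := by
  obtain ⟨⟨G, hG⟩, hv0, haff⟩ := hv
  have hint := (hardy_integral hn hG).1
  by_cases hz : v x₀ = 0
  · rw [hz]
    have : 0 ≤ ∫ x in ball (0 : E n) 1, (‖x‖ ^ 2)⁻¹ * v x ^ 2 :=
      integral_nonneg fun x => by positivity
    simpa using this
  have hxD : x₀ ∈ 𝒯.domain := by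
    by_contra hxD; exact hz (hv0 x₀ hxD)
  obtain ⟨s, hs, hxs⟩ := Triangulation.mem_carrier.1 (𝒯.domain_subset_carrier hxD)
  obtain ⟨f, hf⟩ := haff s hs
  -- At a maximiser `p` of `|f|` on the cell, the homothety of centre `p` and ratio `1/4` sends the
  -- inscribed ball to a ball where `|f| ≥ (3/4 - 1/4) |f p|`. The weight is at least 1 there, so
  -- this ball alone bounds the integral below.
  obtain ⟨p, hp, hpmax⟩ := (isCompact_cell s).exists_isMaxOn ⟨x₀, hxs⟩
    (continuous_affine f).abs.continuousOn
  have hmx : |v x₀| ≤ |f p| := by rw [hf hxs]; exact hpmax hxs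
  obtain ⟨c, ρ, hρ, hball, hhρ⟩ := hm.exists_closedBall_subset (by omega) hh hs
  set c' : E n := p + (1 / 4 : ℝ) • (c - p) with hc'
  have hA : ∀ y ∈ ball c' (ρ / 4), y ∈ cell s ∧ |f p| / 2 ≤ |f y| := by
    intro y hy
    set z : E n := p + (4:ℝ) • (y - p) with hz
    have hyz : y = AffineMap.lineMap p z (1 / 4 : ℝ) := by
      rw [AffineMap.lineMap_apply_module', hz]
      simp [smul_smul]
    have hzs : z ∈ cell s := by
      refine hball ?_
      rw [mem_closedBall, dist_eq_norm]
      have : z - c = (4:ℝ) • (y - c') := by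
        rw [hz, hc']; module
      rw [this, norm_smul]
      rw [mem_ball, dist_eq_norm] at hy
      simp only [Real.norm_ofNat]
      linarith
    refine ⟨?_, ?_⟩
    · rw [hyz]
      exact (convex_cell s).lineMap_mem hp hzs ⟨by norm_num, by norm_num⟩
    · have h1 : f y = (1 - 1 / 4) * f p + 1 / 4 * f z := by
        conv_lhs => rw [hyz]
        exact affine_lineMap f p z _
      have h2 : |f z| ≤ |f p| := hpmax hzs
      have h3 : |(1 - 1 / 4) * f p| - |1 / 4 * f z| ≤ |f y| := by
        rw [h1]
        have := abs_sub_abs_le_abs_sub ((1 - 1 / 4) * f p) (-(1 / 4 * f z))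
        rwa [abs_neg, sub_neg_eq_add] at this
      rw [abs_mul, abs_mul] at h3
      norm_num at h3
      linarith
  have hAB : ball c' (ρ / 4) ⊆ ball 0 1 := fun y hy =>
    hm.domain_subset (𝒯.interior_cell_subset hs
      (interior_maximal (fun z hz => (hA z hz).1) isOpen_ball hy))
  have hvol : volume.real (ball c' (ρ / 4)) = (ρ / 4) ^ n * volume.real (ball (0 : E n) 1) := by
    rw [measureReal_def, Measure.addHaar_ball_of_pos _ _ (by positivity), ENNReal.toReal_mul,
      ENNReal.toReal_ofReal (by positivity), finrank_euclideanSpace_fin, measureReal_def]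
  have hconst : ∫ _ in ball c' (ρ / 4), v x₀ ^ 2 / 4 =
      (ρ / 4) ^ n * volume.real (ball (0 : E n) 1) * (v x₀ ^ 2 / 4) := by
    rw [setIntegral_const, smul_eq_mul, hvol]
  have hle : ∫ _ in ball c' (ρ / 4), v x₀ ^ 2 / 4 ≤
      ∫ x in ball (0 : E n) 1, (‖x‖ ^ 2)⁻¹ * v x ^ 2 := by
    refine le_trans ?_ (setIntegral_mono_set hint (.of_forall fun x => by positivity)
      (LE.le.eventuallyLE hAB))
    refine setIntegral_mono_on_ae (integrableOn_const measure_ball_lt_top.ne)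
      (hint.mono_set hAB) measurableSet_ball ?_
    have hNe : ∀ᵐ x : E n ∂volume, x ≠ 0 := by
      have : Nontrivial (E n) := by
        have : Nonempty (Fin n) := ⟨⟨0, by omega⟩⟩
        infer_instance
      exact Measure.ae_ne _ _
    filter_upwards [hNe] with y hy0 hy
    have h1 : ‖y‖ < 1 := by simpa using hAB hy
    have h2 : 0 < ‖y‖ := norm_pos_iff.2 hy0
    have h3 : 1 ≤ (‖y‖ ^ 2)⁻¹ := (one_le_inv₀ (by positivity)).2 (by nlinarith)
    obtain ⟨hys, hfy⟩ := hA y hy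
    have h4 : v x₀ ^ 2 / 4 ≤ v y ^ 2 := by
      rw [hf hys, ← sq_abs (v x₀), ← sq_abs (f y)]
      nlinarith [abs_nonneg (v x₀), abs_nonneg (f y)]
    nlinarith [sq_nonneg (v y)]
  rw [hconst] at hle
  have hω := volume_real_ball_pos n
  have hρκ : h / (4 * κ) ≤ ρ / 4 := by
    rw [div_le_div_iff₀ (by positivity) (by norm_num)]
    nlinarith
  have hpow : (h / (4 * κ)) ^ n ≤ (ρ / 4) ^ n := by gcongr
  calc _ ≤ v x₀ ^ 2 * ((ρ / 4) ^ n * volume.real (ball (0 : E n) 1)) := by gcongr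
    _ ≤ _ := by linarith

/-- The inverse estimate at a point where `v` does not vanish. The absolute value makes `κ` positive
without any sign information on `σ` and `τ`. -/
lemma IsBallMesh.denominator_pos (hn : 3 ≤ n) {𝒯 : Triangulation n} {h σ τ : ℝ}
    (hm : IsBallMesh 𝒯 h σ τ) (hh : 0 < h) {v : E n → ℝ} (hv : v ∈ 𝒯.feSpace) (hv0 : v ≠ 0) :
    0 < ∫ x in ball (0 : E n) 1, (‖x‖ ^ 2)⁻¹ * v x ^ 2 := by
  obtain ⟨x, hx⟩ := Function.ne_iff.1 hv0
  have := hm.inverse_estimate hn hh (κ := |2 * (σ * τ)| + 1) (by positivity)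
    (by linarith [le_abs_self (2 * (σ * τ))]) hv x
  have hω := volume_real_ball_pos n
  have hx2 : 0 < v x ^ 2 := by
    have : v x ≠ 0 := hx
    positivity
  have hpos : 0 < v x ^ 2 * ((h / (4 * (|2 * (σ * τ)| + 1))) ^ n *
      volume.real (ball (0 : E n) 1)) := by positivity
  linarith

theorem hardyQuotient_lower_bound (hn : 3 ≤ n) :
    ∃ C : ℝ, 0 < C ∧ ∀ σ τ : ℝ, ∃ h₀ : ℝ, 0 < h₀ ∧
      ∀ (h : ℝ) (𝒯 : Triangulation n), 0 < h → h < h₀ → IsBallMesh 𝒯 h σ τ →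
        ∀ q ∈ 𝒯.hardyQuotients, ((n : ℝ) - 2) ^ 2 / 4 + C / |Real.log h| ^ 2 ≤ q := by
  -- For `|log h| > 1` one has `2 - log R ≤ (n+3) |log h|`, so the gain is at least `1 / (4 (n+3)²
  -- |log h|²)`; only half of the denominator benefits from it.
  refine ⟨1 / (8 * ((n:ℝ) + 3) ^ 2), by positivity, fun σ τ => ?_⟩
  set κ : ℝ := |2 * (σ * τ)| + 1 with hκ
  have hκ0 : 0 < κ := by positivity
  have hn0 : (0:ℝ) < n := by exact_mod_cast (by omega : 0 < n)
  -- The first bound gives `|log h| > 1`; the second makes the share of the inner ball, `4 n (4κ)^n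
  -- h`, at most one half.
  refine ⟨min (Real.exp (-1)) (1 / (8 * n * (4 * κ) ^ n)), by positivity, ?_⟩
  rintro h 𝒯 hh hh0 hm q ⟨v, G, hv, hvne, hG, rfl⟩
  have hD := hm.denominator_pos hn hh hv hvne
  obtain ⟨hint, -, hardy⟩ := hardy_integral hn hG
  set D := ∫ x in ball (0 : E n) 1, (‖x‖ ^ 2)⁻¹ * v x ^ 2 with hDdef
  have hh1 : h < Real.exp (-1) := hh0.trans_le (min_le_left _ _)
  have hh2 : h ≤ 1 / (8 * n * (4 * κ) ^ n) := (hh0.trans_le (min_le_right _ _)).le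
  have hlog : Real.log h < -1 := by
    rw [← Real.log_exp (-1)]; exact Real.log_lt_log hh hh1
  have hlt1 : h < 1 := (Real.log_neg_iff hh).1 (by linarith)
  set R : ℝ := h ^ (n + 1) with hR
  have hR0 : 0 < R := by positivity
  have hR1 : R < 1 := pow_lt_one₀ hh.le hlt1 (by omega)
  have hω := volume_real_ball_pos n
  set W := volume.real (ball (0 : E n) 1)
  have hsup : ∀ x, v x ^ 2 ≤ 4 * D / ((h / (4 * κ)) ^ n * W) := fun x => by
    rw [le_div_iff₀ (by positivity)]
    exact hm.inverse_estimate hn hh hκ0 (by linarith [le_abs_self (2 * (σ * τ))]) hv x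
  have hsmall : ∫ x in ball (0 : E n) R, (‖x‖ ^ 2)⁻¹ * v x ^ 2 ≤ D / 2 := by
    obtain ⟨i1, i2⟩ := setIntegral_inv_norm_sq_le hn hR0 hR1.le
    calc _ ≤ ∫ x in ball (0 : E n) R, (‖x‖ ^ 2)⁻¹ * (4 * D / ((h / (4 * κ)) ^ n * W)) := by
          refine setIntegral_mono (hint.mono_set (ball_subset_ball hR1.le)) (i1.mul_const _)
            fun x => ?_
          exact mul_le_mul_of_nonneg_left (hsup x) (by positivity)
      _ = (∫ x in ball (0 : E n) R, (‖x‖ ^ 2)⁻¹) * (4 * D / ((h / (4 * κ)) ^ n * W)) :=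
          integral_mul_const _ _
      _ ≤ (n * W * R) * (4 * D / ((h / (4 * κ)) ^ n * W)) := by gcongr
      _ = 4 * n * (4 * κ) ^ n * h * D := by
          rw [hR, div_pow, pow_succ]
          field_simp
      _ ≤ 4 * n * (4 * κ) ^ n * (1 / (8 * n * (4 * κ) ^ n)) * D := by gcongr
      _ = D / 2 := by field_simp; norm_num
  have hms : MeasurableSet {y : E n | R ≤ ‖y‖} := measurableSet_le measurable_const measurable_norm
  have hsplit : D = (∫ x in ball (0 : E n) 1 ∩ {y | R ≤ ‖y‖}, (‖x‖ ^ 2)⁻¹ * v x ^ 2) +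
      ∫ x in ball (0 : E n) R, (‖x‖ ^ 2)⁻¹ * v x ^ 2 := by
    have hset : ball (0 : E n) 1 \ {y | R ≤ ‖y‖} = ball 0 R := by
      ext x
      simp only [Set.mem_sdiff, mem_ball_zero_iff, mem_ofPred_eq, not_le]
      exact ⟨fun h => h.2, fun h => ⟨h.trans hR1, h⟩⟩
    rw [hDdef, ← integral_inter_add_sdiff hms hint, hset]
  have hmain := hardy R hR0 hR1
  have hlogR : Real.log R = -((n + 1) * |Real.log h|) := by
    rw [hR, Real.log_pow, abs_of_neg (by linarith)]
    push_cast
    ring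
  have habs : 1 < |Real.log h| := by rw [abs_of_neg (by linarith)]; linarith
  have hb : 1 / (2 * (((n:ℝ) + 3) * |Real.log h|)) ≤ 1 / (2 * (2 - Real.log R)) := by
    rw [hlogR]
    apply one_div_le_one_div_of_le
    · nlinarith
    · nlinarith
  have hb2 : (1 / (2 * (((n:ℝ) + 3) * |Real.log h|))) ^ 2 ≤ (1 / (2 * (2 - Real.log R))) ^ 2 := by
    have : 0 ≤ 1 / (2 * (((n:ℝ) + 3) * |Real.log h|)) := by positivity
    gcongr
  rw [le_div_iff₀ hD]
  have hI : D / 2 ≤ ∫ x in ball (0 : E n) 1 ∩ {y | R ≤ ‖y‖}, (‖x‖ ^ 2)⁻¹ * v x ^ 2 := by linarith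
  calc _ = ((n : ℝ) - 2) ^ 2 / 4 * D +
        (1 / (2 * (((n:ℝ) + 3) * |Real.log h|))) ^ 2 * (D / 2) := by
        field_simp; ring
    _ ≤ _ := by gcongr
    _ ≤ _ := hmain

/-! ### The minimum is attained -/

/-- The finite element space as a vector space. -/
def Triangulation.feSubmodule (𝒯 : Triangulation n) : Submodule ℝ (E n → ℝ) where
  carrier := 𝒯.feSpace
  zero_mem' := ⟨⟨_, MemH10.zero _⟩, fun _ _ => rfl, fun _ _ => ⟨0, fun _ _ => rfl⟩⟩
  add_mem' := by
    rintro v w ⟨⟨G, hG⟩, hv0, hva⟩ ⟨⟨H, hH⟩, hw0, hwa⟩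
    refine ⟨⟨_, hG.add hH⟩, fun x hx => by simp [hv0 x hx, hw0 x hx], fun s hs => ?_⟩
    obtain ⟨f, hf⟩ := hva s hs
    obtain ⟨g, hg⟩ := hwa s hs
    exact ⟨f + g, fun x hx => by simp [hf hx, hg hx]⟩
  smul_mem' := by
    rintro c v ⟨⟨G, hG⟩, hv0, hva⟩
    refine ⟨⟨_, hG.const_mul c⟩, fun x hx => by simp [hv0 x hx], fun s hs => ?_⟩
    obtain ⟨f, hf⟩ := hva s hs
    refine ⟨c • f, fun x hx => ?_⟩
    change c * v x = c * f x
    rw [hf hx]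

lemma Triangulation.eq_zero_of_vertices (𝒯 : Triangulation n) {v : E n → ℝ} (hv : v ∈ 𝒯.feSpace)
    (h0 : ∀ s ∈ 𝒯.cells, ∀ p ∈ s, v p = 0) : v = 0 := by
  funext x
  by_cases hx : x ∈ 𝒯.domain
  · obtain ⟨s, hs, hxs⟩ := Triangulation.mem_carrier.1 (𝒯.domain_subset_carrier hx)
    obtain ⟨f, hf⟩ := hv.2.2 s hs
    have hf0 : f = 0 := (𝒯.isSimplex hs).affine_ext fun p hp => by
      rw [← hf (mem_cell_of_mem hp), h0 s hs p hp]; rfl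
    rw [hf hxs, hf0]
    rfl
  · exact hv.2.1 x hx

instance Triangulation.finite_feSubmodule (𝒯 : Triangulation n) :
    Module.Finite ℝ 𝒯.feSubmodule := by
  classical
  let V : Finset (E n) := 𝒯.cells.biUnion id
  let L : 𝒯.feSubmodule →ₗ[ℝ] (V → ℝ) :=
    { toFun := fun v p => v.1 p
      map_add' := fun _ _ => rfl
      map_smul' := fun _ _ => rfl }
  refine Module.Finite.of_injective L ((injective_iff_map_eq_zero L).2 fun v hv => ?_)
  refine Subtype.ext (𝒯.eq_zero_of_vertices v.2 fun s hs p hp => ?_)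
  exact congrFun hv ⟨p, Finset.mem_biUnion.2 ⟨s, hs, hp⟩⟩

/-- The integral is a quadratic form in `c`, given by the Gram matrix of the `f i`. -/
lemma continuous_integral_norm_sq_sum {F : Type*} [NormedAddCommGroup F] [InnerProductSpace ℝ F]
    {μ : Measure (E n)} {k : ℕ} {f : Fin k → E n → F} (hf : ∀ i, MemLp (f i) 2 μ) :
    Continuous fun c : Fin k → ℝ => ∫ x, ‖∑ i, c i • f i x‖ ^ 2 ∂μ := by
  have hi : ∀ i j, Integrable (fun x => inner ℝ (f i x) (f j x)) μ := fun i j =>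
    ((hf i).norm.integrable_mul (hf j).norm).mono' ((hf i).1.inner (hf j).1)
      (.of_forall fun x => norm_inner_le_norm _ _)
  have h : ∀ c : Fin k → ℝ, ∫ x, ‖∑ i, c i • f i x‖ ^ 2 ∂μ =
      ∑ i, ∑ j, c i * (c j * ∫ x, inner ℝ (f i x) (f j x) ∂μ) := by
    intro c
    have hpt : ∀ x, ‖∑ i, c i • f i x‖ ^ 2 =
        ∑ i, ∑ j, c i * (c j * inner ℝ (f i x) (f j x)) := fun x => by
      rw [← real_inner_self_eq_norm_sq, sum_inner]
      refine Finset.sum_congr rfl fun i _ => ?_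
      rw [inner_sum]
      refine Finset.sum_congr rfl fun j _ => ?_
      rw [real_inner_smul_left, real_inner_smul_right]
    simp only [hpt]
    rw [integral_finsetSum _ fun i _ => integrable_finsetSum _ fun j _ =>
      ((hi i j).const_mul _).const_mul _]
    refine Finset.sum_congr rfl fun i _ => ?_
    rw [integral_finsetSum _ fun j _ => ((hi i j).const_mul _).const_mul _]
    simp only [integral_const_mul]
  simp only [h]
  fun_prop

/-- The quotient has degree zero, so minimising over the compact unit sphere suffices. -/
lemma exists_min_quotient {k : ℕ} (hk : 0 < k) {N D : (Fin k → ℝ) → ℝ} (hN : Continuous N)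
    (hD : Continuous D) (hNh : ∀ (a : ℝ) c, N (a • c) = a ^ 2 * N c)
    (hDh : ∀ (a : ℝ) c, D (a • c) = a ^ 2 * D c) (hDpos : ∀ c, c ≠ 0 → 0 < D c) :
    ∃ c, c ≠ 0 ∧ ∀ d, d ≠ 0 → N c / D c ≤ N d / D d := by
  have : Nonempty (Fin k) := ⟨⟨0, hk⟩⟩
  obtain ⟨c, hc, hmin⟩ := (isCompact_sphere (0 : Fin k → ℝ) 1).exists_isMinOn
    (NormedSpace.sphere_nonempty.2 zero_le_one) (f := fun c => N c / D c)
    (hN.continuousOn.div hD.continuousOn fun c hc =>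
      (hDpos c (ne_of_mem_sphere hc one_ne_zero)).ne')
  refine ⟨c, ne_of_mem_sphere hc one_ne_zero, fun d hd => ?_⟩
  have hd' : 0 < ‖d‖ := norm_pos_iff.2 hd
  have hmem : ‖d‖⁻¹ • d ∈ sphere (0 : Fin k → ℝ) 1 := by
    rw [mem_sphere_zero_iff_norm, norm_smul, norm_inv, norm_norm, inv_mul_cancel₀ hd'.ne']
  have h1 : N c / D c ≤ N (‖d‖⁻¹ • d) / D (‖d‖⁻¹ • d) := hmin hmem
  rwa [hNh, hDh, mul_div_mul_left _ _ (by positivity)] at h1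

lemma integral_norm_sq_eq_of_memH10 {v : E n → ℝ} {G H : E n → E n}
    (hG : MemH10 (ball (0 : E n) 1) v G) (hH : MemH10 (ball (0 : E n) 1) v H) :
    ∫ x in ball (0 : E n) 1, ‖G x‖ ^ 2 = ∫ x in ball (0 : E n) 1, ‖H x‖ ^ 2 := by
  refine integral_congr_ae ?_
  filter_upwards [hG.toMemH1.grad_ae_eq isOpen_ball hH.toMemH1] with x hx
  rw [hx]

lemma memLp_inv_norm_smul (hn : 3 ≤ n) {v : E n → ℝ} {G : E n → E n}
    (hG : MemH10 (ball (0 : E n) 1) v G) :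
    MemLp (fun x => ‖x‖⁻¹ * v x) 2 (volume.restrict (ball (0 : E n) 1)) := by
  have hmeas : AEStronglyMeasurable (fun x => ‖x‖⁻¹ * v x) (volume.restrict (ball (0 : E n) 1)) :=
    (measurable_norm.inv.aemeasurable.mul hG.memLp.1.aemeasurable).aestronglyMeasurable
  rw [memLp_two_iff_integrable_sq hmeas]
  refine (hardy_integral hn hG).1.congr (.of_forall fun x => ?_)
  simp only [mul_pow, inv_pow]

/-- The minimum of the Hardy quotients is attained once the finite element space is nontrivial. -/
theorem IsBallMesh.exists_isLeast (hn : 3 ≤ n) {𝒯 : Triangulation n} {h σ τ : ℝ}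
    (hm : IsBallMesh 𝒯 h σ τ) (hh : 0 < h) (hne : ∃ v ∈ 𝒯.feSpace, v ≠ 0) :
    ∃ S, IsLeast 𝒯.hardyQuotients S := by
  classical
  let b := Module.finBasis ℝ 𝒯.feSubmodule
  set k := Module.finrank ℝ 𝒯.feSubmodule
  have hk : 0 < k := by
    obtain ⟨v, hv, hv0⟩ := hne
    have : Nontrivial 𝒯.feSubmodule :=
      ⟨⟨⟨v, hv⟩, 0, fun h => hv0 (congrArg Subtype.val h)⟩⟩
    exact Module.finrank_pos
  have hbG : ∀ i, ∃ G, MemH10 (ball (0 : E n) 1) (b i : E n → ℝ) G := fun i => (b i).2.1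
  choose G hG using hbG
  let w : (Fin k → ℝ) → E n → ℝ := fun c x => ∑ i, c i * (b i : E n → ℝ) x
  let H : (Fin k → ℝ) → E n → E n := fun c x => ∑ i, c i • G i x
  have hH : ∀ c, MemH10 (ball (0 : E n) 1) (w c) (H c) := fun c =>
    MemH10.sum _ fun i _ => (hG i).const_mul (c i)
  have hwb : ∀ c, w c = ((∑ i, c i • b i : 𝒯.feSubmodule) : E n → ℝ) := fun c => by
    funext x
    simp [w, Finset.sum_apply]
  have hwV : ∀ c, w c ∈ 𝒯.feSpace := fun c => by
    rw [hwb]; exact (∑ i, c i • b i : 𝒯.feSubmodule).2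
  have hw0 : ∀ c, c ≠ 0 → w c ≠ 0 := fun c hc h0 => by
    rw [hwb] at h0
    have h1 : (∑ i, c i • b i : 𝒯.feSubmodule) = 0 := Subtype.ext h0
    exact hc (funext (Fintype.linearIndependent_iff.1 b.linearIndependent c h1))
  let N : (Fin k → ℝ) → ℝ := fun c => ∫ x in ball (0 : E n) 1, ‖H c x‖ ^ 2
  let D : (Fin k → ℝ) → ℝ := fun c => ∫ x in ball (0 : E n) 1, (‖x‖ ^ 2)⁻¹ * w c x ^ 2
  have hN : Continuous N := continuous_integral_norm_sq_sum fun i => (hG i).memLp_grad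
  have hD : Continuous D := by
    have := continuous_integral_norm_sq_sum fun i => memLp_inv_norm_smul hn (hG i)
    convert this using 3 with c
    congr 1
    ext x
    rw [Real.norm_eq_abs, sq_abs, ← inv_pow, ← mul_pow]
    simp only [w, Finset.mul_sum, smul_eq_mul]
    congr 1
    exact Finset.sum_congr rfl fun i _ => by ring
  have hNh : ∀ (a : ℝ) c, N (a • c) = a ^ 2 * N c := fun a c => by
    simp only [N]
    rw [← integral_const_mul]
    congr 1
    ext x
    have : H (a • c) x = a • H c x := by
      simp only [H, Finset.smul_sum, Pi.smul_apply, smul_eq_mul, mul_smul]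
    rw [this, norm_smul, mul_pow, Real.norm_eq_abs, sq_abs]
  have hDh : ∀ (a : ℝ) c, D (a • c) = a ^ 2 * D c := fun a c => by
    simp only [D]
    rw [← integral_const_mul]
    congr 1
    ext x
    have : w (a • c) x = a * w c x := by
      simp only [w, Finset.mul_sum, Pi.smul_apply, smul_eq_mul, mul_assoc]
    rw [this]
    ring
  obtain ⟨c, hc, hmin⟩ := exists_min_quotient hk hN hD hNh hDh fun c hc =>
    hm.denominator_pos hn hh (hwV c) (hw0 c hc)
  refine ⟨N c / D c, ⟨w c, H c, hwV c, hw0 c hc, hH c, rfl⟩, ?_⟩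
  rintro q ⟨v, G', hv, hv0, hG', rfl⟩
  set d : Fin k → ℝ := fun i => b.repr ⟨v, hv⟩ i with hd
  have hvd : v = w d := by
    rw [hwb]
    have := b.sum_repr (⟨v, hv⟩ : 𝒯.feSubmodule)
    exact (congrArg Subtype.val this).symm
  have hd0 : d ≠ 0 := fun h => hv0 (by rw [hvd, h]; funext x; simp [w])
  rw [integral_norm_sq_eq_of_memH10 hG' (hvd ▸ hH d), hvd]
  exact hmin d hd0

/-- Near the origin every vertex of a cell lies in the ball of radius `1/2`, so interpolating its
indicator gives the value 1 at 0. -/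
lemma IsBallMesh.exists_ne_zero {𝒯 : Triangulation n} {h σ τ : ℝ} (hm : IsBallMesh 𝒯 h σ τ)
    (hh : h ≤ 1 / 4) (hvol : ENNReal.ofReal (h ^ 2) < volume (ball (0 : E n) (3 / 4))) :
    ∃ v ∈ 𝒯.feSpace, v ≠ 0 := by
  set c : E n → ℝ := indicator (closedBall 0 (1 / 2)) fun _ => 1 with hc
  refine ⟨𝒯.interp c, (hm.interp_mem hh fun p hp => ?_).2, fun h0 => ?_⟩
  · rw [hc, indicator_of_notMem]
    simpa using hp
  · have h0D : (0 : E n) ∈ 𝒯.domain := hm.ball_subset_domain hh hvol (by simp)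
    obtain ⟨s, hs, hxs⟩ := Triangulation.mem_carrier.1 (𝒯.domain_subset_carrier h0D)
    have hS := 𝒯.isSimplex hs
    have h1 : nodal s c = AffineMap.const ℝ (E n) 1 := hS.affine_ext fun p hp => by
      rw [hS.nodal_apply _ hp, hc, indicator_of_mem]
      · rfl
      · have := (dist_le_cellDiam (mem_cell_of_mem hp) hxs).trans (hm.diam_le s hs)
        rw [mem_closedBall]
        linarith
    have h2 := congrFun h0 0
    rw [𝒯.interp_eq_nodal c hs hxs, h1] at h2
    simp at h2

/-- For small mesh size, the volume condition excludes holes. -/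
lemma exists_mesh_size_bound (n : ℕ) : ∃ h₁ : ℝ, 0 < h₁ ∧ ∀ h, 0 < h → h < h₁ →
    h ≤ 1 / 4 ∧ ENNReal.ofReal (h ^ 2) < volume (ball (0 : E n) (3 / 4)) := by
  have hV : 0 < volume.real (ball (0 : E n) (3 / 4)) :=
    ENNReal.toReal_pos (measure_ball_pos _ _ (by norm_num)).ne' measure_ball_lt_top.ne
  refine ⟨min (1 / 4) (volume.real (ball (0 : E n) (3 / 4))), by positivity, fun h h0 h1 => ?_⟩
  have h2 : h < 1 / 4 := h1.trans_le (min_le_left _ _)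
  refine ⟨h2.le, (ENNReal.ofReal_lt_iff_lt_toReal (by positivity) measure_ball_lt_top.ne).2 ?_⟩
  refine lt_trans ?_ (h1.trans_le (min_le_right _ _))
  nlinarith

/-! ### The one-dimensional profile -/

lemma deriv_smoothTransition_of_one_le {t : ℝ} (ht : 1 ≤ t) : deriv Real.smoothTransition t = 0 :=
  IsLocalMax.deriv_eq_zero (.of_forall fun y => by
    rw [Real.smoothTransition.one_of_one_le ht]; exact Real.smoothTransition.le_one y)

lemma deriv_smoothTransition_of_nonpos {t : ℝ} (ht : t ≤ 0) : deriv Real.smoothTransition t = 0 :=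
  IsLocalMin.deriv_eq_zero (.of_forall fun y => by
    rw [Real.smoothTransition.zero_of_nonpos ht]; exact Real.smoothTransition.nonneg y)

lemma exists_bound_deriv_smoothTransition : ∃ A : ℝ, 1 ≤ A ∧
    (∀ t, |deriv Real.smoothTransition t| ≤ A) ∧
    ∀ t, |deriv (deriv Real.smoothTransition) t| ≤ A := by
  have hs : ContDiff ℝ ∞ Real.smoothTransition := Real.smoothTransition.contDiff
  have hs1 : ContDiff ℝ ∞ (deriv Real.smoothTransition) :=
    (contDiff_infty_iff_deriv.1 hs).2
  have hc : HasCompactSupport (deriv Real.smoothTransition) :=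
    HasCompactSupport.intro (isCompact_Icc (a := (0:ℝ)) (b := 1)) fun t ht => by
      rw [mem_Icc, not_and_or, not_le, not_le] at ht
      rcases ht with h | h
      · exact deriv_smoothTransition_of_nonpos h.le
      · exact deriv_smoothTransition_of_one_le h.le
  obtain ⟨A, hA⟩ := hc.exists_bound_of_continuous hs1.continuous
  obtain ⟨B, hB⟩ := hc.deriv.exists_bound_of_continuous (hs1.continuous_deriv (by simp))
  refine ⟨max 1 (max A B), le_max_left _ _, fun t => ?_, fun t => ?_⟩
  · exact (hA t).trans ((le_max_left _ _).trans (le_max_right _ _))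
  · exact (hB t).trans ((le_max_right _ _).trans (le_max_right _ _))

/-- Cut-off sine profiles on `[0, L]`, nearly optimal for the Dirichlet quotient. -/
lemma exists_profile : ∃ K : ℝ, 0 < K ∧ ∀ L : ℝ, 4 ≤ L → ∃ g g' g'' : ℝ → ℝ,
    ContDiff ℝ ∞ g ∧ (∀ t, HasDerivAt g (g' t) t) ∧ (∀ t, HasDerivAt g' (g'' t) t) ∧
    (∀ t ≤ 0, g t = 0) ∧ (∀ t, L ≤ t → g t = 0) ∧
    (∀ t, |g t| ≤ K ∧ |g' t| ≤ K ∧ |g'' t| ≤ K) ∧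
    L / 4 ≤ ∫ t in (0:ℝ)..L, g t ^ 2 ∧
    ∫ t in (0:ℝ)..L, (g' t - g t / 2) ^ 2 ≤
      (1 / 4 + Real.pi ^ 2 / L ^ 2 + K / L ^ 3) * ∫ t in (0:ℝ)..L, g t ^ 2 := by
  obtain ⟨A, hA1, hA, hA2⟩ := exists_bound_deriv_smoothTransition
  have hpi := Real.pi_pos
  -- The first summand absorbs the cut-off energy `2 (A π / L)²` measured against `∫ g² ≥ L/4`; the
  -- second bounds `g` and its two derivatives.
  refine ⟨8 * A ^ 2 * Real.pi ^ 2 + 20 * A ^ 2, by positivity, fun L hL => ?_⟩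
  have hL0 : 0 < L := by linarith
  set χ := Real.smoothTransition
  have hχone : ∀ t, 1 ≤ t → χ t = 1 := fun t => Real.smoothTransition.one_of_one_le
  have hχzero : ∀ t, t ≤ 0 → χ t = 0 := fun t => Real.smoothTransition.zero_of_nonpos
  have hχ'one : ∀ t, 1 ≤ t → deriv χ t = 0 := fun t => deriv_smoothTransition_of_one_le
  have hχ : ContDiff ℝ ∞ χ := Real.smoothTransition.contDiff
  have hχ1 : ContDiff ℝ ∞ (deriv χ) := (contDiff_infty_iff_deriv.1 hχ).2
  have hχ2c : Continuous (deriv (deriv χ)) := hχ1.continuous_deriv (by simp)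
  have hd : ∀ t, HasDerivAt χ (deriv χ t) t := fun t =>
    (hχ.differentiable (by simp) t).hasDerivAt
  have hd1 : ∀ t, HasDerivAt (deriv χ) (deriv (deriv χ) t) t := fun t =>
    (hχ1.differentiable (by simp) t).hasDerivAt
  have hcs : ∀ t : ℝ, HasDerivAt (fun t => L - t) (-1) t := fun t => by
    simpa using (hasDerivAt_id t).const_sub L
  have hdL : ∀ t, HasDerivAt (fun t => χ (L - t)) (-deriv χ (L - t)) t := fun t =>
    ((hd (L - t)).scomp t (hcs t)).congr_deriv (by simp)
  have hd1L : ∀ t, HasDerivAt (fun t => deriv χ (L - t)) (-deriv (deriv χ) (L - t)) t :=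
    fun t => ((hd1 (L - t)).scomp t (hcs t)).congr_deriv (by simp)
  set ω₀ : ℝ := Real.pi / L with hω
  have hω0 : 0 < ω₀ := by positivity
  have hω1 : ω₀ ≤ 1 := by rw [hω, div_le_one hL0]; linarith [Real.pi_le_four]
  set ψ : ℝ → ℝ := fun t => Real.sin (ω₀ * t) with hψ
  set ψ' : ℝ → ℝ := fun t => ω₀ * Real.cos (ω₀ * t) with hψ'
  have hlin : ∀ t : ℝ, HasDerivAt (fun t => ω₀ * t) ω₀ t := fun t => by
    simpa using (hasDerivAt_id t).const_mul ω₀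
  have hψd : ∀ t, HasDerivAt ψ (ψ' t) t := fun t => by
    have := (hlin t).sin
    rwa [mul_comm] at this
  have hψ'd : ∀ t, HasDerivAt ψ' (-ω₀ ^ 2 * ψ t) t := fun t => by
    have := ((hlin t).cos).const_mul ω₀
    refine this.congr_deriv ?_
    simp only [hψ]; ring
  set a : ℝ → ℝ := fun t => χ t * χ (L - t) with ha
  set a' : ℝ → ℝ := fun t => deriv χ t * χ (L - t) - χ t * deriv χ (L - t) with ha'
  set a'' : ℝ → ℝ := fun t => deriv (deriv χ) t * χ (L - t) - 2 * (deriv χ t * deriv χ (L - t)) +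
    χ t * deriv (deriv χ) (L - t) with ha''
  have had : ∀ t, HasDerivAt a (a' t) t := fun t => by
    refine ((hd t).mul (hdL t)).congr_deriv ?_
    simp only [ha']; ring
  have ha'd : ∀ t, HasDerivAt a' (a'' t) t := fun t => by
    refine (((hd1 t).mul (hdL t)).sub ((hd t).mul (hd1L t))).congr_deriv ?_
    simp only [ha'']; ring
  set g : ℝ → ℝ := fun t => a t * ψ t with hg
  set g' : ℝ → ℝ := fun t => a' t * ψ t + a t * ψ' t with hg'
  set g'' : ℝ → ℝ := fun t => a'' t * ψ t + 2 * (a' t * ψ' t) + a t * (-ω₀ ^ 2 * ψ t) with hg''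
  have hgd : ∀ t, HasDerivAt g (g' t) t := fun t => (had t).mul (hψd t)
  have hg'd : ∀ t, HasDerivAt g' (g'' t) t := fun t => by
    refine (((ha'd t).mul (hψd t)).add ((had t).mul (hψ'd t))).congr_deriv ?_
    simp only [hg'']; ring
  have hgs : ContDiff ℝ ∞ g := by
    have h1 : ContDiff ℝ ∞ (fun t => χ (L - t)) := hχ.comp (contDiff_const.sub contDiff_id)
    have h2 : ContDiff ℝ ∞ ψ := Real.contDiff_sin.comp (contDiff_const.mul contDiff_id)
    exact (hχ.mul h1).mul h2
  have hχle : ∀ t, |χ t| ≤ 1 := fun t => by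
    rw [abs_of_nonneg (Real.smoothTransition.nonneg t)]; exact Real.smoothTransition.le_one t
  have hmul : ∀ {x y p q : ℝ}, |x| ≤ p → |y| ≤ q → |x * y| ≤ p * q := fun hx hy => by
    rw [abs_mul]
    exact mul_le_mul hx hy (abs_nonneg _) ((abs_nonneg _).trans hx)
  have hψle : ∀ t, |ψ t| ≤ 1 := fun t => Real.abs_sin_le_one _
  have hψ'le : ∀ t, |ψ' t| ≤ 1 := fun t => by
    have := hmul (show |ω₀| ≤ 1 by rwa [abs_of_pos hω0]) (Real.abs_cos_le_one (ω₀ * t))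
    rwa [mul_one] at this
  have hale : ∀ t, |a t| ≤ 1 := fun t => by
    have := hmul (hχle t) (hχle (L - t))
    rwa [mul_one] at this
  have ha'le : ∀ t, |a' t| ≤ 2 * A := fun t => by
    have h1 := hmul (hA t) (hχle (L - t))
    have h2 := hmul (hχle t) (hA (L - t))
    have := abs_sub (deriv χ t * χ (L - t)) (χ t * deriv χ (L - t))
    simp only [ha']
    linarith
  have ha''le : ∀ t, |a'' t| ≤ 2 * A + 2 * A ^ 2 := fun t => by
    have h1 := hmul (hA2 t) (hχle (L - t))
    have h2 := hmul (hχle t) (hA2 (L - t))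
    have h3 := hmul (hA t) (hA (L - t))
    simp only [ha'']
    rw [abs_le] at *
    constructor <;> nlinarith
  have hpiA : 0 ≤ 8 * A ^ 2 * Real.pi ^ 2 := by positivity
  have hAA : A ≤ A ^ 2 := by nlinarith
  have hbd : ∀ t, |g t| ≤ 8 * A ^ 2 * Real.pi ^ 2 + 20 * A ^ 2 ∧
      |g' t| ≤ 8 * A ^ 2 * Real.pi ^ 2 + 20 * A ^ 2 ∧
      |g'' t| ≤ 8 * A ^ 2 * Real.pi ^ 2 + 20 * A ^ 2 := fun t => by
    have h1 := hmul (hale t) (hψle t)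
    have h2 := hmul (ha'le t) (hψle t)
    have h3 := hmul (hale t) (hψ'le t)
    have h4 := hmul (ha''le t) (hψle t)
    have h5 := hmul (ha'le t) (hψ'le t)
    have h6 : |a t * (-ω₀ ^ 2 * ψ t)| ≤ 1 * (1 * 1) := hmul (hale t) (hmul (by
      rw [abs_neg, abs_of_pos (by positivity)]; nlinarith) (hψle t))
    refine ⟨?_, ?_, ?_⟩
    · simp only [hg]; linarith
    · simp only [hg']
      have := abs_add_le (a' t * ψ t) (a t * ψ' t)
      linarith
    · simp only [hg'']
      have e1 := abs_add_le (a'' t * ψ t + 2 * (a' t * ψ' t)) (a t * (-ω₀ ^ 2 * ψ t))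
      have e2 := abs_add_le (a'' t * ψ t) (2 * (a' t * ψ' t))
      rw [abs_mul 2, abs_two] at e2
      linarith
  have hgc : Continuous g := hgs.continuous
  have hg'c : Continuous g' := continuous_iff_continuousAt.2 fun t => (hg'd t).continuousAt
  have hψc : Continuous ψ := continuous_iff_continuousAt.2 fun t => (hψd t).continuousAt
  have hψ'c : Continuous ψ' := continuous_iff_continuousAt.2 fun t => (hψ'd t).continuousAt
  have hac : Continuous a := continuous_iff_continuousAt.2 fun t => (had t).continuousAt
  have ha'c : Continuous a' := continuous_iff_continuousAt.2 fun t => (ha'd t).continuousAt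
  -- As `L ≥ 4`, the cut-off equals 1 on the middle half of the interval, where the squared sine is
  -- at least `1/2`.
  have hg2 : L / 4 ≤ ∫ t in (0:ℝ)..L, g t ^ 2 := by
    have h1 : ∫ _ in (L/4)..(3*L/4), (1/2 : ℝ) ≤ ∫ t in (L/4)..(3*L/4), g t ^ 2 := by
      refine intervalIntegral.integral_mono_on (by linarith) (by simp)
        ((hgc.pow 2).intervalIntegrable _ _) fun t ht => ?_
      have e1 : a t = 1 := by
        simp only [ha]
        rw [hχone t (by linarith [ht.1]), hχone (L - t) (by linarith [ht.2]), one_mul]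
      simp only [hg, e1, one_mul, hψ]
      rw [Real.sin_sq_eq_half_sub]
      have h4 : Real.cos (2 * (ω₀ * t)) ≤ 0 := by
        have hωL : ω₀ * L = Real.pi := by rw [hω]; field_simp
        refine Real.cos_nonpos_of_pi_div_two_le_of_le ?_ ?_
        · nlinarith [mul_le_mul_of_nonneg_left ht.1 hω0.le]
        · nlinarith [mul_le_mul_of_nonneg_left ht.2 hω0.le]
      linarith
    have h2 : ∫ t in (L/4)..(3*L/4), g t ^ 2 ≤ ∫ t in (0:ℝ)..L, g t ^ 2 :=
      intervalIntegral.integral_mono_interval (by linarith) (by linarith) (by linarith)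
        (.of_forall fun t => by positivity) ((hgc.pow 2).intervalIntegrable _ _)
    rw [intervalIntegral.integral_const] at h1
    simp only [smul_eq_mul] at h1
    linarith
  refine ⟨g, g', g'', hgs, hgd, hg'd, fun t ht => ?_, fun t ht => ?_, hbd, hg2, ?_⟩
  · simp only [hg, ha]
    rw [hχzero t ht]; simp
  · simp only [hg, ha]
    rw [hχzero (L - t) (by linarith)]; simp
  -- The cut-off varies only within distance 1 of the endpoints, where the sine is at most `π/L`.
  -- Its energy is therefore `O(L⁻²)`, one order below the main term `(π²/L²) ∫ g²`.
  have hsinle : ∀ x : ℝ, 0 ≤ x → x ≤ 1 → |Real.sin (ω₀ * x)| ≤ ω₀ := fun x hx0 hx1 => by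
    refine (Real.abs_sin_le_abs).trans ?_
    rw [abs_of_nonneg (by positivity)]
    nlinarith
  have hside : ∀ t, t ∈ Icc 0 L → (t ≤ 1 ∨ L - 1 ≤ t) → ‖a' t ^ 2 * ψ t ^ 2‖ ≤ (A * ω₀) ^ 2 := by
    intro t ht hor
    rw [Real.norm_of_nonneg (by positivity), ← mul_pow, ← sq_abs]
    have : |a' t * ψ t| ≤ A * ω₀ := by
      rcases hor with h | h
      · refine hmul ?_ (hsinle t ht.1 h)
        simp only [ha']
        rw [hχ'one (L - t) (by linarith), mul_zero, sub_zero]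
        exact (hmul (hA t) (hχle (L - t))).trans_eq (mul_one A)
      · refine hmul ?_ ?_
        · simp only [ha']
          rw [hχ'one (t) (by linarith), zero_mul, zero_sub, abs_neg]
          exact (hmul (hχle t) (hA (L - t))).trans_eq (one_mul A)
        · have e : ψ t = Real.sin (ω₀ * (L - t)) := by
            have hωL : ω₀ * L = Real.pi := by rw [hω]; field_simp
            simp only [hψ]
            rw [mul_sub, hωL, Real.sin_pi_sub]
          rw [e]
          exact hsinle _ (by linarith [ht.2]) (by linarith)
    gcongr
  have hI : ∀ x y : ℝ, IntervalIntegrable (fun t => a' t ^ 2 * ψ t ^ 2) volume x y := fun x y =>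
    ((ha'c.pow 2).mul (hψc.pow 2)).intervalIntegrable _ _
  have hrem : ∫ t in (0:ℝ)..L, a' t ^ 2 * ψ t ^ 2 ≤ 2 * (A * ω₀) ^ 2 := by
    rw [← intervalIntegral.integral_add_adjacent_intervals (hI 0 1) (hI 1 L),
      ← intervalIntegral.integral_add_adjacent_intervals (hI 1 (L - 1)) (hI (L - 1) L)]
    have h1 := intervalIntegral.norm_integral_le_of_norm_le_const (a := 0) (b := 1)
      (f := fun t => a' t ^ 2 * ψ t ^ 2) (C := (A * ω₀) ^ 2) fun t ht => by
        rw [uIoc_of_le zero_le_one] at ht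
        exact hside t ⟨ht.1.le, by linarith [ht.2]⟩ (.inl ht.2)
    have h2 := intervalIntegral.norm_integral_le_of_norm_le_const (a := 1) (b := L - 1)
      (f := fun t => a' t ^ 2 * ψ t ^ 2) (C := 0) fun t ht => by
        rw [uIoc_of_le (by linarith)] at ht
        have : a' t = 0 := by
          simp only [ha']
          rw [hχ'one (t) ht.1.le,
            hχ'one (L - t) (by linarith [ht.2])]
          simp
        simp [this]
    have h3 := intervalIntegral.norm_integral_le_of_norm_le_const (a := L - 1) (b := L)
      (f := fun t => a' t ^ 2 * ψ t ^ 2) (C := (A * ω₀) ^ 2) fun t ht => by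
        rw [uIoc_of_le (by linarith)] at ht
        exact hside t ⟨by linarith [ht.1], ht.2⟩ (.inr ht.1.le)
    rw [Real.norm_eq_abs] at h1 h2 h3
    have e1 : |(1:ℝ) - 0| = 1 := by norm_num
    have e3 : |L - (L - 1)| = 1 := by simp
    rw [e1, mul_one] at h1
    rw [e3, mul_one] at h3
    rw [zero_mul] at h2
    linarith [le_abs_self (∫ t in (0:ℝ)..1, a' t ^ 2 * ψ t ^ 2),
      le_abs_self (∫ t in (1:ℝ)..(L - 1), a' t ^ 2 * ψ t ^ 2),
      le_abs_self (∫ t in (L - 1)..L, a' t ^ 2 * ψ t ^ 2)]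
  -- Since `ψ'' = -ω₀² ψ`, the expression `g'² - ω₀² g² - a'² ψ²` is the derivative of `a² ψ ψ'`;
  -- the cross term `-g g'` is that of `-g²/2`. Both primitives vanish at the endpoints.
  have hΦ : ∀ t, HasDerivAt (fun t => a t ^ 2 * (ψ t * ψ' t) - g t ^ 2 / 2)
      ((g' t - g t / 2) ^ 2 - (1 / 4 + ω₀ ^ 2) * g t ^ 2 - a' t ^ 2 * ψ t ^ 2) t := fun t => by
    have := (((had t).pow 2).mul ((hψd t).mul (hψ'd t))).sub (((hgd t).pow 2).div_const 2)
    refine this.congr_deriv ?_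
    simp only [hg, hg', Pi.mul_apply, Pi.pow_apply]
    push_cast
    ring
  have hFTC := intervalIntegral.integral_eq_sub_of_hasDerivAt (a := 0) (b := L)
    (fun t _ => hΦ t) (Continuous.intervalIntegrable (by fun_prop) _ _)
  have ha0 : a 0 = 0 := by
    simp only [ha]
    rw [hχzero 0 le_rfl, zero_mul]
  have haL : a L = 0 := by
    simp only [ha]
    rw [hχzero (L - L) (by simp), mul_zero]
  have i1 : IntervalIntegrable (fun t => (g' t - g t / 2) ^ 2) volume 0 L :=
    Continuous.intervalIntegrable (by fun_prop) _ _
  have i2 : IntervalIntegrable (fun t => (1 / 4 + ω₀ ^ 2) * g t ^ 2) volume 0 L :=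
    Continuous.intervalIntegrable (by fun_prop) _ _
  rw [intervalIntegral.integral_sub (i1.sub i2) (hI 0 L), intervalIntegral.integral_sub i1 i2,
    intervalIntegral.integral_const_mul] at hFTC
  simp only [hg, ha0, haL] at hFTC
  have hfin : 2 * (A * ω₀) ^ 2 ≤ (8 * A ^ 2 * Real.pi ^ 2 + 20 * A ^ 2) / L ^ 3 *
      ∫ t in (0:ℝ)..L, g t ^ 2 := by
    calc 2 * (A * ω₀) ^ 2 = (8 * A ^ 2 * Real.pi ^ 2) / L ^ 3 * (L / 4) := by
          rw [hω]; field_simp; ring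
      _ ≤ _ := by gcongr; nlinarith
  have hω2 : ω₀ ^ 2 = Real.pi ^ 2 / L ^ 2 := by rw [hω, div_pow]
  rw [← hω2, add_mul]
  simp only [hg] at hfin ⊢
  linarith

/-! ### Radial test functions -/

/-- The profile `s ↦ s ^ (-1/4) * g (log s / 2 - l)`, as a function of `s = ‖x‖ ^ 2`. -/
def radialProfile (g : ℝ → ℝ) (l s : ℝ) : ℝ :=
  Real.exp (-(Real.log s / 4)) * g (Real.log s / 2 - l)

/-- The function `d ↦ d ^ (-5/2)`. -/
def decay (d : ℝ) : ℝ := Real.exp (-(Real.log d / 2)) / d ^ 2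

lemma decay_nonneg (d : ℝ) : 0 ≤ decay d := by unfold decay; positivity

lemma decay_sq {d : ℝ} (hd : 0 < d) : decay d ^ 2 = (d ^ 5)⁻¹ := by
  rw [decay, div_pow, ← Real.exp_nat_mul]
  have : ((2:ℕ):ℝ) * -(Real.log d / 2) = -Real.log d := by push_cast; ring
  rw [this, Real.exp_neg, Real.exp_log hd]
  field_simp

lemma decay_anti {d e : ℝ} (hd : 0 < d) (hde : d ≤ e) : decay e ≤ decay d := by
  unfold decay
  have := Real.log_le_log hd hde
  gcongr

lemma exp_log_div_eq_decay {d : ℝ} : Real.exp (-(Real.log (d ^ 2) / 4)) / d ^ 2 = decay d := by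
  rw [decay, Real.log_pow]
  push_cast
  congr 2
  ring

section Radial

variable {g g' g'' : ℝ → ℝ} {l : ℝ}

lemma hasDerivAt_radialProfile (hg : ∀ t, HasDerivAt g (g' t) t) {s : ℝ} (hs : 0 < s) :
    HasDerivAt (radialProfile g l)
      (radialProfile (fun t => g' t / 2 - g t / 4) l s / s) s := by
  have h1 : HasDerivAt (fun s => Real.log s) (s⁻¹) s := Real.hasDerivAt_log hs.ne'
  have h2 := ((h1.div_const 4).fun_neg).exp
  have h3 := (hg (Real.log s / 2 - l)).comp s ((h1.div_const 2).sub_const l)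
  refine (h2.mul h3).congr_deriv ?_
  simp only [radialProfile, Function.comp_apply]
  ring

lemma abs_radialProfile_le {K : ℝ} (hK : ∀ t, |g t| ≤ K) (s : ℝ) :
    |radialProfile g l s| ≤ K * Real.exp (-(Real.log s / 4)) := by
  rw [radialProfile, abs_mul, abs_of_pos (Real.exp_pos _), mul_comm]
  exact mul_le_mul_of_nonneg_right (hK _) (Real.exp_pos _).le

lemma hasFDerivAt_radial (hg : ∀ t, HasDerivAt g (g' t) t) {x : E n} (hx : x ≠ 0) :
    HasFDerivAt (fun x : E n => radialProfile g l (‖x‖ ^ 2))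
      ((radialProfile (fun t => g' t / 2 - g t / 4) l (‖x‖ ^ 2) / ‖x‖ ^ 2) • 2 • innerSL ℝ x) x :=
  (hasDerivAt_radialProfile hg (by positivity)).comp_hasFDerivAt x
    (hasStrictFDerivAt_norm_sq x).hasFDerivAt

/-- Second order Taylor estimate for the radial function along a segment avoiding a ball. -/
lemma radial_taylor {K : ℝ} (hg : ∀ t, HasDerivAt g (g' t) t) (hg' : ∀ t, HasDerivAt g' (g'' t) t)
    (hK : ∀ t, |g t| ≤ K ∧ |g' t| ≤ K ∧ |g'' t| ≤ K) {x y : E n} {d : ℝ} (hd : 0 < d)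
    (hseg : ∀ t ∈ Icc (0:ℝ) 1, d ≤ ‖x + t • (y - x)‖) :
    |radialProfile g l (‖y‖ ^ 2) - radialProfile g l (‖x‖ ^ 2) -
      fderiv ℝ (fun x : E n => radialProfile g l (‖x‖ ^ 2)) x (y - x)| ≤
      9 * K * decay d * ‖y - x‖ ^ 2 := by
  set e := y - x with he
  have hK0 : 0 ≤ K := (abs_nonneg _).trans (hK 0).1
  set g₁ : ℝ → ℝ := fun t => g' t / 2 - g t / 4 with hg₁
  set g₁' : ℝ → ℝ := fun t => g'' t / 2 - g' t / 4 with hg₁'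
  have hg₁d : ∀ t, HasDerivAt g₁ (g₁' t) t := fun t =>
    ((hg' t).div_const 2).sub ((hg t).div_const 4)
  set g₂ : ℝ → ℝ := fun t => g₁' t / 2 - g₁ t / 4 with hg₂
  set s : ℝ → ℝ := fun t => ‖x + t • e‖ ^ 2 with hs
  have hsd : ∀ t, HasDerivAt s (2 * inner ℝ (x + t • e) e) t := fun t => by
    have h1 : HasDerivAt (fun t : ℝ => x + t • e) e t := by
      simpa using ((hasDerivAt_id t).smul_const e).const_add x
    exact h1.norm_sq
  have hid : ∀ t, HasDerivAt (fun t : ℝ => inner ℝ (x + t • e) e) (‖e‖ ^ 2) t := fun t => by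
    have h1 : HasDerivAt (fun t : ℝ => x + t • e) e t := by
      simpa using ((hasDerivAt_id t).smul_const e).const_add x
    have := h1.inner ℝ (hasDerivAt_const t e)
    simpa using this
  have hspos : ∀ t ∈ Icc (0:ℝ) 1, 0 < s t := fun t ht => by
    have := hseg t ht
    have : 0 < ‖x + t • e‖ := hd.trans_le this
    simp only [hs]; positivity
  set k : ℝ → ℝ := fun t => radialProfile g l (s t) with hk
  set k₁ : ℝ → ℝ := fun t => radialProfile g₁ l (s t) / s t * (2 * inner ℝ (x + t • e) e) with hk₁
  set k₂ : ℝ → ℝ := fun t =>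
    (radialProfile g₂ l (s t) / s t * (2 * inner ℝ (x + t • e) e) * s t -
      radialProfile g₁ l (s t) * (2 * inner ℝ (x + t • e) e)) / s t ^ 2 *
        (2 * inner ℝ (x + t • e) e) + radialProfile g₁ l (s t) / s t * (2 * ‖e‖ ^ 2) with hk₂
  have hkd : ∀ t ∈ Icc (0:ℝ) 1, HasDerivAt k (k₁ t) t := fun t ht =>
    (hasDerivAt_radialProfile hg (hspos t ht)).comp t (hsd t)
  have hk₁d : ∀ t ∈ Icc (0:ℝ) 1, HasDerivAt k₁ (k₂ t) t := fun t ht => by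
    have h1 := (hasDerivAt_radialProfile hg₁d (hspos t ht) (l := l)).comp t (hsd t)
    exact (h1.div (hsd t) (hspos t ht).ne').mul ((hid t).const_mul 2)
  have hb1 : ∀ t, |g₁ t| ≤ K := fun t => by
    obtain ⟨a, b, c⟩ := hK t
    simp only [hg₁]
    rw [abs_le] at *
    constructor <;> linarith
  have hb1' : ∀ t, |g₁' t| ≤ K := fun t => by
    obtain ⟨a, b, c⟩ := hK t
    simp only [hg₁']
    rw [abs_le] at *
    constructor <;> linarith
  have hb2 : ∀ t, |g₂ t| ≤ 3 / 4 * K := fun t => by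
    have a := hb1 t
    have b := hb1' t
    simp only [hg₂]
    rw [abs_le] at *
    constructor <;> linarith
  -- The second derivative along the segment is of size `|z|^(-1/2) / |z|² = |z|^(-5/2)`. The
  -- constant is `9 = 4 · 7/4 + 2`, from the two terms of `hform`.
  have hk₂b : ∀ t ∈ Icc (0:ℝ) 1, ‖k₂ t‖ ≤ 9 * K * decay d * ‖e‖ ^ 2 := by
    intro t ht
    have hst := hspos t ht
    have hin : |inner ℝ (x + t • e) e| ≤ ‖x + t • e‖ * ‖e‖ := abs_real_inner_le_norm _ _
    set c := inner ℝ (x + t • e) e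
    have hc2 : c ^ 2 ≤ s t * ‖e‖ ^ 2 := by
      rw [← sq_abs, ← mul_pow]
      gcongr
    set X := Real.exp (-(Real.log (s t) / 4)) with hX
    have hX0 : 0 < X := Real.exp_pos _
    have p1 : |radialProfile g₁ l (s t)| ≤ K * X := abs_radialProfile_le hb1 _
    have p2 : |radialProfile g₂ l (s t)| ≤ 3 / 4 * K * X := abs_radialProfile_le hb2 _
    have hXd : X / s t ≤ decay d := by
      have h1 : X / s t = decay ‖x + t • e‖ := exp_log_div_eq_decay
      rw [h1]
      exact decay_anti hd (hseg t ht)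
    have hform : k₂ t = (radialProfile g₂ l (s t) - radialProfile g₁ l (s t)) *
        (4 * c ^ 2 / s t) / s t + radialProfile g₁ l (s t) / s t * (2 * ‖e‖ ^ 2) := by
      simp only [hk₂]
      field_simp
      ring
    have hq : 0 ≤ 4 * c ^ 2 / s t ∧ 4 * c ^ 2 / s t ≤ 4 * ‖e‖ ^ 2 := by
      refine ⟨by positivity, ?_⟩
      rw [div_le_iff₀ hst]
      linarith
    have t1 : |(radialProfile g₂ l (s t) - radialProfile g₁ l (s t)) *
        (4 * c ^ 2 / s t) / s t| ≤ (7 / 4 * K * X) * (4 * ‖e‖ ^ 2) / s t := by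
      rw [abs_div, abs_mul, abs_of_pos hst, abs_of_nonneg hq.1]
      have : |radialProfile g₂ l (s t) - radialProfile g₁ l (s t)| ≤ 7 / 4 * K * X := by
        rw [abs_le] at *
        constructor <;> linarith
      gcongr
      exact hq.2
    have t2 : |radialProfile g₁ l (s t) / s t * (2 * ‖e‖ ^ 2)| ≤ K * X / s t * (2 * ‖e‖ ^ 2) := by
      rw [abs_mul, abs_div, abs_of_pos hst, abs_of_nonneg (by positivity : 0 ≤ 2 * ‖e‖ ^ 2)]
      gcongr
    rw [Real.norm_eq_abs, hform]
    calc _ ≤ _ := abs_add_le _ _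
      _ ≤ (7 / 4 * K * X) * (4 * ‖e‖ ^ 2) / s t + K * X / s t * (2 * ‖e‖ ^ 2) := add_le_add t1 t2
      _ = 9 * K * (X / s t) * ‖e‖ ^ 2 := by ring
      _ ≤ _ := by gcongr
  set M := 9 * K * decay d * ‖e‖ ^ 2 with hM
  have hM0 : 0 ≤ M := by have := decay_nonneg d; positivity
  have hk₁b : ∀ t ∈ Icc (0:ℝ) 1, ‖k₁ t - k₁ 0‖ ≤ M := by
    intro t ht
    have := (convex_Icc (0:ℝ) 1).norm_image_sub_le_of_norm_hasDerivWithin_le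
      (fun t ht => (hk₁d t ht).hasDerivWithinAt) hk₂b (left_mem_Icc.2 zero_le_one) ht
    refine this.trans ?_
    rw [sub_zero, Real.norm_of_nonneg ht.1]
    exact mul_le_of_le_one_right hM0 ht.2
  have hfin := (convex_Icc (0:ℝ) 1).norm_image_sub_le_of_norm_hasDerivWithin_le
    (f := fun t => k t - t * k₁ 0) (f' := fun t => k₁ t - k₁ 0) (C := M)
    (fun t ht => by
      have := (hkd t ht).sub ((hasDerivAt_id t).mul_const (k₁ 0))
      exact (this.congr_deriv (by rw [one_mul])).hasDerivWithinAt) hk₁b (left_mem_Icc.2 zero_le_one)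
    (right_mem_Icc.2 zero_le_one)
  have hx0 : x ≠ 0 := by
    have := hseg 0 (left_mem_Icc.2 zero_le_one)
    simp only [zero_smul, add_zero] at this
    exact norm_pos_iff.1 (hd.trans_le this)
  rw [(hasFDerivAt_radial hg hx0).fderiv]
  have e1 : k 1 = radialProfile g l (‖y‖ ^ 2) := by simp [hk, hs, he]
  have e0 : k 0 = radialProfile g l (‖x‖ ^ 2) := by simp [hk, hs]
  have e2 : k₁ 0 = ((radialProfile g₁ l (‖x‖ ^ 2) / ‖x‖ ^ 2) • 2 • innerSL ℝ x) e := by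
    simp [hk₁, hs]
  rw [← e1, ← e0, ← e2]
  rw [sub_zero, norm_one, mul_one, Real.norm_eq_abs] at hfin
  convert hfin using 2
  ring

end Radial

/-- The substitution `t = log y - log r`, for which `dt = y⁻¹ dy`. -/
lemma integral_Ioi_inv_mul_comp_log {q : ℝ → ℝ} (hq : Continuous q) {r L : ℝ} (hr : 0 < r)
    (hL : 0 ≤ L) (h0 : ∀ t < 0, q t = 0) (h1 : ∀ t, L < t → q t = 0) :
    ∫ y in Ioi (0:ℝ), y⁻¹ * q (Real.log y - Real.log r) = ∫ t in (0:ℝ)..L, q t := by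
  have hle : r ≤ r * Real.exp L := le_mul_of_one_le_right hr.le (Real.one_le_exp hL)
  have hsub : Icc r (r * Real.exp L) ⊆ Ioi (0:ℝ) := fun y hy => hr.trans_le hy.1
  rw [setIntegral_eq_of_subset_of_forall_sdiff_eq_zero measurableSet_Ioi hsub,
    integral_Icc_eq_integral_Ioc, ← intervalIntegral.integral_of_le hle]
  · have hd : ∀ y ∈ uIcc r (r * Real.exp L),
        HasDerivAt (fun y => Real.log y - Real.log r) (y⁻¹) y := fun y hy => by
      rw [uIcc_of_le hle] at hy
      exact (Real.hasDerivAt_log (hsub hy).ne').sub_const _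
    have hc : ContinuousOn (fun y : ℝ => y⁻¹) (uIcc r (r * Real.exp L)) := fun y hy => by
      rw [uIcc_of_le hle] at hy
      exact (continuousAt_inv₀ (hsub hy).ne').continuousWithinAt
    have := intervalIntegral.integral_comp_mul_deriv hd hc hq
    rw [sub_self, Real.log_mul hr.ne' (Real.exp_pos L).ne', Real.log_exp,
      add_sub_cancel_left] at this
    rw [← this]
    refine intervalIntegral.integral_congr fun y _ => ?_
    simp only [Function.comp_apply, mul_comm]
  · rintro y ⟨hy0, hy⟩
    have hy0' : 0 < y := hy0
    rw [mem_Icc, not_and_or, not_le, not_le] at hy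
    rcases hy with h | h
    · rw [h0 _ (sub_neg.2 (Real.log_lt_log hy0' h)), mul_zero]
    · have := Real.log_lt_log (by positivity) h
      rw [Real.log_mul hr.ne' (Real.exp_pos L).ne', Real.log_exp] at this
      rw [h1 _ (by linarith), mul_zero]

lemma exp_neg_log_div {y : ℝ} (hy : 0 < y) : Real.exp (-(Real.log (y ^ 2) / 4)) ^ 2 = y⁻¹ := by
  rw [← Real.exp_nat_mul, Real.log_pow]
  have : ((2:ℕ):ℝ) * -(((2:ℕ):ℝ) * Real.log y / 4) = -Real.log y := by push_cast; ring
  rw [this, Real.exp_neg, Real.exp_log hy]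

lemma radialProfile_sq {g : ℝ → ℝ} {l y : ℝ} (hy : 0 < y) :
    radialProfile g l (y ^ 2) ^ 2 = y⁻¹ * g (Real.log y - l) ^ 2 := by
  rw [radialProfile, mul_pow, exp_neg_log_div hy, Real.log_pow]
  congr 3
  push_cast
  ring

/-- Smooth radial test functions on the three-dimensional ball, nearly optimal for the Hardy
quotient, with a quantitative second order Taylor estimate. -/
lemma exists_radial_test : ∃ K : ℝ, 0 < K ∧ ∀ r L : ℝ, 0 < r → 4 ≤ L → r * Real.exp L ≤ 1 / 2 →
    ∃ u : E 3 → ℝ, IsTest (ball (0 : E 3) 1) u ∧ (∀ x, 1 / 2 ≤ ‖x‖ → u x = 0) ∧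
      (∀ h, h ≤ r / 4 → ∀ x y : E 3, ‖y - x‖ ≤ h →
        |u y - u x - fderiv ℝ u x (y - x)| ≤
          {z : E 3 | r / 2 ≤ ‖z‖}.indicator (fun z => K * decay (‖z‖ / 2)) x * h ^ 2) ∧
      volume.real (ball (0 : E 3) 1) ≤ ∫ x in ball (0 : E 3) 1, (‖x‖ ^ 2)⁻¹ * u x ^ 2 ∧
      ∫ x in ball (0 : E 3) 1, ‖gradient u x‖ ^ 2 ≤
        (1 / 4 + Real.pi ^ 2 / L ^ 2 + K / L ^ 3) *
          ∫ x in ball (0 : E 3) 1, (‖x‖ ^ 2)⁻¹ * u x ^ 2 := by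
  obtain ⟨K, hK0, hprof⟩ := exists_profile
  refine ⟨9 * K, by positivity, fun r L hr hL hrL => ?_⟩
  obtain ⟨g, g', g'', hgs, hgd, hg'd, hg0, hgL, hbd, hI1, hI2⟩ := hprof L hL
  have hL0 : 0 < L := by linarith
  have hlog : Real.log r + L < 0 := by
    have h1 : Real.log (r * Real.exp L) < 0 :=
      Real.log_neg (by positivity) (by linarith)
    rwa [Real.log_mul hr.ne' (Real.exp_pos L).ne', Real.log_exp] at h1
  set l := Real.log r with hl
  set u : E 3 → ℝ := fun x => radialProfile g l (‖x‖ ^ 2) with hu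
  have hlogsq : ∀ x : E 3, Real.log (‖x‖ ^ 2) / 2 = Real.log ‖x‖ := fun x => by
    rw [Real.log_pow]; push_cast; ring
  have hin : ∀ x : E 3, ‖x‖ ≤ r → u x = 0 := by
    intro x hx
    simp only [hu, radialProfile]
    rw [hlogsq]
    -- The convention `log 0 = 0` evaluates `g` at `-log r`, which exceeds `L`, so `u` vanishes at
    -- the origin too.
    by_cases hx0 : x = 0
    · rw [hx0, norm_zero, Real.log_zero, hgL _ (by linarith), mul_zero]
    · have := Real.log_le_log (norm_pos_iff.2 hx0) hx
      rw [hg0 _ (by linarith), mul_zero]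
  have hout : ∀ x : E 3, r * Real.exp L ≤ ‖x‖ → u x = 0 := by
    intro x hx
    simp only [hu, radialProfile]
    have := Real.log_le_log (by positivity) hx
    rw [Real.log_mul hr.ne' (Real.exp_pos L).ne', Real.log_exp] at this
    rw [hlogsq, hgL _ (by linarith), mul_zero]
  have hout2 : ∀ x : E 3, 1 / 2 ≤ ‖x‖ → u x = 0 := fun x hx => hout x (hrL.trans hx)
  have hnear : ∀ x : E 3, ‖x‖ < r → u =ᶠ[𝓝 x] fun _ => 0 := fun x hx => by
    filter_upwards [continuous_norm.continuousAt.eventually_lt_const hx] with y hy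
    exact hin y hy.le
  have hsm : ContDiff ℝ ∞ u := by
    refine contDiff_iff_contDiffAt.2 fun x => ?_
    by_cases hx0 : x = 0
    · exact contDiffAt_const.congr_of_eventuallyEq (hnear x (by rw [hx0, norm_zero]; exact hr))
    · have h1 : ContDiffAt ℝ ∞ (fun x : E 3 => Real.log (‖x‖ ^ 2)) x :=
        (contDiff_norm_sq ℝ).contDiffAt.log (by positivity)
      exact ((h1.div_const 4).neg.exp).mul
        (hgs.contDiffAt.comp x ((h1.div_const 2).sub contDiffAt_const))
  have hsupp : tsupport u ⊆ closedBall 0 (1 / 2) := by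
    refine closure_minimal (fun x hx => ?_) isClosed_closedBall
    by_contra h
    rw [mem_closedBall_zero_iff, not_le] at h
    exact hx (hout2 x h.le)
  have htest : IsTest (ball (0 : E 3) 1) u :=
    ⟨hsm, HasCompactSupport.of_support_subset_isCompact (isCompact_closedBall 0 (1 / 2))
      ((subset_tsupport _).trans hsupp), hsupp.trans (closedBall_subset_ball (by norm_num))⟩
  have hgrad : ∀ x : E 3, ‖gradient u x‖ ^ 2 =
      4 * (radialProfile (fun t => g' t / 2 - g t / 4) l (‖x‖ ^ 2) / ‖x‖ ^ 2) ^ 2 * ‖x‖ ^ 2 := by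
    intro x
    by_cases hx0 : x = 0
    · have := (hnear x (by rw [hx0, norm_zero]; exact hr)).gradient_eq
      rw [this, gradient_fun_const, hx0]
      simp
    · have h1 : HasGradientAt u
          ((2 * (radialProfile (fun t => g' t / 2 - g t / 4) l (‖x‖ ^ 2) / ‖x‖ ^ 2)) • x) x := by
        rw [hasGradientAt_iff_hasFDerivAt]
        refine (hasFDerivAt_radial (l := l) hgd hx0).congr_fderiv ?_
        ext y
        simp
        ring
      rw [h1.gradient, norm_smul, mul_pow, Real.norm_eq_abs, sq_abs]
      ring
  have : Nontrivial (E 3) := inferInstance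
  -- The Jacobian `|x|²` cancels the Hardy weight, and `u² = |x|⁻¹ g²` leaves precisely the
  -- logarithmic measure.
  have hD : ∫ x in ball (0 : E 3) 1, (‖x‖ ^ 2)⁻¹ * u x ^ 2 =
      3 * volume.real (ball (0 : E 3) 1) * ∫ t in (0:ℝ)..L, g t ^ 2 := by
    rw [setIntegral_eq_integral_of_forall_compl_eq_zero fun x hx => by
      rw [hout2 x (by rw [mem_ball_zero_iff, not_lt] at hx; linarith)]; simp]
    have := integral_fun_norm_addHaar (volume : Measure (E 3))
      (fun y => (y ^ 2)⁻¹ * radialProfile g l (y ^ 2) ^ 2)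
    rw [this, finrank_euclideanSpace_fin, nsmul_eq_mul, smul_eq_mul,
      ← integral_Ioi_inv_mul_comp_log (q := fun t => g t ^ 2) (hgs.continuous.pow 2) hr hL0.le
        (fun t ht => by rw [hg0 t ht.le]; simp) (fun t ht => by rw [hgL t ht.le]; simp),
      ← mul_assoc]
    congr 1
    refine setIntegral_congr_fun measurableSet_Ioi fun y hy => ?_
    have hy' : 0 < y := hy
    simp only [smul_eq_mul]
    rw [radialProfile_sq hy', ← hl]
    field_simp
  have hg'c : Continuous g' := continuous_iff_continuousAt.2 fun t => (hg'd t).continuousAt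
  have hg'0 : ∀ t, (t < 0 ∨ L < t) → g' t = 0 := by
    intro t ht
    have hev : g =ᶠ[𝓝 t] fun _ => 0 := by
      rcases ht with h | h
      · filter_upwards [Iio_mem_nhds h] with y hy using hg0 y (le_of_lt hy)
      · filter_upwards [Ioi_mem_nhds h] with y hy using hgL y (le_of_lt hy)
    rw [← (hgd t).deriv, hev.deriv_eq, deriv_const]
  have hN : ∫ x in ball (0 : E 3) 1, ‖gradient u x‖ ^ 2 =
      3 * volume.real (ball (0 : E 3) 1) * ∫ t in (0:ℝ)..L, (g' t - g t / 2) ^ 2 := by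
    rw [setIntegral_eq_integral_of_forall_compl_eq_zero fun x hx => by
      rw [gradient_eq_zero_of_notMem_tsupport fun h => hx (htest.2.2 h)]; simp]
    simp only [hgrad]
    have := integral_fun_norm_addHaar (volume : Measure (E 3))
      (fun y => 4 * (radialProfile (fun t => g' t / 2 - g t / 4) l (y ^ 2) / y ^ 2) ^ 2 * y ^ 2)
    rw [this, finrank_euclideanSpace_fin, nsmul_eq_mul, smul_eq_mul,
      ← integral_Ioi_inv_mul_comp_log (q := fun t => (g' t - g t / 2) ^ 2)
        ((hg'c.sub (hgs.continuous.div_const 2)).pow 2) hr hL0.le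
        (fun t ht => by rw [hg0 t ht.le, hg'0 t (.inl ht)]; simp)
        (fun t ht => by rw [hgL t ht.le, hg'0 t (.inr ht)]; simp), ← mul_assoc]
    congr 1
    refine setIntegral_congr_fun measurableSet_Ioi fun y hy => ?_
    have hy' : 0 < y := hy
    simp only [smul_eq_mul]
    rw [div_pow, radialProfile_sq hy', ← hl]
    field_simp
    ring
  have hω := volume_real_ball_pos 3
  refine ⟨u, htest, hout2, ?_, ?_, ?_⟩
  · intro h hh x y hxy
    -- Because `h ≤ r/4`, a segment starting at such an `x` stays at distance at least `|x|/2` from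
    -- the origin. In the other case both endpoints lie in the ball of radius `r`, where `u` is
    -- zero.
    by_cases hx : r / 2 ≤ ‖x‖
    · rw [indicator_of_mem (by exact hx)]
      have hx0 : 0 < ‖x‖ := by linarith
      have := radial_taylor (l := l) hgd hg'd hbd (x := x) (y := y) (d := ‖x‖ / 2) (by positivity)
        (fun t ht => by
          have h1 : ‖t • (y - x)‖ ≤ h := by
            rw [norm_smul, Real.norm_of_nonneg ht.1]
            exact (mul_le_of_le_one_left (norm_nonneg _) ht.2).trans hxy
          have h2 := norm_sub_norm_le x (-(t • (y - x)))
          rw [norm_neg, sub_neg_eq_add] at h2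
          linarith)
      refine this.trans ?_
      have := decay_nonneg (‖x‖ / 2)
      gcongr
    · rw [indicator_of_notMem (by exact hx), zero_mul]
      rw [not_le] at hx
      have hy : ‖y‖ ≤ r := by
        have := norm_sub_norm_le y x
        linarith
      have hfd : fderiv ℝ u x = 0 := by
        rw [(hnear x (by linarith)).fderiv_eq]; simp
      rw [hin x (by linarith), hin y hy, hfd]
      simp
  · rw [hD]
    nlinarith
  · rw [hD, hN]
    have h3 : Real.pi ^ 2 / L ^ 2 + K / L ^ 3 ≤ Real.pi ^ 2 / L ^ 2 + 9 * K / L ^ 3 := by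
      gcongr
      linarith
    have hJ : 0 ≤ ∫ t in (0:ℝ)..L, g t ^ 2 := by linarith
    calc _ ≤ 3 * volume.real (ball (0 : E 3) 1) *
          ((1 / 4 + Real.pi ^ 2 / L ^ 2 + K / L ^ 3) * ∫ t in (0:ℝ)..L, g t ^ 2) := by gcongr
      _ = (1 / 4 + (Real.pi ^ 2 / L ^ 2 + K / L ^ 3)) *
          (3 * volume.real (ball (0 : E 3) 1) * ∫ t in (0:ℝ)..L, g t ^ 2) := by ring
      _ ≤ (1 / 4 + (Real.pi ^ 2 / L ^ 2 + 9 * K / L ^ 3)) *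
          (3 * volume.real (ball (0 : E 3) 1) * ∫ t in (0:ℝ)..L, g t ^ 2) := by gcongr
      _ = _ := by ring

/-! ### Nodal interpolation error -/

/-- The affine function minus the first order Taylor polynomial of `u` at `x` is bounded by `b` at
the vertices, hence by convexity on the cell. Comparing antipodal points of an inscribed ball of
radius `ρ` bounds its gradient by `b/ρ`. -/
lemma norm_gradient_affine_sub_le {s : Finset (E n)} {f : E n →ᵃ[ℝ] ℝ} {c x : E n} {ρ b : ℝ}
    (hρ : 0 < ρ) (hball : closedBall c ρ ⊆ cell s) {u : E n → ℝ}
    (hb : ∀ p ∈ s, |f p - u x - fderiv ℝ u x (p - x)| ≤ b) :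
    ‖gradient f x - gradient u x‖ ≤ b / ρ := by
  set A : E n →L[ℝ] ℝ := f.linear.toContinuousLinearMap with hA
  set B : E n →L[ℝ] ℝ := fderiv ℝ u x with hB
  have hfA : ∀ y z, f y - f z = A (y - z) := fun y z => by
    exact (f.linearMap_vsub y z).symm
  have hder : HasFDerivAt f A x := by
    have : (f : E n → ℝ) = fun y => f x + A (y - x) := by
      funext y; rw [← hfA]; ring
    rw [this]
    simpa using (A.hasFDerivAt.comp x ((hasFDerivAt_id x).sub_const x)).const_add (f x)
  have hcell : ∀ y ∈ cell s, |f y - u x - B (y - x)| ≤ b := by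
    have hconv : Convex ℝ {y : E n | |f y - u x - B (y - x)| ≤ b} := by
      have : {y : E n | |f y - u x - B (y - x)| ≤ b} =
          (f - (AffineMap.const ℝ (E n) (u x - B x)) - B.toLinearMap.toAffineMap) ⁻¹'
            (Icc (-b) b) := by
        ext y
        simp only [mem_ofPred_eq, mem_preimage, mem_Icc, ← abs_le]
        simp only [map_sub, AffineMap.coe_sub, Pi.sub_apply, AffineMap.const_apply,
          LinearMap.coe_toAffineMap, ContinuousLinearMap.coe_coe]
        ring_nf
      rw [this]
      exact (convex_Icc _ _).affine_preimage _
    exact fun y hy => convexHull_min (fun p hp => hb p hp) hconv hy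
  have hb0 : 0 ≤ b := (abs_nonneg _).trans (hcell c (hball (mem_closedBall_self hρ.le)))
  have hAB : ‖A - B‖ ≤ b / ρ := by
    refine ContinuousLinearMap.opNorm_le_of_unit_norm (by positivity) fun w hw => ?_
    have hm : ∀ e : ℝ, |e| = 1 → c + (e * ρ) • w ∈ closedBall c ρ := fun e he => by
      rw [mem_closedBall_iff_norm, add_sub_cancel_left, norm_smul, hw, mul_one, norm_mul,
        Real.norm_eq_abs, he, one_mul, Real.norm_of_nonneg hρ.le]
    have h1 := hcell _ (hball (hm 1 (by simp)))
    have h2 := hcell _ (hball (hm (-1) (by simp)))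
    have e1 : f (c + (1 * ρ) • w) - f (c + (-1 * ρ) • w) = 2 * ρ * A w := by
      rw [hfA, add_sub_add_left_eq_sub, ← sub_smul, map_smul, smul_eq_mul]; ring
    have e2 : B (c + (1 * ρ) • w - x) - B (c + (-1 * ρ) • w - x) = 2 * ρ * B w := by
      rw [← map_sub, sub_sub_sub_cancel_right, add_sub_add_left_eq_sub, ← sub_smul, map_smul,
        smul_eq_mul]; ring
    rw [abs_le] at h1 h2
    rw [_root_.sub_apply, Real.norm_eq_abs, le_div_iff₀ hρ, ← abs_of_pos hρ,
      ← abs_mul, abs_le]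
    constructor <;> linarith [h1.1, h1.2, h2.1, h2.2]
  rw [gradient, gradient, hder.fderiv, ← map_sub, LinearIsometryEquiv.norm_map]
  exact hAB

/-- The gradient of the nodal interpolation error, given a second order Taylor estimate. -/
lemma IsBallMesh.norm_gradient_interp_sub_le (hn : 0 < n) {𝒯 : Triangulation n} {h σ τ : ℝ}
    (hm : IsBallMesh 𝒯 h σ τ) (hh : 0 < h) (hball : ball (0 : E n) (3 / 4) ⊆ 𝒯.domain)
    {u M : E n → ℝ} (hu : ∀ x, 1 / 2 ≤ ‖x‖ → u x = 0)
    (hM : ∀ x y, ‖y - x‖ ≤ h → |u y - u x - fderiv ℝ u x (y - x)| ≤ M x * h ^ 2) :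
    ∀ᵐ x : E n, ‖gradient (𝒯.interp u) x - gradient u x‖ ≤ 2 * |σ * τ| * (M x * h) := by
  -- Off the null set of cell boundaries, the interpolant coincides near `x` with a single affine
  -- function or with zero.
  have hfr : ∀ᵐ x : E n, ∀ s ∈ 𝒯.cells, x ∉ frontier (cell s) := by
    refine (ae_ball_iff 𝒯.cells.countable_toSet).2 fun s _ => ?_
    exact measure_eq_zero_iff_ae_notMem.1 ((convex_cell s).addHaar_frontier volume)
  filter_upwards [hfr] with x hx
  have hMx : 0 ≤ M x := by
    have h1 := (abs_nonneg _).trans (hM x x (by simpa using hh.le))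
    by_contra hneg
    have : M x * h ^ 2 < 0 := mul_neg_of_neg_of_pos (not_le.1 hneg) (by positivity)
    linarith
  by_cases hxc : x ∈ 𝒯.carrier
  · obtain ⟨s, hs, hxs⟩ := Triangulation.mem_carrier.1 hxc
    have hint : x ∈ interior (cell s) := by
      by_contra hni
      exact hx s hs ⟨subset_closure hxs, hni⟩
    have hev : 𝒯.interp u =ᶠ[𝓝 x] nodal s u := by
      filter_upwards [isOpen_interior.mem_nhds hint] with y hy
      exact 𝒯.interp_eq_nodal u hs (interior_subset hy)
    obtain ⟨c, ρ, hρ, hcb, hle⟩ := hm.exists_closedBall_subset hn hh hs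
    rw [hev.gradient_eq]
    refine (norm_gradient_affine_sub_le (b := M x * h ^ 2) hρ hcb fun p hp => ?_).trans ?_
    · rw [(𝒯.isSimplex hs).nodal_apply u hp]
      refine hM x p ?_
      rw [← dist_eq_norm]
      exact (dist_le_cellDiam (mem_cell_of_mem hp) hxs).trans (hm.diam_le s hs)
    · rw [div_le_iff₀ hρ]
      have h1 : h ≤ 2 * |σ * τ| * ρ := hle.trans (by gcongr; exact le_abs_self _)
      calc M x * h ^ 2 = M x * h * h := by ring
        _ ≤ M x * h * (2 * |σ * τ| * ρ) := by gcongr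
        _ = _ := by ring
  · have hev : 𝒯.interp u =ᶠ[𝓝 x] fun _ => 0 := by
      filter_upwards [𝒯.isClosed_carrier.isOpen_compl.mem_nhds hxc] with y hy
      exact 𝒯.interp_eq_zero_of_notMem_carrier u hy
    have hxn : 1 / 2 < ‖x‖ := by
      by_contra hle
      refine hxc (𝒯.domain_subset_carrier (hball ?_))
      rw [mem_ball_zero_iff]
      linarith
    have hev2 : u =ᶠ[𝓝 x] fun _ => 0 := by
      filter_upwards [continuous_norm.continuousAt.eventually_const_lt hxn] with y hy
      exact hu y hy.le
    rw [hev.gradient_eq, hev2.gradient_eq, sub_self, norm_zero]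
    positivity

/-- The integrand is `32 |z|⁻⁵`, so its radial density is `32 y⁻³`, integrating to `16 d⁻²`. This is
the source of the order `(h/r)²` of the interpolation energy. -/
lemma integral_indicator_decay_sq {d : ℝ} (hd : 0 < d) :
    Integrable ({z : E 3 | d ≤ ‖z‖}.indicator fun z => decay (‖z‖ / 2) ^ 2) ∧
    ∫ z, {z : E 3 | d ≤ ‖z‖}.indicator (fun z => decay (‖z‖ / 2) ^ 2) z =
      48 * volume.real (ball (0 : E 3) 1) / d ^ 2 := by
  set f : ℝ → ℝ := (Ici d).indicator fun y => decay (y / 2) ^ 2 with hf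
  have hfe : ({z : E 3 | d ≤ ‖z‖}.indicator fun z => decay (‖z‖ / 2) ^ 2) = fun z => f ‖z‖ := by
    funext z
    simp only [hf, indicator, mem_ofPred_eq, mem_Ici]
  have hg : ∀ y ∈ Ioi (0:ℝ), y ^ (3 - 1) • f y =
      (Ici d).indicator (fun y => 32 * y ^ (-3 : ℝ)) y := by
    intro y hy
    have hy' : 0 < y := hy
    by_cases hyd : d ≤ y
    · rw [hf, indicator_of_mem (by exact hyd), indicator_of_mem (by exact hyd),
        decay_sq (by positivity), Real.rpow_neg hy'.le, smul_eq_mul]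
      norm_num
      field_simp
      norm_num
    · rw [hf, indicator_of_notMem (by exact hyd), indicator_of_notMem (by exact hyd), smul_zero]
  have hI : Ioi (0:ℝ) ∩ Ici d = Ici d := inter_eq_right.2 fun y hy => hd.trans_le hy
  have hint : IntegrableOn (fun y : ℝ => 32 * y ^ (-3 : ℝ)) (Ici d) := by
    rw [integrableOn_Ici_iff_integrableOn_Ioi]
    exact (integrableOn_Ioi_rpow_of_lt (by norm_num) hd).const_mul 32
  rw [hfe]
  constructor
  · rw [integrable_fun_norm_addHaar, finrank_euclideanSpace_fin,
      integrableOn_congr_fun hg measurableSet_Ioi, IntegrableOn,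
      integrable_indicator_iff measurableSet_Ici, IntegrableOn,
      Measure.restrict_restrict measurableSet_Ici, inter_comm, hI]
    exact hint
  · rw [integral_fun_norm_addHaar, finrank_euclideanSpace_fin,
      setIntegral_congr_fun measurableSet_Ioi hg, setIntegral_indicator measurableSet_Ici, hI,
      integral_Ici_eq_integral_Ioi, integral_const_mul,
      integral_Ioi_rpow_of_lt (by norm_num) hd, nsmul_eq_mul, smul_eq_mul]
    have : d ^ ((-3 : ℝ) + 1) = (d ^ 2)⁻¹ := by
      rw [show (-3 : ℝ) + 1 = -2 by norm_num, Real.rpow_neg hd.le]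
      norm_num
    rw [this]
    push_cast
    field_simp
    ring

/-! ### Perturbation of the Hardy quotient -/

lemma sq_add_le_mul_add {η : ℝ} (hη : 0 < η) (a b : ℝ) :
    (a + b) ^ 2 ≤ (1 + η) * a ^ 2 + (1 + η⁻¹) * b ^ 2 := by
  have h : (1 + η) * a ^ 2 + (1 + η⁻¹) * b ^ 2 - (a + b) ^ 2 = η⁻¹ * (η * a - b) ^ 2 := by
    field_simp
    ring
  have : 0 ≤ η⁻¹ * (η * a - b) ^ 2 := by positivity
  linarith

/-- Stability of the Dirichlet and Hardy integrals under a perturbation in `H¹₀`. -/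
lemma hardy_perturbation {u v : E 3 → ℝ} {G H : E 3 → E 3} (hu : MemH10 (ball (0 : E 3) 1) u G)
    (hv : MemH10 (ball (0 : E 3) 1) v H) {η ε : ℝ} (hη : 0 < η)
    (hε : ∫ x in ball (0 : E 3) 1, ‖H x - G x‖ ^ 2 ≤ ε) :
    (∫ x in ball (0 : E 3) 1, ‖H x‖ ^ 2) ≤
      (1 + η) * (∫ x in ball (0 : E 3) 1, ‖G x‖ ^ 2) + (1 + η⁻¹) * ε ∧
    (∫ x in ball (0 : E 3) 1, (‖x‖ ^ 2)⁻¹ * u x ^ 2) ≤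
      (1 + η) * (∫ x in ball (0 : E 3) 1, (‖x‖ ^ 2)⁻¹ * v x ^ 2) + (1 + η⁻¹) * (4 * ε) := by
  obtain ⟨hDu, hNu, -⟩ := hardy_integral le_rfl hu
  obtain ⟨hDv, hNv, -⟩ := hardy_integral le_rfl hv
  obtain ⟨hDe, hNe, hHe⟩ := hardy_integral le_rfl (hv.sub hu)
  have hη' : 0 < η⁻¹ := inv_pos.2 hη
  constructor
  · calc _ ≤ ∫ x in ball (0 : E 3) 1, ((1 + η) * ‖G x‖ ^ 2 + (1 + η⁻¹) * ‖H x - G x‖ ^ 2) := by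
          refine integral_mono hNv ((hNu.const_mul _).add (hNe.const_mul _)) fun x => ?_
          have h1 : ‖H x‖ ≤ ‖G x‖ + ‖H x - G x‖ := by
            simpa using norm_add_le (G x) (H x - G x)
          calc ‖H x‖ ^ 2 ≤ (‖G x‖ + ‖H x - G x‖) ^ 2 := by gcongr
            _ ≤ _ := sq_add_le_mul_add hη _ _
      _ = (1 + η) * (∫ x in ball (0 : E 3) 1, ‖G x‖ ^ 2) +
          (1 + η⁻¹) * ∫ x in ball (0 : E 3) 1, ‖H x - G x‖ ^ 2 := by
          rw [integral_add (hNu.const_mul _) (hNe.const_mul _), integral_const_mul,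
            integral_const_mul]
      _ ≤ _ := by gcongr
  -- Hardy's inequality with constant `1/4` controls the weighted norm of the difference by four
  -- times its energy; the radius `1/2` is arbitrary, the extra term being dropped.
  · have hD4 : (∫ x in ball (0 : E 3) 1, (‖x‖ ^ 2)⁻¹ * (v x - u x) ^ 2) ≤ 4 * ε := by
      have h1 := hHe (1 / 2) (by norm_num) (by norm_num)
      have h2 : 0 ≤ ∫ x in ball (0 : E 3) 1 ∩ {y | 1 / 2 ≤ ‖y‖},
          (‖x‖ ^ 2)⁻¹ * (v x - u x) ^ 2 := integral_nonneg fun x => by positivity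
      have h3 : 0 ≤ (1 / (2 * (2 - Real.log (1 / 2)))) ^ 2 *
          ∫ x in ball (0 : E 3) 1 ∩ {y | 1 / 2 ≤ ‖y‖},
          (‖x‖ ^ 2)⁻¹ * (v x - u x) ^ 2 := by positivity
      have h4 : (((3:ℕ):ℝ) - 2) ^ 2 / 4 = 1 / 4 := by norm_num
      rw [h4] at h1
      linarith
    calc _ ≤ ∫ x in ball (0 : E 3) 1, ((1 + η) * ((‖x‖ ^ 2)⁻¹ * v x ^ 2) +
            (1 + η⁻¹) * ((‖x‖ ^ 2)⁻¹ * (v x - u x) ^ 2)) := by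
          refine integral_mono hDu ((hDv.const_mul _).add (hDe.const_mul _)) fun x => ?_
          have h1 := sq_add_le_mul_add hη (v x) (-(v x - u x))
          have h2 : v x + -(v x - u x) = u x := by ring
          rw [h2, neg_sq] at h1
          have h3 : 0 ≤ (‖x‖ ^ 2)⁻¹ := by positivity
          calc (‖x‖ ^ 2)⁻¹ * u x ^ 2 ≤ (‖x‖ ^ 2)⁻¹ *
                ((1 + η) * v x ^ 2 + (1 + η⁻¹) * (v x - u x) ^ 2) := by gcongr
            _ = _ := by ring
      _ = (1 + η) * (∫ x in ball (0 : E 3) 1, (‖x‖ ^ 2)⁻¹ * v x ^ 2) +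
          (1 + η⁻¹) * ∫ x in ball (0 : E 3) 1, (‖x‖ ^ 2)⁻¹ * (v x - u x) ^ 2 := by
          rw [integral_add (hDv.const_mul _) (hDe.const_mul _), integral_const_mul,
            integral_const_mul]
      _ ≤ _ := by gcongr

/-- Algebraic core of the upper bound: closeness of the Hardy and Dirichlet integrals of two
functions turns into closeness of their quotients. -/
lemma quotient_le_of_perturbation {N N' D D' W c q Q η : ℝ} (hW : 0 < W) (hc : 0 ≤ c) (hq : 0 ≤ q)
    (hqQ : q ≤ Q) (hη : 0 < η) (hη1 : η ≤ 1) (hcη : 16 * c * η ≤ 1) (hWD : W ≤ D)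
    (hN : N ≤ q * D) (hN' : N' ≤ (1 + η) * N + (1 + η⁻¹) * (c * W * η ^ 2))
    (hD' : D ≤ (1 + η) * D' + (1 + η⁻¹) * (4 * (c * W * η ^ 2))) :
    0 < D' ∧ N' / D' ≤ q + (3 * Q + 64 * c * Q + 8 * c) * η := by
  have hQ : 0 ≤ Q := hq.trans hqQ
  have e1 : (1 + η⁻¹) * (c * W * η ^ 2) ≤ 2 * (c * W * η) := by
    have : (1 + η⁻¹) * (c * W * η ^ 2) = (1 + η) * (c * W * η) := by field_simp; ring
    rw [this]
    gcongr
    linarith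
  set m := c * W * η with hmdef
  have hm : 0 ≤ m := by positivity
  have hmW : 16 * m ≤ W := by nlinarith
  have hD2 : D ≤ (1 + η) * D' + 8 * m := by linarith
  have hN2 : N' ≤ (1 + η) * N + 2 * m := by linarith
  have hpos : 0 < D' := by
    by_contra hle
    have : (1 + η) * D' ≤ 0 := mul_nonpos_of_nonneg_of_nonpos (by positivity) (not_lt.1 hle)
    linarith
  -- This makes every error, a multiple of `W η`, relative to the new denominator `D'`.
  have hW4 : W ≤ 4 * D' := by nlinarith
  have hm4 : m ≤ 4 * c * η * D' := by
    have : c * η * W ≤ c * η * (4 * D') := by gcongr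
    rw [hmdef]; linarith
  refine ⟨hpos, ?_⟩
  rw [div_le_iff₀ hpos]
  have h3 : (1 + η) * N ≤ (1 + η) * (q * ((1 + η) * D' + 8 * m)) := by
    gcongr
    exact hN.trans (by gcongr)
  have h4 : (1 + η) ^ 2 ≤ 1 + 3 * η := by nlinarith
  have h5 : (1 + η) * (q * ((1 + η) * D' + 8 * m)) ≤ q * (1 + 3 * η) * D' + 16 * (Q * m) := by
    have h6 : (1 + η) ^ 2 * (q * D') ≤ (1 + 3 * η) * (q * D') := by gcongr
    have h7 : (1 + η) * (q * (8 * m)) ≤ 2 * (Q * (8 * m)) := by gcongr; linarith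
    linarith
  have h8 : Q * m ≤ Q * (4 * c * η * D') := by gcongr
  have h9 : q * (η * D') ≤ Q * (η * D') := by gcongr
  linarith

/-- An upper bound for the discrete Hardy constant in terms of an inner cut-off radius `r` and a
logarithmic length `L`. -/
lemma exists_hardyQuotient_le : ∃ K : ℝ, 0 < K ∧ ∀ σ τ : ℝ, ∃ K' : ℝ, 0 < K' ∧
    ∀ (h r L : ℝ) (𝒯 : Triangulation 3), 0 < h → IsBallMesh 𝒯 h σ τ → h ≤ 1 / 4 →
      ENNReal.ofReal (h ^ 2) < volume (ball (0 : E 3) (3 / 4)) → 0 < r → 4 ≤ L →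
      r * Real.exp L ≤ 1 / 2 → h ≤ r / 4 → K' * (h / r) ≤ 1 →
      ∃ q ∈ 𝒯.hardyQuotients,
        q ≤ 1 / 4 + Real.pi ^ 2 / L ^ 2 + K / L ^ 3 + K' * (h / r) := by
  obtain ⟨K, hK, hrad⟩ := exists_radial_test
  refine ⟨K, hK, fun σ τ => ?_⟩
  -- From `(2 |σ τ| K h)² · 48 W / (r/2)²`, where `4 · 48 · 4 = 768`. Next, `Q` bounds the quotient
  -- of `u` for every `L ≥ 4`.
  set c : ℝ := 768 * (σ * τ * K) ^ 2 with hc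
  set Q : ℝ := 1 / 4 + Real.pi ^ 2 / 4 ^ 2 + K / 4 ^ 3 with hQ
  have hc0 : 0 ≤ c := by positivity
  have hQ0 : 0 < Q := by positivity
  -- The perturbation needs only `8 c`; with `16 c`, the hypothesis `K' (h/r) ≤ 1` also yields the
  -- smallness condition `16 c η ≤ 1`.
  refine ⟨3 * Q + 64 * c * Q + 16 * c, by positivity,
    fun h r L 𝒯 hh hm hh4 hvol hr hL hrL hhr hsmall => ?_⟩
  obtain ⟨u, htest, hout, htay, hD, hN⟩ := hrad r L hr hL hrL
  set η := h / r with hη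
  have hη0 : 0 < η := by positivity
  set W := volume.real (ball (0 : E 3) 1) with hW
  set v := 𝒯.interp u with hv
  obtain ⟨hvH, hvfe⟩ := hm.interp_mem hh4 (c := u) fun p hp => hout p hp.le
  have huH := htest.memH10 isOpen_ball measure_ball_lt_top.ne
  have herr := hm.norm_gradient_interp_sub_le (by norm_num) hh (hm.ball_subset_domain hh4 hvol)
    hout (htay h hhr)
  obtain ⟨hint, hival⟩ := integral_indicator_decay_sq (d := r / 2) (by positivity)
  have hε : ∫ x in ball (0 : E 3) 1, ‖gradient v x - gradient u x‖ ^ 2 ≤ c * W * η ^ 2 := by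
    set I : E 3 → ℝ := {z : E 3 | r / 2 ≤ ‖z‖}.indicator (fun z => decay (‖z‖ / 2) ^ 2) with hI
    have hI0 : ∀ x, 0 ≤ I x := fun x => indicator_nonneg (fun z _ => sq_nonneg _) x
    calc _ ≤ ∫ x in ball (0 : E 3) 1, (2 * |σ * τ| * K * h) ^ 2 * I x := by
          refine integral_mono_ae (hardy_integral le_rfl (hvH.sub huH)).2.1
            (hint.integrableOn.const_mul _) ?_
          filter_upwards [ae_restrict_of_ae herr] with x hx
          calc ‖gradient v x - gradient u x‖ ^ 2 ≤ _ := pow_le_pow_left₀ (norm_nonneg _) hx 2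
            _ = _ := by
              by_cases hxr : r / 2 ≤ ‖x‖
              · rw [hI, indicator_of_mem (by exact hxr), indicator_of_mem (by exact hxr)]
                ring
              · rw [hI, indicator_of_notMem (by exact hxr), indicator_of_notMem (by exact hxr)]
                ring
      _ ≤ ∫ x, (2 * |σ * τ| * K * h) ^ 2 * I x :=
          setIntegral_le_integral (hint.const_mul _)
            (Eventually.of_forall fun x => mul_nonneg (sq_nonneg _) (hI0 x))
      _ = (2 * |σ * τ| * K * h) ^ 2 * (48 * W / (r / 2) ^ 2) := by
          rw [integral_const_mul, hival]
      _ = c * W * η ^ 2 := by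
          rw [hc, hη, mul_pow, mul_pow, mul_pow, sq_abs]
          field_simp
          ring
  obtain ⟨hp1, hp2⟩ := hardy_perturbation huH hvH hη0 hε
  have hL0 : 0 < L := by linarith
  obtain ⟨hpos, hle⟩ := quotient_le_of_perturbation (Q := Q) (volume_real_ball_pos 3) hc0
    (q := 1 / 4 + Real.pi ^ 2 / L ^ 2 + K / L ^ 3) (by positivity) (by rw [hQ]; gcongr) hη0
    (by rw [hη, div_le_one hr]; linarith)
    (by
      have : 16 * c * η ≤ (3 * Q + 64 * c * Q + 16 * c) * η := by
        gcongr
        have : 0 ≤ 64 * c * Q := by positivity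
        linarith
      linarith) hD hN hp1 hp2
  refine ⟨_, ⟨v, gradient v, hvfe, ?_, hvH, rfl⟩, hle.trans ?_⟩
  · intro h0
    rw [← hv, h0] at hpos
    simp at hpos
  · gcongr
    linarith

/-! ### Choice of the cut-off radius and of the logarithmic length -/

lemma tendsto_log_length : Tendsto (fun t : ℝ => (t - 3 * Real.log t - Real.log 2) / t) atTop
    (𝓝 1) := by
  have h1 : Tendsto (fun t : ℝ => Real.log t / t) atTop (𝓝 0) :=
    Real.isLittleO_log_id_atTop.tendsto_div_nhds_zero
  have h2 : Tendsto (fun t : ℝ => Real.log 2 / t) atTop (𝓝 0) :=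
    tendsto_const_nhds.div_atTop tendsto_id
  have h3 := (tendsto_const_nhds (x := (1:ℝ))).sub (h1.const_mul 3) |>.sub h2
  rw [mul_zero, sub_zero, sub_zero] at h3
  refine h3.congr' ?_
  filter_upwards [eventually_gt_atTop 0] with t ht
  field_simp

/-- As `L/t → 1`, the difference `π²/L² - π²/t²` is `o(t⁻²)`, and the cubic terms are smaller still.
-/
lemma tendsto_remainder (K K' : ℝ) : Tendsto (fun t : ℝ =>
    t ^ 2 * (Real.pi ^ 2 / (t - 3 * Real.log t - Real.log 2) ^ 2 - Real.pi ^ 2 / t ^ 2 +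
      K / (t - 3 * Real.log t - Real.log 2) ^ 3 + K' / t ^ 3)) atTop (𝓝 0) := by
  have h1 := tendsto_log_length.inv₀ one_ne_zero
  have h2 : Tendsto (fun t : ℝ => t⁻¹) atTop (𝓝 0) := tendsto_inv_atTop_zero
  have h3 := ((((h1.pow 2).sub_const 1).const_mul (Real.pi ^ 2)).add
    (((h1.pow 3).mul h2).const_mul K)).add (h2.const_mul K')
  norm_num at h3
  refine h3.congr' ?_
  filter_upwards [eventually_gt_atTop 0, tendsto_log_length.eventually_const_lt zero_lt_one]
    with t ht hlt
  have hL : t - 3 * Real.log t - Real.log 2 ≠ 0 := fun h0 => by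
    rw [h0, zero_div] at hlt
    exact hlt.false
  field_simp

/-- The upper bound for the discrete Hardy constant in dimension three. -/
theorem hardyQuotient_upper_bound (σ τ : ℝ) : ∃ (h₀ : ℝ) (r : ℝ → ℝ), 0 < h₀ ∧
    (r =o[𝓝[>] (0 : ℝ)] fun h => 1 / |Real.log h| ^ 2) ∧
    ∀ (h : ℝ) (𝒯 : Triangulation 3), 0 < h → h < h₀ → IsBallMesh 𝒯 h σ τ →
      ∃ q ∈ 𝒯.hardyQuotients, q ≤ 1 / 4 + Real.pi ^ 2 / |Real.log h| ^ 2 + r h := by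
  obtain ⟨K, hK, hrest⟩ := exists_hardyQuotient_le
  obtain ⟨K', hK', hq⟩ := hrest σ τ
  obtain ⟨h₁, hh₁, hsize⟩ := exists_mesh_size_bound 3
  set R : ℝ → ℝ := fun t =>
    Real.pi ^ 2 / (t - 3 * Real.log t - Real.log 2) ^ 2 - Real.pi ^ 2 / t ^ 2 +
      K / (t - 3 * Real.log t - Real.log 2) ^ 3 + K' / t ^ 3 with hR
  have habs : Tendsto (fun h : ℝ => |Real.log h|) (𝓝[>] 0) atTop :=
    tendsto_abs_atBot_atTop.comp Real.tendsto_log_nhdsGT_zero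
  have hev : ∀ᶠ t : ℝ in atTop, 4 ≤ t ∧ 4 ≤ t - 3 * Real.log t - Real.log 2 ∧ K' ≤ t := by
    filter_upwards [eventually_ge_atTop 8, eventually_ge_atTop K',
      tendsto_log_length.eventually_const_le (show (1 / 2 : ℝ) < 1 by norm_num)] with t h1 h2 h3
    rw [le_div_iff₀ (by linarith)] at h3
    exact ⟨by linarith, by linarith, h2⟩
  have hev2 : ∀ᶠ h : ℝ in 𝓝[>] 0, 4 ≤ |Real.log h| ∧
      4 ≤ |Real.log h| - 3 * Real.log |Real.log h| - Real.log 2 ∧ K' ≤ |Real.log h| :=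
    habs.eventually hev
  obtain ⟨h₂, hh₂, hlog⟩ := (mem_nhdsGT_iff_exists_Ioo_subset).1 hev2
  have hh₂' : 0 < h₂ := hh₂
  refine ⟨min h₁ (min h₂ 1), fun h => R |Real.log h|, by positivity, ?_, ?_⟩
  · have hne : ∀ᶠ h : ℝ in 𝓝[>] 0, 1 / |Real.log h| ^ 2 = 0 → R |Real.log h| = 0 := by
      filter_upwards [hev2] with h hh h0
      have : 0 < |Real.log h| := by linarith [hh.1]
      have : 0 < 1 / |Real.log h| ^ 2 := by positivity
      linarith
    rw [Asymptotics.isLittleO_iff_tendsto' hne]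
    refine ((tendsto_remainder K K').comp habs).congr fun h => ?_
    simp only [Function.comp_apply, hR, one_div, div_inv_eq_mul]
    ring
  · intro h 𝒯 hh hlt hm
    obtain ⟨hlt1, hlt2, hlt3⟩ : h < h₁ ∧ h < h₂ ∧ h < 1 := by simpa using hlt
    obtain ⟨ht4, hL4, hKt⟩ := hlog ⟨hh, hlt2⟩
    obtain ⟨hh4, hvol⟩ := hsize h hh hlt1
    have hlogh : |Real.log h| = -Real.log h := abs_of_neg (Real.log_neg hh hlt3)
    set t := |Real.log h| with ht
    have ht0 : 0 < t := by linarith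
    have hexp : Real.exp (t - 3 * Real.log t - Real.log 2) = (h * t ^ 3 * 2)⁻¹ := by
      have : t - 3 * Real.log t - Real.log 2 = -Real.log (h * t ^ 3 * 2) := by
        rw [Real.log_mul (by positivity) (by norm_num), Real.log_mul hh.ne' (by positivity),
          Real.log_pow, hlogh]
        push_cast
        ring
      rw [this, Real.exp_neg, Real.exp_log (by positivity)]
    have hη : h / (h * t ^ 3) = 1 / t ^ 3 := by field_simp
    have ht3 : t ≤ t ^ 3 := le_self_pow₀ (by linarith) (by norm_num)
    -- With `r = h t³` the interpolation error is `h/r = t⁻³`, negligible against `t⁻²`, while `r`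
    -- costs only `3 log t` in length. This `L` gives `r e^L = 1/2` exactly.
    obtain ⟨q, hq1, hq2⟩ := hq h (h * t ^ 3) (t - 3 * Real.log t - Real.log 2) 𝒯 hh hm hh4 hvol
      (by positivity) hL4 (by rw [hexp]; field_simp; norm_num) (by nlinarith)
      (by rw [hη, mul_one_div, div_le_one (by positivity)]; linarith)
    refine ⟨q, hq1, hq2.trans (le_of_eq ?_)⟩
    rw [hη, hR]
    ring

end HardyFEM

end

theorem theorem1p3 :
    (∃ C : ℝ, 0 < C ∧ ∀ σ τ : ℝ, ∃ (h₀ : ℝ) (r : ℝ → ℝ), 0 < h₀ ∧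
      (r =o[𝓝[>] (0 : ℝ)] fun h => 1 / |Real.log h| ^ 2) ∧
      ∀ (h : ℝ) (𝒯 : HardyFEM.Triangulation 3), 0 < h → h < h₀ →
        HardyFEM.IsBallMesh 𝒯 h σ τ →
        ∃ S : ℝ, IsLeast 𝒯.hardyQuotients S ∧
          1 / 4 + C / |Real.log h| ^ 2 ≤ S ∧
          S ≤ 1 / 4 + Real.pi ^ 2 / |Real.log h| ^ 2 + r h) ∧
    (∀ n : ℕ, 3 ≤ n → ∃ C : ℝ, 0 < C ∧ ∀ σ τ : ℝ, ∃ h₀ : ℝ, 0 < h₀ ∧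
      ∀ (h : ℝ) (𝒯 : HardyFEM.Triangulation n), 0 < h → h < h₀ →
        HardyFEM.IsBallMesh 𝒯 h σ τ →
        ∃ S : ℝ, IsLeast 𝒯.hardyQuotients S ∧
          ((n : ℝ) - 2) ^ 2 / 4 + C / |Real.log h| ^ 2 ≤ S) := by
  have hlow : ∀ n : ℕ, 3 ≤ n → ∃ C : ℝ, 0 < C ∧ ∀ σ τ : ℝ, ∃ h₀ : ℝ, 0 < h₀ ∧
      ∀ (h : ℝ) (𝒯 : HardyFEM.Triangulation n), 0 < h → h < h₀ →
        HardyFEM.IsBallMesh 𝒯 h σ τ →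
        ∃ S : ℝ, IsLeast 𝒯.hardyQuotients S ∧
          ((n : ℝ) - 2) ^ 2 / 4 + C / |Real.log h| ^ 2 ≤ S := by
    intro n hn
    obtain ⟨C, hC, hbound⟩ := HardyFEM.hardyQuotient_lower_bound hn
    obtain ⟨h₁, hh₁, hsize⟩ := HardyFEM.exists_mesh_size_bound n
    refine ⟨C, hC, fun σ τ => ?_⟩
    obtain ⟨h₂, hh₂, hle⟩ := hbound σ τ
    refine ⟨min h₁ h₂, lt_min hh₁ hh₂, fun h 𝒯 hh hlt hm => ?_⟩
    obtain ⟨h4, hvol⟩ := hsize h hh (hlt.trans_le (min_le_left _ _))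
    obtain ⟨S, hS⟩ := hm.exists_isLeast hn hh (hm.exists_ne_zero h4 hvol)
    exact ⟨S, hS, hle h 𝒯 hh (hlt.trans_le (min_le_right _ _)) hm S hS.1⟩
  refine ⟨?_, hlow⟩
  obtain ⟨C, hC, hbound⟩ := hlow 3 le_rfl
  refine ⟨C, hC, fun σ τ => ?_⟩
  obtain ⟨h₁, hh₁, hle⟩ := hbound σ τ
  obtain ⟨h₂, r, hh₂, hr, hup⟩ := HardyFEM.hardyQuotient_upper_bound σ τ
  refine ⟨min h₁ h₂, r, lt_min hh₁ hh₂, hr, fun h 𝒯 hh hlt hm => ?_⟩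
  obtain ⟨S, hS, hlo⟩ := hle h 𝒯 hh (hlt.trans_le (min_le_left _ _)) hm
  obtain ⟨q, hq, hqle⟩ := hup h 𝒯 hh (hlt.trans_le (min_le_right _ _)) hm
  refine ⟨S, hS, ?_, (hS.2 hq).trans hqle⟩
  have h3 : (((3 : ℕ) : ℝ) - 2) ^ 2 / 4 = 1 / 4 := by norm_num
  rwa [h3] at hlo
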